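/- **Setting.** Let $M$ be a connected $C^\infty$-manifold of dimension $n+1\ge 3$, and let $L:TM\to\mathbb R$ be a Lorentz–Finsler structure: $L$ is $C^\infty$ on $TM\setminus\{0\}$, $L(cv)=c^2L(v)$ for $c>0$, and for every $v\ne 0$ the matrix $g_{\alpha\beta}(v)=\partial^2L/\partial v^\alpha\partial v^\beta(v)$ is non-degenerate of signature $(-,+,\dots,+)$; it defines the Lorentzian metric $g_v$ on $T_xM$. Assume that $(M,L)$ is time oriented by a smooth vector field $X$ with $L(X)<0$. Put $\Omega'_x=\{v\in T_xM: L(v)<0\}$. The future-directed causal vectors at $x$ are the elements of the connected component of $\overline{\Omega'_x}\setminus\{0\}$ containing $X(x)$; they are lightlike if $L(v)=0$. Let $\psi$ be a $C^\infty$, positively $0$-homogeneous function on the bundle of future-directed causal vectors. With $\widetilde\Gamma^\alpha_{\beta\gamma}=\frac12\sum_\delta g^{\alpha\delta}(\partial_{x^\beta}g_{\delta\gamma}+\partial_{x^\gamma}g_{\beta\delta}-\partial_{x^\delta}g_{\beta\gamma})$, $G^\alpha=\frac12\sum\widetilde\Gamma^\alpha_{\beta\gamma}v^\beta v^\gamma$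 and $N^\alpha_\beta=\partial G^\alpha/\partial v^\beta$, geodesics are the smooth solutions of $\ddot\eta^\alpha+2G^\alpha(\dot\eta)=0$; a lightlike geodesic is one whose velocity is future-directed and lightlike. The curvature endomorphism is $R_v(w)=\sum R^\alpha_\beta(v)w^\beta\partial_{x^\alpha}$ with $$R^\alpha_\beta=2\frac{\partial G^\alpha}{\partial x^\beta}-\sum_\gamma\Big(\frac{\partial N^\alpha_\beta}{\partial x^\gamma}v^\gamma-2\frac{\partial N^\alpha_\beta}{\partial v^\gamma}G^\gamma\Big)-\sum_\gamma N^\alpha_\gamma N^\gamma_\beta ,$$ and $\mathrm{Ric}(v)=\mathrm{trace}\,R_v$. Jacobi fields along a geodesic $\eta$ are the smooth solutions $Y$ of $D^{\dot\eta}_{\dot\eta}D^{\dot\eta}_{\dot\eta}Y+R_{\dot\eta}(Y)=0$, where $D$ is the covariant derivative of the Chern connection with reference vector $\dot\eta$. A geodesic has a pair of conjugate points if some nontrivial Jacobi field along it vanishes at two distinct parameters. For a future-directed causal vector $v$, let $\eta$ be the geodesic with $\dot\eta(0)=v$ and $\psi_\eta(t)=\psi(\dot\eta(t))$. Put $\mathrm{Ric}_N(v)=\mathrm{Ric}(v)+\psi_\eta''(0)-\frac{\psi_\eta'(0)^2}{N-n}$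 for $N\in\mathbb R\setminus\{n\}$, $\mathrm{Ric}_\infty(v)=\mathrm{Ric}(v)+\psi_\eta''(0)$, and $\mathrm{Ric}_n(v)=\mathrm{Ric}(v)+\psi_\eta''(0)$ if $\psi_\eta'(0)=0$, $\mathrm{Ric}_n(v)=-\infty$ otherwise. A geodesic $\eta:(a,b)\to M$, $-\infty\le a<b\le+\infty$, is inextendible if $\eta(t)$ converges neither as $t\to a$ nor as $t\to b$. An inextendible lightlike geodesic is $\epsilon$-complete if $\tau_\epsilon(t)=\int_{t_0}^t e^{\frac{2(\epsilon-1)}{n-1}\psi_\eta(s)}\,ds$ (with $t_0\in(a,b)$) tends to $+\infty$ as $t\to b$ and to $-\infty$ as $t\to a$; a lightlike geodesic is $\epsilon$-incomplete if it is not $\epsilon$-complete. **Theorem.** Let $(M,L,\psi)$ be as above, with $\dim M=n+1\ge 3$, and let $N\in(-\infty,1)\cup[n,+\infty]$. Assume * (null genericity) along every inextendible lightlike geodesic $\eta:(a,b)\to M$ there is $t_1\in(a,b)$ such that the endomorphism induced by $R_{\dot\eta(t_1)}$ on $\{w: g_{\dot\eta(t_1)}(\dot\eta(t_1),w)=0\}/\mathbb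 R\dot\eta(t_1)$ is nonzero; * (null $N$-convergence) $\mathrm{Ric}_N(v)\ge 0$ for every future-directed lightlike vector $v$. Then every future-directed lightlike geodesic $\eta:(a,b)\to M$ either has a pair of conjugate points or is $\epsilon$-incomplete for every $\epsilon\in\mathbb R$ in the null range, that is, for every $\epsilon$ with $|\epsilon|<\sqrt{(N-1)/(N-n)}$ (read as $|\epsilon|<1$ if $N=+\infty$, and as no condition on $\epsilon$ if $N=n$). -/

import Mathlib

open Set Filter Topology
open scoped Manifold ContDiff

noncomputable section

namespace FinslerST

/-! ### Local coordinate formulas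

`ℓ x v` is the coordinate expression of a Lagrangian on a chart domain of `TM`; `x` is the position
and `v` the vector of fibre coordinates. Indices run over `Fin (n + 1)`, that is `0, 1, …, n`. -/

/-- The model space `ℝⁿ⁺¹`. -/
abbrev Model (n : ℕ) : Type := EuclideanSpace ℝ (Fin (n + 1))

section Coordinates

variable {n : ℕ}

/-- The `α`-th coordinate vector. -/
def coordVec (α : Fin (n + 1)) : Model n := EuclideanSpace.single α (1 : ℝ)

/-- `∂f/∂x^α`. -/
def pdx (α : Fin (n + 1)) (f : Model n → Model n → ℝ) (x v : Model n) : ℝ :=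
  fderiv ℝ (fun y => f y v) x (coordVec α)

/-- `∂f/∂v^α`. -/
def pdv (α : Fin (n + 1)) (f : Model n → Model n → ℝ) (x v : Model n) : ℝ :=
  fderiv ℝ (fun w => f x w) v (coordVec α)

/-- `g_{αβ}(v) = ∂²L/∂v^α∂v^β`. -/
def gLow (ℓ : Model n → Model n → ℝ) (α β : Fin (n + 1)) : Model n → Model n → ℝ :=
  pdv α (pdv β ℓ)

/-- The inverse matrix `g^{αβ}(v)`. -/
def gUp (ℓ : Model n → Model n → ℝ) (α β : Fin (n + 1)) (x v : Model n) : ℝ :=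
  (Matrix.of fun μ ν => gLow ℓ μ ν x v)⁻¹ α β

/-- The formal Christoffel symbols `Γ̃^α_{βγ}(v)`. -/
def formalChristoffel (ℓ : Model n → Model n → ℝ) (α β γ : Fin (n + 1)) (x v : Model n) : ℝ :=
  (1 / 2) * ∑ δ, gUp ℓ α δ x v *
    (pdx β (gLow ℓ δ γ) x v + pdx γ (gLow ℓ β δ) x v - pdx δ (gLow ℓ β γ) x v)

/-- The geodesic spray coefficients `G^α(v) = (1/2) ∑ Γ̃^α_{βγ}(v) v^β v^γ`. -/
def sprayCoeff (ℓ : Model n → Model n → ℝ) (α : Fin (n + 1)) (x v : Model n) : ℝ :=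
  (1 / 2) * ∑ β, ∑ γ, formalChristoffel ℓ α β γ x v * v β * v γ

/-- The nonlinear connection `N^α_β(v) = ∂G^α/∂v^β`. -/
def nonlinConn (ℓ : Model n → Model n → ℝ) (α β : Fin (n + 1)) : Model n → Model n → ℝ :=
  pdv β (sprayCoeff ℓ α)

/-- The coefficients `Γ^α_{βγ}(v)` of the Chern connection. -/
def chern (ℓ : Model n → Model n → ℝ) (α β γ : Fin (n + 1)) (x v : Model n) : ℝ :=
  formalChristoffel ℓ α β γ x v - (1 / 2) * ∑ δ, ∑ μ, gUp ℓ α δ x v *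
    (pdv μ (gLow ℓ δ γ) x v * nonlinConn ℓ μ β x v
      + pdv μ (gLow ℓ β δ) x v * nonlinConn ℓ μ γ x v
      - pdv μ (gLow ℓ β γ) x v * nonlinConn ℓ μ δ x v)

/-- The curvature coefficients `R^α_β(v)`. -/
def curvCoeff (ℓ : Model n → Model n → ℝ) (α β : Fin (n + 1)) (x v : Model n) : ℝ :=
  2 * pdx β (sprayCoeff ℓ α) x v
    - ∑ γ, (pdx γ (nonlinConn ℓ α β) x v * v γ
        - 2 * pdv γ (nonlinConn ℓ α β) x v * sprayCoeff ℓ γ x v)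
    - ∑ γ, nonlinConn ℓ α γ x v * nonlinConn ℓ γ β x v

/-- The vector `∑ Γ^α_{βγ}(v) v^β y^γ ∂/∂x^α`. -/
def chernTerm (ℓ : Model n → Model n → ℝ) (x v y : Model n) : Model n :=
  ∑ α, (∑ β, ∑ γ, chern ℓ α β γ x v * v β * y γ) • coordVec α

/-- The vector `∑ R^α_β(v) w^β ∂/∂x^α`. -/
def curvTerm (ℓ : Model n → Model n → ℝ) (x v w : Model n) : Model n :=
  ∑ α, (∑ β, curvCoeff ℓ α β x v * w β) • coordVec α

end Coordinates

/-! ### Lorentz–Finsler manifolds, spacetimes and weights -/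

/-- The tangent bundle of an `(n+1)`-dimensional manifold. Recall that in Mathlib the fibre
`TangentSpace 𝓘(ℝ, Model n) x` is `Model n`, a tangent vector at `x` being represented by its
components in the preferred chart `chartAt _ x`. -/
abbrev TM (n : ℕ) (M : Type*) [TopologicalSpace M] [ChartedSpace (Model n) M] :=
  TangentBundle 𝓘(ℝ, Model n) M

/-- A symmetric bilinear form on `ℝⁿ⁺¹` is non-degenerate of signature `(-,+,…,+)`: it has a basis
in which its matrix is `diag(-1,1,…,1)`. -/
def IsLorentzian {n : ℕ} (B : Model n → Model n → ℝ) : Prop :=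
  ∃ b : Module.Basis (Fin (n + 1)) ℝ (Model n),
    ∀ i j, B (b i) (b j) = if i = j then (if i = 0 then -1 else 1) else 0

/-- The Hessian of a Lagrangian `L` along the fibre `T_xM` at `v`, i.e. `g_v(a,b)`. -/
def fibreHess {n : ℕ} {M : Type*} [TopologicalSpace M] [ChartedSpace (Model n) M]
    (L : TM n M → ℝ) (x : M) (v a b : Model n) : ℝ :=
  fderiv ℝ (fderiv ℝ (fun u : Model n => L ⟨x, u⟩)) v a b

/-- A Lorentz–Finsler structure (in Beem's sense) on `M`. -/
structure LorentzFinsler (n : ℕ) (M : Type*) [TopologicalSpace M] [ChartedSpace (Model n) M]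
    [IsManifold 𝓘(ℝ, Model n) ∞ M] where
  L : TM n M → ℝ
  smooth : ContMDiffOn 𝓘(ℝ, Model n).tangent 𝓘(ℝ, ℝ) ∞ L {v | v.2 ≠ 0}
  homogeneous : ∀ (x : M) (v : TangentSpace 𝓘(ℝ, Model n) x) (c : ℝ), 0 < c →
    L ⟨x, c • v⟩ = c ^ 2 * L ⟨x, v⟩
  lorentzian : ∀ (x : M) (v : Model n), v ≠ 0 → IsLorentzian (fibreHess L x v)

/-- A Finsler spacetime: a Lorentz–Finsler manifold time oriented by a smooth timelike
vector field `X`. -/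
structure FinslerSpacetime (n : ℕ) (M : Type*) [TopologicalSpace M] [ChartedSpace (Model n) M]
    [IsManifold 𝓘(ℝ, Model n) ∞ M] extends LorentzFinsler n M where
  X : ∀ x : M, TangentSpace 𝓘(ℝ, Model n) x
  X_smooth : ContMDiff 𝓘(ℝ, Model n) 𝓘(ℝ, Model n).tangent ∞ (fun x => (⟨x, X x⟩ : TM n M))
  X_timelike : ∀ x : M, L ⟨x, X x⟩ < 0

section Spacetime

variable {n : ℕ} {M : Type*} [TopologicalSpace M] [ChartedSpace (Model n) M]
  [IsManifold 𝓘(ℝ, Model n) ∞ M]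

/-- The set of all timelike vectors `Ω'_x`. -/
def LorentzFinsler.timelikeCone (S : LorentzFinsler n M) (x : M) : Set (Model n) :=
  {u : Model n | S.L ⟨x, u⟩ < 0}

/-- The future-directed causal vectors at `x` (the set `closure Ω_x \ {0}`): the connected component
of `closure Ω'_x \ {0}` that contains `X(x)`. -/
def FinslerSpacetime.futureCone (S : FinslerSpacetime n M) (x : M) : Set (Model n) :=
  connectedComponentIn (closure (S.timelikeCone x) \ {0}) (S.X x)

/-- The bundle of future-directed causal vectors. -/
def FinslerSpacetime.futureBundle (S : FinslerSpacetime n M) : Set (TM n M) :=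
  {v | (v.2 : Model n) ∈ S.futureCone v.1}

/-- A weighted Finsler spacetime `(M, L, ψ)`. Only the values of `ψ` on the bundle of future-directed
causal vectors are constrained, and only those are used. -/
structure WeightedSpacetime (n : ℕ) (M : Type*) [TopologicalSpace M] [ChartedSpace (Model n) M]
    [IsManifold 𝓘(ℝ, Model n) ∞ M] extends FinslerSpacetime n M where
  ψ : TM n M → ℝ
  ψ_smooth : ContMDiffOn 𝓘(ℝ, Model n).tangent 𝓘(ℝ, ℝ) ∞ ψ toFinslerSpacetime.futureBundle
  ψ_homogeneous : ∀ (x : M) (v : TangentSpace 𝓘(ℝ, Model n) x) (c : ℝ), 0 < c →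
    (⟨x, v⟩ : TM n M) ∈ toFinslerSpacetime.futureBundle → ψ ⟨x, c • v⟩ = ψ ⟨x, v⟩

/-! ### Geodesics -/

/-- The standard bundle chart `(x^α, v^β)` of `TM` induced by the preferred chart at `p`. -/
def bundleChart (n : ℕ) {M : Type*} [TopologicalSpace M] [ChartedSpace (Model n) M]
    [IsManifold 𝓘(ℝ, Model n) ∞ M] (p : M) : PartialEquiv (TM n M) (Model n × Model n) :=
  extChartAt 𝓘(ℝ, Model n).tangent (⟨p, 0⟩ : TM n M)

/-- The expression of `L` in the standard bundle chart induced by the preferred chart at `p`. -/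
def LorentzFinsler.localL (S : LorentzFinsler n M) (p : M) (x v : Model n) : ℝ :=
  S.L ((bundleChart n p).symm (x, v))

/-- The velocity `η̇(t)`, as an element of `T_{η(t)}M`. -/
def velocity (n : ℕ) {M : Type*} [TopologicalSpace M] [ChartedSpace (Model n) M]
    (η : ℝ → M) (t : ℝ) : TangentSpace 𝓘(ℝ, Model n) (η t) :=
  mfderiv 𝓘(ℝ, ℝ) 𝓘(ℝ, Model n) η t (1 : ℝ)

/-- The lift `t ↦ (η(t), η̇(t))` of a curve to `TM`. -/
def lift (n : ℕ) {M : Type*} [TopologicalSpace M] [ChartedSpace (Model n) M]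
    (η : ℝ → M) (t : ℝ) : TM n M :=
  ⟨η t, velocity n η t⟩

/-- The geodesic equation `η̈^α + ∑ Γ̃^α_{βγ}(η̇) η̇^β η̇^γ = 0` at time `t`, in the coordinates given
by any preferred chart around `η(t)`. -/
def LorentzFinsler.GeodesicEqAt (S : LorentzFinsler n M) (η : ℝ → M) (t : ℝ) : Prop :=
  ∀ p : M, η t ∈ (chartAt (Model n) p).source →
    let c : ℝ → Model n := fun s => chartAt (Model n) p (η s)
    ∀ α, deriv (deriv c) t α
      + ∑ β, ∑ γ, formalChristoffel (S.localL p) α β γ (c t) (deriv c t)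
          * deriv c t β * deriv c t γ = 0

/-- `I` is an open interval `(a,b)` with `-∞ ≤ a < b ≤ ∞`. -/
def IsOpenInterval (I : Set ℝ) : Prop := IsOpen I ∧ I.OrdConnected ∧ I.Nonempty

/-- `η : I → M` is a future-directed causal geodesic on the open interval `I`. -/
structure FinslerSpacetime.IsCausalGeodesic (S : FinslerSpacetime n M) (I : Set ℝ) (η : ℝ → M) :
    Prop where
  interval : IsOpenInterval I
  smooth : ContMDiffOn 𝓘(ℝ, ℝ) 𝓘(ℝ, Model n) ∞ η I
  future : ∀ t ∈ I, lift n η t ∈ S.futureBundle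
  geodesic : ∀ t ∈ I, S.GeodesicEqAt η t

/-- `η : I → M` is a future-directed lightlike geodesic on the open interval `I`. -/
structure FinslerSpacetime.IsLightlikeGeodesic (S : FinslerSpacetime n M) (I : Set ℝ) (η : ℝ → M) :
    Prop extends S.IsCausalGeodesic I η where
  lightlike : ∀ t ∈ I, S.L (lift n η t) = 0

/-- `η : (a,b) → M` is inextendible: `η(t)` converges neither as `t → b` nor as `t → a`. For an open
interval `I = (a,b)`, the filters `atTop` and `atBot` on the subtype `I` are `t → b` and
`t → a`. -/
def Inextendible {M : Type*} [TopologicalSpace M] (I : Set ℝ) (η : ℝ → M) : Prop :=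
  (¬ ∃ p : M, Tendsto (fun t : I => η t) atTop (𝓝 p)) ∧
    ¬ ∃ p : M, Tendsto (fun t : I => η t) atBot (𝓝 p)

/-! ### Covariant derivative, Jacobi fields, curvature -/

/-- The covariant derivative `D^{η̇}_{η̇} Y` of a vector field `Y` along `η` at time `t`, computed
in the preferred chart at `η(t)`:
`(D Y)^α = Ẏ^α + ∑ Γ^α_{βγ}(η̇) η̇^β Y^γ`. -/
def LorentzFinsler.covDeriv (S : LorentzFinsler n M) (η : ℝ → M)
    (Y : ∀ t, TangentSpace 𝓘(ℝ, Model n) (η t)) (t : ℝ) : TangentSpace 𝓘(ℝ, Model n) (η t) :=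
  let yLoc : ℝ → Model n := fun s => (bundleChart n (η t) ⟨η s, Y s⟩).2
  deriv yLoc t
    + chernTerm (S.localL (η t)) (chartAt (Model n) (η t) (η t)) (velocity n η t) (Y t)

/-- The curvature `R_v(w) = ∑ R^α_β(v) w^β ∂/∂x^α`, for `v, w ∈ T_xM`, computed in the preferred
chart at `x`. -/
def LorentzFinsler.curvature (S : LorentzFinsler n M) (x : M)
    (v w : TangentSpace 𝓘(ℝ, Model n) x) : TangentSpace 𝓘(ℝ, Model n) x :=
  curvTerm (S.localL x) (chartAt (Model n) x x) v w

/-- The Ricci curvature `Ric(v) = trace R_v`. -/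
def LorentzFinsler.ricci (S : LorentzFinsler n M) (v : TM n M) : ℝ :=
  ∑ α, curvCoeff (S.localL v.1) α α (chartAt (Model n) v.1 v.1) v.2

/-- `Y` is a Jacobi field along the geodesic `η : I → M`:
`Y` is smooth and `D D Y + R_{η̇}(Y) = 0`. -/
def LorentzFinsler.IsJacobiField (S : LorentzFinsler n M) (I : Set ℝ) (η : ℝ → M)
    (Y : ∀ t, TangentSpace 𝓘(ℝ, Model n) (η t)) : Prop :=
  ContMDiffOn 𝓘(ℝ, ℝ) 𝓘(ℝ, Model n).tangent ∞ (fun t => (⟨η t, Y t⟩ : TM n M)) I ∧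
    ∀ t ∈ I, S.covDeriv η (S.covDeriv η Y) t + S.curvature (η t) (velocity n η t) (Y t) = 0

/-- `η : I → M` has a pair of conjugate points: some nontrivial Jacobi field along `η` vanishes at
two distinct parameters. -/
def LorentzFinsler.HasConjugatePair (S : LorentzFinsler n M) (I : Set ℝ) (η : ℝ → M) : Prop :=
  ∃ Y : ∀ t, TangentSpace 𝓘(ℝ, Model n) (η t), S.IsJacobiField I η Y ∧
    (∃ r ∈ I, Y r ≠ 0) ∧ ∃ s ∈ I, ∃ t ∈ I, s < t ∧ Y s = 0 ∧ Y t = 0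

/-- The genericity condition along a lightlike geodesic `η : I → M`. With `v = η̇(t)`,
`N = {w | g_v(v,w) = 0}` and `Q = N / ℝv`, the endomorphism of `Q` induced by `R_v` is nonzero
for some `t ∈ I`, that is, `R_v` does not map `N` into `ℝv`. -/
def LorentzFinsler.NullGenericAlong (S : LorentzFinsler n M) (I : Set ℝ) (η : ℝ → M) : Prop :=
  ∃ t ∈ I, ∃ w : TangentSpace 𝓘(ℝ, Model n) (η t),
    fibreHess S.L (η t) (velocity n η t) (velocity n η t) w = 0 ∧
      S.curvature (η t) (velocity n η t) w ∉ Submodule.span ℝ {velocity n η t}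

/-- The null genericity condition: genericity along every inextendible lightlike geodesic. -/
def FinslerSpacetime.NullGenericity (S : FinslerSpacetime n M) : Prop :=
  ∀ (I : Set ℝ) (η : ℝ → M), S.IsLightlikeGeodesic I η → Inextendible I η →
    S.NullGenericAlong I η

/-! ### Weighted Ricci curvature and the convergence condition -/

/-- `ψ_η(t) = ψ(η̇(t))`. -/
def WeightedSpacetime.ψAlong (S : WeightedSpacetime n M) (η : ℝ → M) (t : ℝ) : ℝ :=
  S.ψ (lift n η t)

/-- `Ric_N(η̇(t))` for a causal geodesic `η` and `N ∈ (-∞, ∞]`, with value `-∞` allowed for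
`N = n`. -/
def WeightedSpacetime.ricciN (S : WeightedSpacetime n M) (N : WithTop ℝ) (η : ℝ → M) (t : ℝ) :
    EReal :=
  let ric : ℝ := S.ricci (lift n η t)
  let ψ₁ : ℝ := deriv (S.ψAlong η) t
  let ψ₂ : ℝ := deriv (deriv (S.ψAlong η)) t
  match N with
  | ⊤ => ((ric + ψ₂ : ℝ) : EReal)
  | (N : ℝ) =>
    if N = n then (if ψ₁ = 0 then ((ric + ψ₂ : ℝ) : EReal) else ⊥)
    else ((ric + ψ₂ - ψ₁ ^ 2 / (N - n) : ℝ) : EReal)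

/-- `Ric_N(v) ≥ 0`, where `Ric_N(v)` is evaluated along the geodesic `η : (-δ,δ) → M` with
`η̇(0) = v`; such a geodesic exists, and its germ at `0` is unique. -/
def WeightedSpacetime.RicciNNonneg (S : WeightedSpacetime n M) (N : WithTop ℝ) (v : TM n M) :
    Prop :=
  ∀ δ > 0, ∀ η : ℝ → M, S.IsCausalGeodesic (Ioo (-δ) δ) η → lift n η 0 = v →
    0 ≤ S.ricciN N η 0

/-- The null `N`-convergence condition: `Ric_N(v) ≥ 0` for every future-directed lightlike `v`. -/
def WeightedSpacetime.NullConvergence (S : WeightedSpacetime n M) (N : WithTop ℝ) : Prop :=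
  ∀ v ∈ S.futureBundle, S.L v = 0 → S.RicciNNonneg N v

/-! ### The null `ε`-range and `ε`-completeness -/

/-- The null `ε`-range: `ε = 0` if `N = 1`, every `ε` if `N = n`, `|ε| < 1` if `N = ∞`, and
`|ε| < √((N-1)/(N-n))` otherwise. -/
def NullRange (n : ℕ) (N : WithTop ℝ) (ε : ℝ) : Prop :=
  match N with
  | ⊤ => |ε| < 1
  | (N : ℝ) =>
    if N = 1 then ε = 0
    else if N = n then True
    else |ε| < Real.sqrt ((N - 1) / (N - n))

/-- The parameter `τ_ε(t) = ∫_{t₀}^t exp(2(ε-1)/(n-1) ψ_η(s)) ds` along a lightlike geodesic. -/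
def WeightedSpacetime.τ (S : WeightedSpacetime n M) (ε : ℝ) (η : ℝ → M) (t₀ t : ℝ) : ℝ :=
  ∫ s in t₀..t, Real.exp (2 * (ε - 1) / ((n : ℝ) - 1) * S.ψAlong η s)

/-- A lightlike geodesic `η : (a,b) → M` is (future and past) `ε`-complete: it is inextendible,
`τ_ε(t) → +∞` as `t → b`, and `τ_ε(t) → -∞` as `t → a` (the choice of the base point `t₀` is
immaterial). -/
def WeightedSpacetime.EpsComplete (S : WeightedSpacetime n M) (ε : ℝ) (I : Set ℝ) (η : ℝ → M) :
    Prop :=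
  Inextendible I η ∧ ∀ t₀ ∈ I,
    Tendsto (fun t : I => S.τ ε η t₀ t) atTop atTop ∧
      Tendsto (fun t : I => S.τ ε η t₀ t) atBot atBot

end Spacetime

end FinslerST

end

/-!
Let `η` be a lightlike geodesic that has no conjugate points and is `ε`-complete. It is shown that
`R_{η̇}` maps `η̇^⊥` into `ℝ η̇` along all of `η` (`not_nullGenericAlong`). As `ε`-complete geodesics
are inextendible by definition, this contradicts null genericity.

**Analysis.** In an orthonormal parallel frame, the Jacobi equation along `η` is `y'' + R y = 0` on
Minkowski space, where `R(t)` is symmetric with trace `Ric(η̇)` and annihilates the constant null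
vector `v₀` that represents `η̇`. Without conjugate points, the solution `A` with `A(s) = 0` and
`A'(s) = 1` is invertible after `s`, and completing the square with the Riccati solution
`U = A' A⁻¹` shows that the index form `∫ (|u'|² - ⟨Ru, u⟩)` is non-negative on fields orthogonal to
`v₀` that vanish at both ends (`exists_riccati`, `index_nonneg`). It is evaluated on the screen
fields `e^{aψ} (1 - τ²/T²) e_i` with `a = (1 - ε)/(n - 1)`, where `τ` is the parameter `τ_ε`.
Completeness allows every `T`, and the weighted Ricci bound reads `Ric + ψ'' - k ψ'² ≥ 0`, where
`K = (1 - ε²)/(n - 1) + k` is positive precisely because `ε` lies in the null range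
(`exists_ricci_bound`). Summing over `i` gives `(K/2) ∫ ψ'² f² ≤ const/T` for
`f = e^{aψ} (1 - τ²/T²)` (`weight_integral_le`), whence `ψ' = 0`. Then `τ` is affine and `Ric ≥ 0`,
and if some entry `R_{ij}` of the screen curvature were non-zero, then the index form would be
negative on a perturbation of `(1 - τ²/T²) e_i` by a multiple of a bump function times `e_j`
(`curvature_entry_eq_zero`).

**Geometry.** The objects of the theorem are defined by coordinate formulas in the preferred
charts, so their invariance has to be established. In a chart, the spray is the unique solution of the
Euler–Lagrange equation (`SprayChart`), and this determines its behaviour under changes of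
coordinates (`IsTransition.spray`). Differentiation gives the transformation law of the nonlinear
connection. The lift `(y, -N y)` of a parallel field solves the linearized spray equation up to the
forcing term `R y` (`hasDerivAt_parallel_lift`), which yields the naturality of the curvature
(`IsTransition.R_eq`) and, because the linearized flow preserves the symplectic form of the
Lagrangian, its symmetry (`R_symm`). The coordinate formulas for spray, curvature and Chern connection are
identified with these objects in `coordSpray`, `curvTerm_eq` and `chernTerm_eq`. Parallel frames are
obtained chart by chart from linear differential equations and glued (`exists_global_of_local`).
-/

noncomputable section

namespace FinslerST

/-! ### Linear differential equations on an open interval -/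

/-- On a preconnected set, a property that is locally constant is constant. -/
lemma forall_of_locally_iff {K : Set ℝ} (hK : K.OrdConnected) (Q : ℝ → Prop)
    (h : ∀ t ∈ K, ∀ᶠ r in 𝓝[K] t, (Q t ↔ Q r)) {a : ℝ} (ha : a ∈ K) (hQ : Q a) :
    ∀ b ∈ K, Q b := by
  intro b hb
  have := hK.isPreconnected.induction₂ (fun x y => (Q x ↔ Q y)) h
    (fun x y z _ _ _ h1 h2 => h1.trans h2) (fun x y _ _ h1 => h1.symm) ha hb
  exact this.1 hQ

/-- Gluing principle: a local first-order condition `P` on curves that is uniquely solvable, for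
arbitrary initial data, near every point of an open interval is solvable on the whole interval. -/
theorem exists_global_of_local {X : Type*} (P : (ℝ → X) → ℝ → Prop)
    (hP : ∀ f g t, f =ᶠ[𝓝 t] g → P f t → P g t) {I : Set ℝ} (hI : IsOpenInterval I)
    (hloc : ∀ t ∈ I, ∃ J : Set ℝ, IsOpen J ∧ J.OrdConnected ∧ t ∈ J ∧ J ⊆ I ∧
      (∀ s ∈ J, ∀ x, ∃ f, f s = x ∧ ∀ r ∈ J, P f r) ∧
      ∀ f g, ∀ K ⊆ J, IsOpen K → K.OrdConnected → (∀ r ∈ K, P f r) → (∀ r ∈ K, P g r) →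
        ∀ s ∈ K, f s = g s → ∀ r ∈ K, f r = g r) :
    (∀ t₀ ∈ I, ∀ x, ∃ f, f t₀ = x ∧ ∀ r ∈ I, P f r) ∧
      ∀ f g, ∀ K ⊆ I, IsOpen K → K.OrdConnected → (∀ r ∈ K, P f r) → (∀ r ∈ K, P g r) →
        ∀ s ∈ K, f s = g s → ∀ r ∈ K, f r = g r := by
  classical
  have huniq : ∀ f g, ∀ K ⊆ I, IsOpen K → K.OrdConnected → (∀ r ∈ K, P f r) →
      (∀ r ∈ K, P g r) → ∀ s ∈ K, f s = g s → ∀ r ∈ K, f r = g r := by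
    intro f g K hKI hKo hKc hf hg s hs hfg
    refine forall_of_locally_iff hKc (fun r => f r = g r) (fun t ht => ?_) hs hfg
    obtain ⟨J, hJo, hJc, htJ, -, -, hu⟩ := hloc t (hKI ht)
    have hKJ := hu f g (K ∩ J) inter_subset_right (hKo.inter hJo) (hKc.inter hJc)
      (fun r hr => hf r hr.1) (fun r hr => hg r hr.1)
    filter_upwards [inter_mem_nhdsWithin K (hJo.mem_nhds htJ)] with r hr
    exact ⟨fun h => hKJ t ⟨ht, htJ⟩ h r hr, fun h => hKJ r hr h t ⟨ht, htJ⟩⟩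
  refine ⟨fun t₀ ht₀ x => ?_, huniq⟩
  have hext : ∀ t ∈ I, ∃ K : Set ℝ, IsOpen K ∧ K.OrdConnected ∧ K ⊆ I ∧ t₀ ∈ K ∧ t ∈ K ∧
      ∃ f, f t₀ = x ∧ ∀ r ∈ K, P f r := by
    refine forall_of_locally_iff hI.2.1 _ (fun t ht => ?_) ht₀ ?_
    · obtain ⟨J, hJo, hJc, htJ, hJI, he, hu⟩ := hloc t ht
      -- solvability up to one point of `J` gives solvability up to every other point of `J`
      have key : ∀ a ∈ J, ∀ b ∈ J, (∃ K : Set ℝ, IsOpen K ∧ K.OrdConnected ∧ K ⊆ I ∧ t₀ ∈ K ∧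
          a ∈ K ∧ ∃ f, f t₀ = x ∧ ∀ r ∈ K, P f r) → ∃ K : Set ℝ, IsOpen K ∧ K.OrdConnected ∧
          K ⊆ I ∧ t₀ ∈ K ∧ b ∈ K ∧ ∃ f, f t₀ = x ∧ ∀ r ∈ K, P f r := by
        rintro a ha b hb ⟨K, hKo, hKc, hKI, h0, haK, f, hf0, hf⟩
        obtain ⟨g, hga, hg⟩ := he a ha (f a)
        have hfg := hu f g (K ∩ J) inter_subset_right (hKo.inter hJo) (hKc.inter hJc)
          (fun r hr => hf r hr.1) (fun r hr => hg r hr.2) a ⟨haK, ha⟩ hga.symm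
        refine ⟨K ∪ J, hKo.union hJo, ?_, union_subset hKI hJI, Or.inl h0, Or.inr hb,
          fun r => if r ∈ K then f r else g r, by simp [h0, hf0], ?_⟩
        · exact (IsPreconnected.union a haK ha hKc.isPreconnected
            hJc.isPreconnected).ordConnected
        · rintro r (hr | hr)
          · refine hP f _ r ?_ (hf r hr)
            filter_upwards [hKo.mem_nhds hr] with q hq
            simp [hq]
          · refine hP g _ r ?_ (hg r hr)
            filter_upwards [hJo.mem_nhds hr] with q hq
            by_cases hqK : q ∈ K
            · simp [hqK, hfg q ⟨hqK, hq⟩]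
            · simp [hqK]
      filter_upwards [nhdsWithin_le_nhds (hJo.mem_nhds htJ)] with r hr
      exact ⟨key t htJ r hr, key r hr t htJ⟩
    · obtain ⟨J, hJo, hJc, htJ, hJI, he, -⟩ := hloc t₀ ht₀
      obtain ⟨f, hf0, hf⟩ := he t₀ htJ x
      exact ⟨J, hJo, hJc, hJI, htJ, htJ, f, hf0, hf⟩
  have : Nonempty X := ⟨x⟩
  choose! K hKo hKc hKI h0 hK f hf0 hf using hext
  refine ⟨fun t => f t t, hf0 t₀ ht₀, fun r hr => ?_⟩
  refine hP (f r) _ r ?_ (hf r hr r (hK r hr))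
  filter_upwards [(hKo r hr).mem_nhds (hK r hr)] with q hq
  have hqI := hKI r hr hq
  exact huniq (f r) (f q) (K r ∩ K q) (inter_subset_left.trans (hKI r hr))
    ((hKo r hr).inter (hKo q hqI)) ((hKc r hr).inter (hKc q hqI))
    (fun s hs => hf r hr s hs.1) (fun s hs => hf q hqI s hs.2) t₀ ⟨h0 r hr, h0 q hqI⟩
    ((hf0 r hr).trans (hf0 q hqI).symm) q ⟨hq, hK q hqI⟩

section LinearODE

variable {V : Type*} [NormedAddCommGroup V] [NormedSpace ℝ V]

/-- Uniqueness for linear equations with bounded coefficients on an open interval. -/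
lemma linearODE_unique_of_bounded (A : ℝ → V →L[ℝ] V) {C : ℝ} {K : Set ℝ}
    (hKo : IsOpen K) (hKc : K.OrdConnected) (hC : ∀ t ∈ K, ‖A t‖ ≤ C) (f g : ℝ → V)
    (hf : ∀ r ∈ K, HasDerivAt f (A r (f r)) r) (hg : ∀ r ∈ K, HasDerivAt g (A r (g r)) r)
    {s : ℝ} (hs : s ∈ K) (hfg : f s = g s) : ∀ r ∈ K, f r = g r := by
  refine forall_of_locally_iff hKc (fun r => f r = g r) (fun t ht => ?_) hs hfg
  obtain ⟨ε, hε, hb⟩ := Metric.isOpen_iff.1 hKo t ht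
  rw [Real.ball_eq_Ioo] at hb
  have key : ∀ a ∈ Ioo (t - ε) (t + ε), f a = g a → EqOn f g (Ioo (t - ε) (t + ε)) := by
    intro a ha hfa
    refine ODE_solution_unique_of_mem_Ioo (v := fun t x => A t x) (s := fun _ => univ)
      (K := C.toNNReal) (fun r hr => ?_) ha (fun r hr => ⟨hf r (hb hr), trivial⟩)
      (fun r hr => ⟨hg r (hb hr), trivial⟩) hfa
    have : LipschitzWith ‖A r‖₊ (A r) := (A r).lipschitz
    refine (this.weaken ?_).lipschitzOnWith
    exact NNReal.le_toNNReal_of_coe_le (by simpa using hC r (hb hr))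
  have htm : t ∈ Ioo (t - ε) (t + ε) := ⟨by linarith, by linarith⟩
  filter_upwards [nhdsWithin_le_nhds (isOpen_Ioo.mem_nhds htm)] with r hr
  exact ⟨fun h => key t htm h hr, fun h => key r hr h htm⟩

/-- Solutions of a linear equation with smooth coefficients are smooth. -/
lemma contDiffOn_of_linearODE {A : ℝ → V →L[ℝ] V} {J : Set ℝ} (hJ : IsOpen J)
    (hA : ContDiffOn ℝ ∞ A J) {f : ℝ → V} (hf : ∀ r ∈ J, HasDerivAt f (A r (f r)) r) :
    ContDiffOn ℝ ∞ f J := by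
  rw [contDiffOn_infty]
  intro k
  induction k with
  | zero =>
    exact contDiffOn_zero.2 fun r hr => (hf r hr).continuousAt.continuousWithinAt
  | succ k ih =>
    have hk : ((k + 1 : ℕ) : WithTop ℕ∞) = (k : WithTop ℕ∞) + 1 := by norm_cast
    rw [hk, contDiffOn_succ_iff_deriv_of_isOpen hJ]
    refine ⟨fun r hr => (hf r hr).differentiableAt.differentiableWithinAt, by simp, ?_⟩
    have h1 : ContDiffOn ℝ k (fun r => A r (f r)) J :=
      (hA.of_le (by exact_mod_cast le_top)).clm_apply ih
    exact h1.congr fun r hr => (hf r hr).deriv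

variable [CompleteSpace V]

/-- On a short interval, the length of which depends only on a bound for the coefficients, a linear
equation is solvable for arbitrary initial data. -/
lemma linearODE_exists_of_bounded (A : ℝ → V →L[ℝ] V) {C t δ : ℝ} (hC0 : 0 ≤ C)
    (hδC : 8 * C * δ ≤ 1) (hA : ContinuousOn A (Icc (t - δ) (t + δ)))
    (hC : ∀ r ∈ Icc (t - δ) (t + δ), ‖A r‖ ≤ C) {s : ℝ} (hs : s ∈ Ioo (t - δ) (t + δ)) (x : V) :
    ∃ f : ℝ → V, f s = x ∧ ∀ r ∈ Ioo (t - δ) (t + δ), HasDerivAt f (A r (f r)) r := by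
  have hPL : IsPicardLindelof (fun r x => A r x) (⟨s, Ioo_subset_Icc_self hs⟩ :
      Icc (t - δ) (t + δ)) x ‖x‖₊ 0 (C.toNNReal * (2 * ‖x‖₊)) C.toNNReal := by
    refine ⟨fun r hr => ?_, fun y _ => hA.clm_apply continuousOn_const, fun r hr y hy => ?_, ?_⟩
    · have : LipschitzWith ‖A r‖₊ (A r) := (A r).lipschitz
      exact (this.weaken (NNReal.le_toNNReal_of_coe_le (by simpa using hC r hr))).lipschitzOnWith
    · have h1 : ‖y‖ ≤ 2 * ‖x‖ := by
        have := norm_le_of_mem_closedBall hy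
        simp at this; linarith
      calc ‖A r y‖ ≤ ‖A r‖ * ‖y‖ := (A r).le_opNorm y
        _ ≤ C * (2 * ‖x‖) := by gcongr; exact hC r hr
        _ = _ := by simp [hC0]
    · have h1 : max (t + δ - s) (s - (t - δ)) ≤ 2 * δ :=
        max_le (by linarith [hs.1]) (by linarith [hs.2])
      simp only [NNReal.coe_mul, Real.coe_toNNReal _ hC0, coe_nnnorm, NNReal.coe_zero, sub_zero,
        NNReal.coe_ofNat]
      calc C * (2 * ‖x‖) * max (t + δ - s) (s - (t - δ)) ≤ C * (2 * ‖x‖) * (2 * δ) := by gcongr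
        _ = (4 * C * δ) * ‖x‖ := by ring
        _ ≤ 1 * ‖x‖ := by
          have hδ : 0 ≤ δ := by linarith [hs.1, hs.2]
          gcongr
          nlinarith [mul_nonneg hC0 hδ]
        _ = ‖x‖ := one_mul _
  obtain ⟨f, hf0, hf⟩ := hPL.exists_eq_forall_mem_Icc_hasDerivWithinAt₀
  exact ⟨f, hf0, fun r hr => (hf r (Ioo_subset_Icc_self hr)).hasDerivAt (Icc_mem_nhds hr.1 hr.2)⟩

/-- Global solvability and uniqueness for a linear equation with continuous coefficients on an open
interval. -/
theorem linearODE (A : ℝ → V →L[ℝ] V) {I : Set ℝ} (hI : IsOpenInterval I)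
    (hA : ContinuousOn A I) :
    (∀ t₀ ∈ I, ∀ x, ∃ f : ℝ → V, f t₀ = x ∧ ∀ r ∈ I, HasDerivAt f (A r (f r)) r) ∧
      ∀ f g : ℝ → V, ∀ K ⊆ I, IsOpen K → K.OrdConnected →
        (∀ r ∈ K, HasDerivAt f (A r (f r)) r) → (∀ r ∈ K, HasDerivAt g (A r (g r)) r) →
        ∀ s ∈ K, f s = g s → ∀ r ∈ K, f r = g r := by
  refine exists_global_of_local (fun f r => HasDerivAt f (A r (f r)) r) ?_ hI fun t ht => ?_
  · intro f g t hfg h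
    have := h.congr_of_eventuallyEq hfg.symm
    rwa [hfg.self_of_nhds] at this
  have hcont : ContinuousAt A t := hA.continuousAt (hI.1.mem_nhds ht)
  have hev : ∀ᶠ r in 𝓝 t, ‖A r‖ ≤ ‖A t‖ + 1 ∧ r ∈ I :=
    ((hcont.norm.eventually_lt continuousAt_const (lt_add_one _)).mono fun r h => le_of_lt h).and
      (hI.1.mem_nhds ht)
  obtain ⟨ε, hε, hb⟩ := Metric.eventually_nhds_iff_ball.1 hev
  rw [Real.ball_eq_Ioo] at hb
  set C := ‖A t‖ + 1 with hC
  have hC0 : 0 < C := by positivity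
  obtain ⟨δ, hδ0, hδε, hδC⟩ : ∃ δ > 0, δ < ε ∧ 8 * C * δ ≤ 1 := by
    refine ⟨min (ε / 2) (1 / (8 * C)), by positivity, ?_, ?_⟩
    · exact (min_le_left _ _).trans_lt (by linarith)
    · calc 8 * C * min (ε / 2) (1 / (8 * C)) ≤ 8 * C * (1 / (8 * C)) := by
            gcongr; exact min_le_right _ _
        _ = 1 := by field_simp
  have hsub : Icc (t - δ) (t + δ) ⊆ Ioo (t - ε) (t + ε) :=
    Icc_subset_Ioo (by linarith) (by linarith)
  refine ⟨Ioo (t - δ) (t + δ), isOpen_Ioo, ordConnected_Ioo, ⟨by linarith, by linarith⟩,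
    fun r hr => (hb r (hsub (Ioo_subset_Icc_self hr))).2, fun s hs x => ?_, ?_⟩
  · exact linearODE_exists_of_bounded A hC0.le hδC
      (hA.mono fun r hr => (hb r (hsub hr)).2) (fun r hr => (hb r (hsub hr)).1) hs x
  · intro f g K hKJ hKo hKc hf hg s hs hfg
    exact linearODE_unique_of_bounded A hKo hKc
      (fun r hr => (hb r (hsub (Ioo_subset_Icc_self (hKJ hr)))).1) f g hf hg hs hfg

end LinearODE

/-! ### The index form of a Jacobi equation without conjugate points -/

lemma eq_of_hasDerivAt_zero {V : Type*} [NormedAddCommGroup V] [NormedSpace ℝ V] {I : Set ℝ}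
    (hIo : IsOpen I) (hIc : I.OrdConnected) {f : ℝ → V} (hf : ∀ t ∈ I, HasDerivAt f 0 t) :
    ∀ s ∈ I, ∀ t ∈ I, f s = f t := fun _ hs _ ht =>
  hIo.is_const_of_deriv_eq_zero hIc.isPreconnected
    (fun r hr => (hf r hr).differentiableAt.differentiableWithinAt)
    (fun r hr => (hf r hr).deriv) hs ht

section SecondOrder

variable {W : Type*} [NormedAddCommGroup W] [NormedSpace ℝ W]

/-- The first-order system on `W × W` that encodes `y'' = κ y`. -/
def secondOrderSystem (κ : W →L[ℝ] W) : W × W →L[ℝ] W × W :=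
  (ContinuousLinearMap.inl ℝ W W).comp (ContinuousLinearMap.snd ℝ W W) +
    (ContinuousLinearMap.inr ℝ W W).comp (κ.comp (ContinuousLinearMap.fst ℝ W W))

lemma secondOrderSystem_apply (κ : W →L[ℝ] W) (p : W × W) :
    secondOrderSystem κ p = (p.2, κ p.1) := by
  simp [secondOrderSystem]

lemma continuousOn_secondOrderSystem {κ : ℝ → W →L[ℝ] W} {I : Set ℝ} (hκ : ContinuousOn κ I) :
    ContinuousOn (fun t => secondOrderSystem (κ t)) I :=
  continuousOn_const.add (continuousOn_const.clm_comp (hκ.clm_comp continuousOn_const))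

lemma contDiffOn_secondOrderSystem {κ : ℝ → W →L[ℝ] W} {I : Set ℝ} (hκ : ContDiffOn ℝ ∞ κ I) :
    ContDiffOn ℝ ∞ (fun t => secondOrderSystem (κ t)) I :=
  contDiffOn_const.add (contDiffOn_const.clm_comp (hκ.clm_comp contDiffOn_const))

/-- A pair `(y, y₁)` with `y' = y₁` and `y₁' = κ y` solves the first-order system. -/
lemma hasDerivAt_secondOrderSystem {κ : W →L[ℝ] W} {y y₁ : ℝ → W} {t : ℝ}
    (h : HasDerivAt y (y₁ t) t) (h₁ : HasDerivAt y₁ (κ (y t)) t) :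
    HasDerivAt (fun t => (y t, y₁ t)) (secondOrderSystem κ (y t, y₁ t)) t := by
  rw [secondOrderSystem_apply]
  exact h.prodMk h₁

/-- Solvability of `y'' = κ y` on an open interval for arbitrary Cauchy data. -/
lemma exists_secondOrder [CompleteSpace W] {κ : ℝ → W →L[ℝ] W} {I : Set ℝ}
    (hI : IsOpenInterval I) (hκ : ContinuousOn κ I) {s : ℝ} (hs : s ∈ I) (a b : W) :
    ∃ y y₁ : ℝ → W, y s = a ∧ y₁ s = b ∧ (∀ t ∈ I, HasDerivAt y (y₁ t) t) ∧
      ∀ t ∈ I, HasDerivAt y₁ (κ t (y t)) t := by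
  obtain ⟨f, hf0, hf⟩ := (linearODE (fun t => secondOrderSystem (κ t)) hI
    (continuousOn_secondOrderSystem hκ)).1 s hs (a, b)
  simp only [secondOrderSystem_apply] at hf
  refine ⟨fun t => (f t).1, fun t => (f t).2, by simp [hf0], by simp [hf0], fun t ht => ?_,
    fun t ht => ?_⟩
  · exact (hasFDerivAt_fst (𝕜 := ℝ) (p := f t)).comp_hasDerivAt t (hf t ht)
  · exact (hasFDerivAt_snd (𝕜 := ℝ) (p := f t)).comp_hasDerivAt t (hf t ht)

end SecondOrder

section Index

variable {V : Type*} [NormedAddCommGroup V] [NormedSpace ℝ V]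

/-- The Jacobi equation `y'' + R y = 0` has no conjugate points on `I`. -/
def NoConjugate (R : ℝ → V →L[ℝ] V) (I : Set ℝ) : Prop :=
  ∀ y y₁ : ℝ → V, (∀ t ∈ I, HasDerivAt y (y₁ t) t) → (∀ t ∈ I, HasDerivAt y₁ (-(R t (y t))) t) →
    ∀ s ∈ I, ∀ t ∈ I, s < t → y s = 0 → y t = 0 → ∀ r ∈ I, y r = 0

lemma hasDerivAt_bilin {W : Type*} [NormedAddCommGroup W] [NormedSpace ℝ W]
    (B : V →L[ℝ] V →L[ℝ] W) {a b : ℝ → V} {a' b' : V} {t : ℝ}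
    (ha : HasDerivAt a a' t) (hb : HasDerivAt b b' t) :
    HasDerivAt (fun t => B (a t) (b t)) (B a' (b t) + B (a t) b') t := by
  have h1 : HasDerivAt (fun t => B (a t)) (B a') t := B.hasFDerivAt.comp_hasDerivAt t ha
  exact h1.clm_apply hb

variable [FiniteDimensional ℝ V]

/-- Without conjugate points, the Riccati equation `U' + U² + R = 0` has a solution on the part of
`I` after any given `s ∈ I`; it is symmetric with respect to `B`, and it has `v₀` as an
eigenvector. It is `U = A' A⁻¹`, where `A'' + R A = 0`, `A(s) = 0` and `A'(s) = 1`. -/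
theorem exists_riccati {I : Set ℝ} (hI : IsOpenInterval I) {B : V →L[ℝ] V →L[ℝ] ℝ}
    {R : ℝ → V →L[ℝ] V} (hRc : ContinuousOn R I)
    (hRs : ∀ t ∈ I, ∀ y z, B (R t y) z = B y (R t z)) {v₀ : V} (hRv : ∀ t ∈ I, R t v₀ = 0)
    (hconj : NoConjugate R I) {s : ℝ} (hs : s ∈ I) :
    ∃ U : ℝ → V →L[ℝ] V, ∀ t ∈ I, s < t →
      HasDerivAt U (-R t - (U t).comp (U t)) t ∧ (∀ y z, B (U t y) z = B y (U t z)) ∧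
        U t v₀ = (t - s)⁻¹ • v₀ := by
  have : CompleteSpace V := FiniteDimensional.complete ℝ V
  have hκ : ContinuousOn (fun t => ContinuousLinearMap.compL ℝ V V V (-R t)) I :=
    (ContinuousLinearMap.compL ℝ V V V).continuous.comp_continuousOn hRc.neg
  -- `A` is the Jacobi tensor with `A s = 0` and `A' s = 1`; it is invertible after `s`
  obtain ⟨A, A₁, hA0, hA10, hA, hA₁⟩ := exists_secondOrder hI hκ hs (0 : V →L[ℝ] V)
    (ContinuousLinearMap.id ℝ V)
  simp only [ContinuousLinearMap.compL_apply] at hA₁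
  have hAc : ∀ c, ∀ t ∈ I, HasDerivAt (fun t => A t c) (A₁ t c) t := fun c t ht => by
    simpa using (hA t ht).clm_apply (hasDerivAt_const t c)
  have hA₁c : ∀ c, ∀ t ∈ I, HasDerivAt (fun t => A₁ t c) (-(R t (A t c))) t := fun c t ht => by
    simpa using (hA₁ t ht).clm_apply (hasDerivAt_const t c)
  have hinj : ∀ t ∈ I, s < t → Function.Injective (A t) := by
    intro t ht hst
    rw [injective_iff_map_eq_zero]
    intro c hc
    have h0 := hconj (fun t => A t c) (fun t => A₁ t c) (hAc c) (hA₁c c) s hs t ht hst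
      (by simp [hA0]) hc
    have h1 : HasDerivAt (fun t => A t c) 0 s := by
      refine (hasDerivAt_const s (0 : V)).congr_of_eventuallyEq ?_
      filter_upwards [hI.1.mem_nhds hs] with r hr using h0 r hr
    simpa [hA10] using (hAc c s hs).unique h1
  have hunit : ∀ t ∈ I, s < t → IsUnit (A t) := fun t ht hst => by
    rw [ContinuousLinearMap.isUnit_iff_bijective]
    exact ⟨hinj t ht hst, (LinearMap.injective_iff_surjective
      (f := (A t : V →ₗ[ℝ] V))).1 (hinj t ht hst)⟩
  -- the Wronskian of two Jacobi fields is constant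
  have hw : ∀ c d, ∀ t ∈ I, B (A t c) (A₁ t d) = B (A₁ t c) (A t d) := by
    intro c d t ht
    have h := eq_of_hasDerivAt_zero hI.1 hI.2.1
      (f := fun t => B (A t c) (A₁ t d) - B (A₁ t c) (A t d)) (fun r hr => by
        have := (hasDerivAt_bilin B (hAc c r hr) (hA₁c d r hr)).sub
          (hasDerivAt_bilin B (hA₁c c r hr) (hAc d r hr))
        refine HasDerivAt.congr_deriv this ?_
        simp only [map_neg, neg_apply, hRs r hr]
        ring) t ht s hs
    simp only [hA0, zero_apply, map_zero, sub_zero] at h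
    linarith
  have hAv : ∀ t ∈ I, A t v₀ = (t - s) • v₀ ∧ A₁ t v₀ = v₀ := by
    intro t ht
    have h := (linearODE (fun t => secondOrderSystem (-R t)) hI
      (continuousOn_secondOrderSystem hRc.neg)).2 (fun t => (A t v₀, A₁ t v₀))
      (fun t => ((t - s) • v₀, v₀)) I subset_rfl hI.1 hI.2.1
      (fun r hr => hasDerivAt_secondOrderSystem (hAc v₀ r hr) (by simpa using hA₁c v₀ r hr))
      (fun r hr => by
        refine hasDerivAt_secondOrderSystem (y₁ := fun _ => v₀) ?_ ?_
        · simpa using ((hasDerivAt_id r).sub_const s).smul_const v₀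
        · simpa [hRv r hr] using hasDerivAt_const r v₀) s hs (by simp [hA0, hA10]) t ht
    simpa using h
  refine ⟨fun t => A₁ t * Ring.inverse (A t), fun t ht hst => ?_⟩
  obtain ⟨x, hx⟩ := hunit t ht hst
  set Ai : V →L[ℝ] V := ((x⁻¹ : (V →L[ℝ] V)ˣ) : V →L[ℝ] V) with hAidef
  have hxi : Ring.inverse (A t) = Ai := by rw [← hx, Ring.inverse_unit]
  have hAi : ∀ y, A t (Ai y) = y := fun y => by
    rw [← hx, ← mul_apply_eq_comp, hAidef, Units.mul_inv, one_apply_eq_self]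
  have hiA : ∀ y, Ai (A t y) = y := fun y => by
    rw [← hx, ← mul_apply_eq_comp, hAidef, Units.inv_mul, one_apply_eq_self]
  refine ⟨?_, fun y z => ?_, ?_⟩
  · have h1 : HasFDerivAt Ring.inverse (-ContinuousLinearMap.mulLeftRight ℝ (V →L[ℝ] V) Ai Ai)
        (A t) := by
      rw [← hx]; exact hasFDerivAt_ringInverse x
    have h2 := (hA₁ t ht).mul (h1.comp_hasDerivAt t (hA t ht))
    refine HasDerivAt.congr_deriv h2 ?_
    ext y
    simp [hAi, hxi, sub_eq_add_neg]
  · simp only [hxi, mul_apply_eq_comp]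
    have := hw (Ai y) (Ai z) t ht
    rw [hAi, hAi] at this
    exact this.symm
  · simp only [hxi, mul_apply_eq_comp]
    have h1 : Ai v₀ = (t - s)⁻¹ • v₀ := by
      have h2 := hiA v₀
      rw [(hAv t ht).1, map_smul] at h2
      rw [← h2, smul_smul, inv_mul_cancel₀ (sub_ne_zero.2 hst.ne'), one_smul, h2]
    rw [h1, map_smul, (hAv t ht).2]

/-- Without conjugate points, the index form is non-negative on fields orthogonal to `v₀` that
vanish at both ends: completing the square with a solution `U` of the Riccati equation,
`B(u',u') - B(Ru,u) = B(u' - Uu, u' - Uu) + (B(Uu,u))'`, and `u' - Uu` is orthogonal to `v₀`. -/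
theorem index_nonneg {I : Set ℝ} (hI : IsOpenInterval I) {B : V →L[ℝ] V →L[ℝ] ℝ}
    (hBs : ∀ y z, B y z = B z y) {R : ℝ → V →L[ℝ] V} (hRc : ContinuousOn R I)
    (hRs : ∀ t ∈ I, ∀ y z, B (R t y) z = B y (R t z)) {v₀ : V} (hRv : ∀ t ∈ I, R t v₀ = 0)
    (hB : ∀ y, B y v₀ = 0 → 0 ≤ B y y) (hconj : NoConjugate R I) {α β : ℝ} (hα : α ∈ I)
    (hβ : β ∈ I) (hαβ : α < β) {u u₁ : ℝ → V} (hu : ∀ t ∈ Icc α β, HasDerivAt u (u₁ t) t)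
    (hu₁ : ContinuousOn u₁ (Icc α β)) (huv : ∀ t ∈ Icc α β, B (u t) v₀ = 0)
    (huα : u α = 0) (huβ : u β = 0) :
    0 ≤ ∫ t in α..β, (B (u₁ t) (u₁ t) - B (R t (u t)) (u t)) := by
  -- the Riccati solution that blows up at a point `s` before `α` is smooth on `[α, β]`
  obtain ⟨s, hsα, hsI⟩ : ∃ s < α, s ∈ I := by
    obtain ⟨ε, hε, hb⟩ := Metric.isOpen_iff.1 hI.1 α hα
    exact ⟨α - ε / 2, by linarith, hb (by simp [abs_of_pos hε, hε])⟩
  have hsub : Icc α β ⊆ I := hI.2.1.out hα hβ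
  obtain ⟨U, hU⟩ := exists_riccati hI hRc hRs hRv hconj hsI
  have hU' := fun t (ht : t ∈ Icc α β) => hU t (hsub ht) (hsα.trans_le ht.1)
  have hΦ : ∀ t ∈ Icc α β, HasDerivAt (fun t => B (U t (u t)) (u t))
      (B ((-R t - (U t).comp (U t)) (u t) + U t (u₁ t)) (u t) + B (U t (u t)) (u₁ t)) t :=
    fun t ht => hasDerivAt_bilin B ((hU' t ht).1.clm_apply (hu t ht)) (hu t ht)
  have hcu : ContinuousOn u (Icc α β) := fun t ht => (hu t ht).continuousAt.continuousWithinAt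
  have hcR : ContinuousOn (fun t => R t (u t)) (Icc α β) := (hRc.mono hsub).clm_apply hcu
  have hint : MeasureTheory.IntegrableOn
      (fun t => B (u₁ t) (u₁ t) - B (R t (u t)) (u t)) (Icc α β) := by
    refine ContinuousOn.integrableOn_Icc (ContinuousOn.sub ?_ ?_)
    · exact (B.continuous.comp_continuousOn hu₁).clm_apply hu₁
    · exact (B.continuous.comp_continuousOn hcR).clm_apply hcu
  have key := intervalIntegral.sub_le_integral_of_hasDeriv_right_of_le hαβ.le
    (fun t ht => (hΦ t ht).continuousAt.continuousWithinAt)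
    (fun t ht => (hΦ t (Ioo_subset_Icc_self ht)).hasDerivWithinAt) hint ?_
  · simpa [huα, huβ] using key
  intro t ht
  have htc := Ioo_subset_Icc_self ht
  obtain ⟨-, hsym, hUv⟩ := hU' t htc
  have h1 : B (u₁ t) v₀ = 0 := by
    have h2 : HasDerivAt (fun t => B (u t) v₀) (B (u₁ t) v₀) t := by
      simpa using hasDerivAt_bilin B (hu t htc) (hasDerivAt_const t v₀)
    refine h2.unique ((hasDerivAt_const t (0 : ℝ)).congr_of_eventuallyEq ?_)
    filter_upwards [Icc_mem_nhds ht.1 ht.2] with r hr using huv r hr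
  have h2 : B (u₁ t - U t (u t)) v₀ = 0 := by
    rw [map_sub, sub_apply, h1, hsym, hUv, map_smul, huv t htc]
    simp
  have h3 := hB _ h2
  simp only [map_sub, sub_apply, map_add, add_apply,
    map_neg, neg_apply, ContinuousLinearMap.comp_apply] at h3 ⊢
  have h4 := hsym (U t (u t)) (u t)
  have h5 := hsym (u₁ t) (u t)
  have h6 := hBs (u₁ t) (U t (u t))
  linarith

end Index

/-! ### Completeness, convergence and the vanishing of the screen curvature -/

/-- Non-negativity of the index form with curvature matrix `r` on the fields `f e_i + ρ e_j`, where
`e` is an orthonormal parallel screen frame; `f`, `ρ` vanish at both ends. -/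
def IndexNonneg {ι : Type*} [DecidableEq ι] (r : ι → ι → ℝ → ℝ) (I : Set ℝ) : Prop :=
  ∀ i j, ∀ α ∈ I, ∀ β ∈ I, α < β → ∀ f f₁ ρ ρ₁ : ℝ → ℝ,
    (∀ t ∈ Icc α β, HasDerivAt f (f₁ t) t) → (∀ t ∈ Icc α β, HasDerivAt ρ (ρ₁ t) t) →
    ContinuousOn f₁ (Icc α β) → ContinuousOn ρ₁ (Icc α β) → f α = 0 → f β = 0 → ρ α = 0 →
    ρ β = 0 →
    0 ≤ ∫ t in α..β, (f₁ t ^ 2 + 2 * (f₁ t * ρ₁ t * (if i = j then 1 else 0)) + ρ₁ t ^ 2 -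
      (f t ^ 2 * r i i t + 2 * (f t * ρ t * r i j t) + ρ t ^ 2 * r j j t))

/-- `index_nonneg`, written out in components with respect to an orthonormal screen frame. -/
lemma indexNonneg_of_noConjugate {V ι : Type*} [NormedAddCommGroup V] [NormedSpace ℝ V]
    [FiniteDimensional ℝ V] [DecidableEq ι] {I : Set ℝ} (hI : IsOpenInterval I)
    {B : V →L[ℝ] V →L[ℝ] ℝ} (hBs : ∀ y z, B y z = B z y) {R : ℝ → V →L[ℝ] V}
    (hRc : ContinuousOn R I) (hRs : ∀ t ∈ I, ∀ y z, B (R t y) z = B y (R t z)) {v₀ : V}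
    (hRv : ∀ t ∈ I, R t v₀ = 0) (hB : ∀ y, B y v₀ = 0 → 0 ≤ B y y) (hconj : NoConjugate R I)
    {e : ι → V} (he : ∀ i j, B (e i) (e j) = if i = j then 1 else 0) (hev : ∀ i, B (e i) v₀ = 0) :
    IndexNonneg (fun i j t => B (R t (e i)) (e j)) I := by
  intro i j α hα β hβ hαβ f f₁ ρ ρ₁ hf hρ hf₁ hρ₁ hfα hfβ hρα hρβ
  have h := index_nonneg hI hBs hRc hRs hRv hB hconj hα hβ hαβ
    (u := fun t => f t • e i + ρ t • e j) (u₁ := fun t => f₁ t • e i + ρ₁ t • e j)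
    (fun t ht => ((hf t ht).smul_const _).add ((hρ t ht).smul_const _))
    ((hf₁.smul continuousOn_const).add (hρ₁.smul continuousOn_const))
    (fun t _ => by simp [hev]) (by simp [hfα, hρα]) (by simp [hfβ, hρβ])
  convert! h using 1
  refine intervalIntegral.integral_congr fun t ht => ?_
  rw [uIcc_of_le hαβ.le] at ht
  have hsub : t ∈ I := hI.2.1.out hα hβ ht
  have hji : B (R t (e j)) (e i) = B (R t (e i)) (e j) := by rw [hRs t hsub, hBs]
  simp only [map_add, map_smul, add_apply, smul_apply, smul_eq_mul, he, hji, if_true,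
    eq_comm (a := j) (b := i)]
  ring

section Completeness

variable {ι : Type*} [Fintype ι] [DecidableEq ι] {I : Set ℝ} {τ σ : ℝ → ℝ}

/-- A surjective parameter `τ` with positive speed is strictly increasing, so it reaches `-T` before
`T`. -/
lemma exists_times (hI : IsOpenInterval I) (hτ : ∀ t ∈ I, HasDerivAt τ (σ t) t)
    (hσ : ∀ t ∈ I, 0 < σ t) (hsurj : ∀ T, ∃ t ∈ I, τ t = T) {T : ℝ} (hT : 0 < T) :
    StrictMonoOn τ I ∧ ∃ α ∈ I, ∃ β ∈ I, α < β ∧ τ α = -T ∧ τ β = T := by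
  have hmono : StrictMonoOn τ I := by
    refine strictMonoOn_of_deriv_pos hI.2.1.convex
      (fun t ht => (hτ t ht).continuousAt.continuousWithinAt) fun t ht => ?_
    rw [hI.1.interior_eq] at ht
    rw [(hτ t ht).deriv]; exact hσ t ht
  obtain ⟨α, hα, hαT⟩ := hsurj (-T)
  obtain ⟨β, hβ, hβT⟩ := hsurj T
  exact ⟨hmono, α, hα, β, hβ, (hmono.lt_iff_lt hα hβ).1 (by linarith), hαT, hβT⟩

/-- The trace of the index form on `f e_i`, `f = e^{aψ} h(τ)` with `h = 1 - τ²/T²` and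
`a = (1-ε)/m`. The choice of `a` makes `e^{2aψ} τ' = 1`, so that the total is estimated by a
multiple of `∫ h_τ² dτ = 8/(3T)`. -/
lemma weight_integral_le (hI : IsOpenInterval I) {r : ι → ι → ℝ → ℝ}
    (hr : ∀ i j, ContinuousOn (r i j) I) (hidx : IndexNonneg r I) {ψ ψ₁ ψ₂ : ℝ → ℝ}
    (hψ : ∀ t ∈ I, HasDerivAt ψ (ψ₁ t) t) (hψ₁ : ∀ t ∈ I, HasDerivAt ψ₁ (ψ₂ t) t)
    (hψ₂ : ContinuousOn ψ₂ I) {m k ε K : ℝ} (hm : m = Fintype.card ι) (hm0 : 0 < m)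
    (hK : K = (1 - ε ^ 2) / m + k) (hK0 : 0 < K)
    (hric : ∀ t ∈ I, 0 ≤ ∑ i, r i i t + ψ₂ t - k * ψ₁ t ^ 2)
    (hτ : ∀ t ∈ I, HasDerivAt τ (Real.exp (2 * (ε - 1) / m * ψ t)) t) {T : ℝ} (hT : 0 < T)
    {α β : ℝ} (hα : α ∈ I) (hβ : β ∈ I) (hαβ : α < β) (hτα : τ α = -T) (hτβ : τ β = T) :
    K / 2 * ∫ t in α..β, ψ₁ t ^ 2 * (Real.exp ((1 - ε) / m * ψ t) * (1 - τ t ^ 2 / T ^ 2)) ^ 2 ≤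
      (m + 2 * ε ^ 2 / K) * (8 / (3 * T)) := by
  set a := (1 - ε) / m with ha
  set C := m + 2 * ε ^ 2 / K with hC
  set E : ℝ → ℝ := fun t => Real.exp (a * ψ t) with hE
  set σ : ℝ → ℝ := fun t => Real.exp (2 * (ε - 1) / m * ψ t) with hσ
  have hEσ : ∀ t, E t ^ 2 * σ t = 1 := fun t => by
    simp only [hE, hσ, ← Real.exp_nat_mul, ← Real.exp_add]
    rw [Real.exp_eq_one_iff, ha]; field_simp; push_cast; ring
  have hsub : Icc α β ⊆ I := hI.2.1.out hα hβ
  have hcψ : ContinuousOn ψ I := fun t ht => (hψ t ht).continuousAt.continuousWithinAt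
  have hcψ₁ : ContinuousOn ψ₁ I := fun t ht => (hψ₁ t ht).continuousAt.continuousWithinAt
  have hcτ : ContinuousOn τ I := fun t ht => (hτ t ht).continuousAt.continuousWithinAt
  have hcE : ContinuousOn E I := (continuousOn_const.mul hcψ).rexp
  have hcσ : ContinuousOn σ I := (continuousOn_const.mul hcψ).rexp
  set f : ℝ → ℝ := fun t => E t * (1 - τ t ^ 2 / T ^ 2) with hf
  set f₁ : ℝ → ℝ := fun t => E t * (a * ψ₁ t * (1 - τ t ^ 2 / T ^ 2) +
    (-2 * τ t / T ^ 2) * σ t) with hf₁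
  have hfd : ∀ t ∈ I, HasDerivAt f (f₁ t) t := fun t ht => by
    have h1 : HasDerivAt E (E t * (a * ψ₁ t)) t := ((hψ t ht).const_mul a).exp
    have h2 : HasDerivAt (fun t => 1 - τ t ^ 2 / T ^ 2) (-2 * τ t / T ^ 2 * σ t) t := by
      refine ((((hτ t ht).pow 2).div_const (T ^ 2)).const_sub 1).congr_deriv ?_
      simp only [hσ]; push_cast; ring
    refine (h1.mul h2).congr_deriv ?_
    simp only [hf₁]; ring
  have hcf : ContinuousOn f I := fun t ht => (hfd t ht).continuousAt.continuousWithinAt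
  have hcf₁ : ContinuousOn f₁ I := by fun_prop
  have hfα : f α = 0 := by simp [hf, hτα, hT.ne']
  have hfβ : f β = 0 := by simp [hf, hτβ, hT.ne']
  have hii : ∀ i, 0 ≤ ∫ t in α..β, (f₁ t ^ 2 - f t ^ 2 * r i i t) := fun i => by
    have h := hidx i i α hα β hβ hαβ f f₁ 0 0 (fun t ht => hfd t (hsub ht))
      (fun t _ => hasDerivAt_const t (0 : ℝ)) (hcf₁.mono hsub) continuousOn_const hfα hfβ rfl rfl
    simpa using h
  have hint : ∀ g : ℝ → ℝ, ContinuousOn g I → IntervalIntegrable g MeasureTheory.volume α β :=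
    fun g hg => (hg.mono (by rwa [uIcc_of_le hαβ.le])).intervalIntegrable
  have hsum : 0 ≤ ∫ t in α..β, (m * f₁ t ^ 2 - f t ^ 2 * ∑ i, r i i t) := by
    have h1 : 0 ≤ ∑ i, ∫ t in α..β, (f₁ t ^ 2 - f t ^ 2 * r i i t) :=
      Finset.sum_nonneg fun i _ => hii i
    rw [← intervalIntegral.integral_finsetSum fun i _ => hint _ (by fun_prop)] at h1
    convert! h1 using 3 with t
    simp only [Finset.sum_sub_distrib, Finset.sum_const, Finset.card_univ, nsmul_eq_mul, hm,
      Finset.mul_sum]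
  -- the derivative of `f² ψ₁` turns `f² ψ₂` into a boundary term, and the second summand of `g` is a
  -- primitive of `C h_τ² τ'`
  set g : ℝ → ℝ := fun t => f t ^ 2 * ψ₁ t + C * (4 * τ t ^ 3 / (3 * T ^ 4)) with hg
  set g₁ : ℝ → ℝ := fun t => 2 * f t * f₁ t * ψ₁ t + f t ^ 2 * ψ₂ t +
    C * ((-2 * τ t / T ^ 2) ^ 2 * σ t) with hg₁
  have hgd : ∀ t ∈ I, HasDerivAt g (g₁ t) t := fun t ht => by
    have h1 := ((hfd t ht).pow 2).mul (hψ₁ t ht)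
    have h2 := ((((hτ t ht).pow 3).const_mul 4).div_const (3 * T ^ 4)).const_mul C
    refine (h1.add h2).congr_deriv ?_
    simp only [hg₁, hσ, Pi.pow_apply]; push_cast; field_simp; ring
  have hcg₁ : ContinuousOn g₁ I := by fun_prop
  have hgint : ∫ t in α..β, g₁ t = C * (8 / (3 * T)) := by
    rw [intervalIntegral.integral_eq_sub_of_hasDerivAt
      (fun t ht => hgd t (hsub (by rwa [uIcc_of_le hαβ.le] at ht))) (hint _ hcg₁)]
    simp only [hg, hfα, hfβ, hτα, hτβ]
    field_simp; ring
  -- complete the square in the cross term `ψ₁ τ' h h_τ`, at the cost of half of `K ψ₁² f²`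
  have hpt : ∀ t ∈ Icc α β, m * f₁ t ^ 2 - f t ^ 2 * ∑ i, r i i t ≤
      g₁ t - K / 2 * (ψ₁ t ^ 2 * f t ^ 2) := fun t ht => by
    have h1 := mul_nonneg (sq_nonneg (f t)) (hric t (hsub ht))
    set q := -2 * τ t / T ^ 2
    set h := 1 - τ t ^ 2 / T ^ 2
    have h2 : 0 ≤ E t ^ 2 * (2 * ε * (q * σ t) + K * (ψ₁ t * h)) ^ 2 / (2 * K) := by positivity
    have h3 : g₁ t - K / 2 * (ψ₁ t ^ 2 * f t ^ 2) - (m * f₁ t ^ 2 - f t ^ 2 * ∑ i, r i i t) =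
        f t ^ 2 * (∑ i, r i i t + ψ₂ t - k * ψ₁ t ^ 2) +
          E t ^ 2 * (2 * ε * (q * σ t) + K * (ψ₁ t * h)) ^ 2 / (2 * K) := by
      have h4 : C * (q ^ 2 * σ t) = C * q ^ 2 * σ t ^ 2 * E t ^ 2 := by
        linear_combination (-C * q ^ 2 * σ t) * hEσ t
      have hma : a * m = 1 - ε := by rw [ha]; field_simp
      have hk : k = K - 2 * a + a ^ 2 * m := by rw [hK, ha]; field_simp; ring
      have hCK : C * K = m * K + 2 * ε ^ 2 := by rw [hC]; field_simp
      have hε : ε = 1 - a * m := by linarith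
      simp only [hg₁, hf, hf₁]
      change _ + _ + C * (q ^ 2 * σ t) - _ - _ = _
      rw [h4, hk]
      change 2 * (E t * h) * (E t * (a * ψ₁ t * h + q * σ t)) * ψ₁ t + (E t * h) ^ 2 * ψ₂ t +
        C * q ^ 2 * σ t ^ 2 * E t ^ 2 - K / 2 * (ψ₁ t ^ 2 * (E t * h) ^ 2) -
        (m * (E t * (a * ψ₁ t * h + q * σ t)) ^ 2 - (E t * h) ^ 2 * ∑ i, r i i t) =
        (E t * h) ^ 2 * (∑ i, r i i t + ψ₂ t - (K - 2 * a + a ^ 2 * m) * ψ₁ t ^ 2) + _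
      rw [eq_comm, ← sub_eq_zero]
      have hC' : C = m + 2 * (1 - a * m) ^ 2 / K := by rw [← hε]
      rw [hC', hε]
      field_simp
      ring
    linarith
  have hle : ∫ t in α..β, (m * f₁ t ^ 2 - f t ^ 2 * ∑ i, r i i t) ≤
      ∫ t in α..β, (g₁ t - K / 2 * (ψ₁ t ^ 2 * f t ^ 2)) :=
    intervalIntegral.integral_mono_on hαβ.le (hint _ (by fun_prop)) (hint _ (by fun_prop)) hpt
  rw [intervalIntegral.integral_sub (hint _ hcg₁) (hint _ (by fun_prop)), hgint,
    intervalIntegral.integral_const_mul] at hle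
  linarith

end Completeness

section Completeness

variable {ι : Type*} [Fintype ι] [DecidableEq ι] {I : Set ℝ} {τ σ : ℝ → ℝ}

/-- A continuous function that is positive at a point of an open interval is bounded below by a
positive constant near it. -/
lemma exists_Icc_lower_bound (hI : IsOpenInterval I) {φ : ℝ → ℝ} (hφ : ContinuousOn φ I) {t₁ : ℝ}
    (ht₁ : t₁ ∈ I) (hpos : 0 < φ t₁) :
    ∃ w > 0, Icc (t₁ - w) (t₁ + w) ⊆ I ∧ ∀ t ∈ Icc (t₁ - w) (t₁ + w), φ t₁ / 2 ≤ φ t := by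
  have h1 : ∀ᶠ t in 𝓝 t₁, t ∈ I ∧ φ t₁ / 2 ≤ φ t :=
    Filter.Eventually.and (hI.1.mem_nhds ht₁) (((hφ.continuousAt (hI.1.mem_nhds ht₁)).eventually_const_lt
      (half_lt_self hpos)).mono fun _ h => h.le)
  obtain ⟨ε, hε, hb⟩ := Metric.eventually_nhds_iff_ball.1 h1
  rw [Real.ball_eq_Ioo] at hb
  have hss : Icc (t₁ - ε / 2) (t₁ + ε / 2) ⊆ Ioo (t₁ - ε) (t₁ + ε) :=
    Icc_subset_Ioo (by linarith) (by linarith)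
  exact ⟨ε / 2, by positivity, fun t ht => (hb t (hss ht)).1, fun t ht => (hb t (hss ht)).2⟩

/-- The weight is constant along a complete curve with non-negative index form: the estimate of
`weight_integral_le` decays like `1/T`, whereas its left-hand side stays bounded below if `ψ₁` is
non-zero somewhere. -/
lemma weight_deriv_eq_zero (hI : IsOpenInterval I) {r : ι → ι → ℝ → ℝ}
    (hr : ∀ i j, ContinuousOn (r i j) I) (hidx : IndexNonneg r I) {ψ ψ₁ ψ₂ : ℝ → ℝ}
    (hψ : ∀ t ∈ I, HasDerivAt ψ (ψ₁ t) t) (hψ₁ : ∀ t ∈ I, HasDerivAt ψ₁ (ψ₂ t) t)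
    (hψ₂ : ContinuousOn ψ₂ I) {m k ε K : ℝ} (hm : m = Fintype.card ι) (hm0 : 0 < m)
    (hK : K = (1 - ε ^ 2) / m + k) (hK0 : 0 < K)
    (hric : ∀ t ∈ I, 0 ≤ ∑ i, r i i t + ψ₂ t - k * ψ₁ t ^ 2)
    (hτ : ∀ t ∈ I, HasDerivAt τ (Real.exp (2 * (ε - 1) / m * ψ t)) t)
    (hsurj : ∀ T, ∃ t ∈ I, τ t = T) : ∀ t ∈ I, ψ₁ t = 0 := by
  intro t₁ ht₁
  by_contra hne
  set a := (1 - ε) / m with ha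
  have hcψ : ContinuousOn ψ I := fun t ht => (hψ t ht).continuousAt.continuousWithinAt
  have hcψ₁ : ContinuousOn ψ₁ I := fun t ht => (hψ₁ t ht).continuousAt.continuousWithinAt
  have hcτ : ContinuousOn τ I := fun t ht => (hτ t ht).continuousAt.continuousWithinAt
  set φ : ℝ → ℝ := fun t => ψ₁ t ^ 2 * Real.exp (a * ψ t) ^ 2 with hφ
  have hφ0 : 0 < φ t₁ := by positivity
  have hcφ : ContinuousOn φ I := by fun_prop
  obtain ⟨w, hw, hwI, hwφ⟩ := exists_Icc_lower_bound hI hcφ ht₁ hφ0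
  set c := t₁ - w with hc
  set d := t₁ + w with hd
  have hcd : c ≤ d := by linarith
  have hcI : c ∈ I := hwI ⟨le_rfl, hcd⟩
  have hdI : d ∈ I := hwI ⟨hcd, le_rfl⟩
  set C := (m + 2 * ε ^ 2 / K) * 8 with hC
  have hC0 : 0 < C := by positivity
  set D := K / 2 * (2 * w * (φ t₁ / 8)) with hD
  have hD0 : 0 < D := by positivity
  set T := 2 * (|τ c| + |τ d|) + 1 + C / D with hT
  have hCD : 0 < C / D := by positivity
  have hT0 : 0 < T := by positivity
  obtain ⟨hmono, α, hα, β, hβ, hαβ, hτα, hτβ⟩ := exists_times hI hτ (fun t _ => Real.exp_pos _)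
    hsurj hT0
  have hαc : α ≤ c := (hmono.le_iff_le hα hcI).1 (by
    rw [hτα]; linarith [neg_abs_le (τ c), abs_nonneg (τ c), abs_nonneg (τ d)])
  have hdβ : d ≤ β := (hmono.le_iff_le hdI hβ).1 (by
    rw [hτβ]; linarith [le_abs_self (τ d), abs_nonneg (τ c), abs_nonneg (τ d)])
  have hsub : Icc α β ⊆ I := hI.2.1.out hα hβ
  have hmain := weight_integral_le hI hr hidx hψ hψ₁ hψ₂ hm hm0 hK hK0 hric hτ hT0 hα hβ hαβ
    hτα hτβ
  rw [← ha] at hmain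
  set F : ℝ → ℝ := fun t => ψ₁ t ^ 2 * (Real.exp (a * ψ t) * (1 - τ t ^ 2 / T ^ 2)) ^ 2 with hF
  have hcF : ContinuousOn F I := by fun_prop
  have hint : ∀ x ∈ I, ∀ y ∈ I, IntervalIntegrable F MeasureTheory.volume x y := fun x hx y hy =>
    (hcF.mono (hI.2.1.uIcc_subset hx hy)).intervalIntegrable
  have h1 : ∫ t in c..d, F t ≤ ∫ t in α..β, F t :=
    intervalIntegral.integral_mono_interval hαc hcd hdβ
      (Eventually.of_forall fun t => by simp only [hF, Pi.zero_apply]; positivity) (hint α hα β hβ)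
  have h2 : ∫ t in c..d, φ t₁ / 8 ≤ ∫ t in c..d, F t := by
    refine intervalIntegral.integral_mono_on hcd intervalIntegrable_const (hint c hcI d hdI)
      fun t ht => ?_
    have htI : t ∈ I := hwI ht
    have h3 : |τ t| ≤ T / 2 := by
      rw [abs_le]
      constructor
      · have := hmono.monotoneOn hcI htI ht.1
        linarith [neg_abs_le (τ c), abs_nonneg (τ c), abs_nonneg (τ d)]
      · have := hmono.monotoneOn htI hdI ht.2
        linarith [le_abs_self (τ d), abs_nonneg (τ c), abs_nonneg (τ d)]
    have h4 : τ t ^ 2 / T ^ 2 ≤ 1 / 4 := by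
      rw [div_le_iff₀ (by positivity), ← sq_abs]
      nlinarith [abs_nonneg (τ t)]
    have h5 : (1 / 4 : ℝ) ≤ (1 - τ t ^ 2 / T ^ 2) ^ 2 := by nlinarith
    calc φ t₁ / 8 = φ t₁ / 2 * (1 / 4) := by ring
      _ ≤ φ t * (1 - τ t ^ 2 / T ^ 2) ^ 2 := by
        refine mul_le_mul (hwφ t ht) h5 (by norm_num) ?_
        simp only [hφ]; positivity
      _ = F t := by simp only [hF, hφ]; ring
  rw [intervalIntegral.integral_const, smul_eq_mul] at h2
  have h6 : D ≤ C / (3 * T) := by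
    calc D = K / 2 * ((d - c) * (φ t₁ / 8)) := by simp only [hD, hc, hd]; ring
      _ ≤ K / 2 * ∫ t in α..β, F t := by gcongr; exact h2.trans h1
      _ ≤ _ := hmain
      _ = C / (3 * T) := by simp only [hC]; ring
  rw [le_div_iff₀ (by positivity)] at h6
  have h7 : D * (C / D) = C := by field_simp
  have h8 : D * (3 * T) = D * (6 * (|τ c| + |τ d|) + 3) + 3 * (D * (C / D)) := by
    simp only [hT]; ring
  have h9 : 0 < D * (6 * (|τ c| + |τ d|) + 3) := by positivity
  linarith

/-- A number `b₀` with `(b₀ + b₁/T²)² ≤ C/T` for all large `T` vanishes. -/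
lemma eq_zero_of_sq_le {b₀ b₁ C T₀ : ℝ} (h : ∀ T > T₀, (b₀ + b₁ / T ^ 2) ^ 2 ≤ C / T) :
    b₀ = 0 := by
  have h1 : Tendsto (fun T : ℝ => (b₀ + b₁ / T ^ 2) ^ 2) atTop (𝓝 ((b₀ + 0) ^ 2)) :=
    (tendsto_const_nhds.add (tendsto_const_nhds.div_atTop (tendsto_pow_atTop two_ne_zero))).pow 2
  have h2 : Tendsto (fun T : ℝ => C / T) atTop (𝓝 0) := tendsto_const_nhds.div_atTop tendsto_id
  have h3 := le_of_tendsto_of_tendsto h1 h2 ((eventually_gt_atTop T₀).mono h)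
  simpa using le_antisymm h3 (sq_nonneg _)

/-- With a constant weight and non-negative Ricci curvature, a non-zero entry of the curvature
matrix would make the index form negative on a small perturbation, supported near a point, of
`(1 - τ²/T²) e_i` with large `T`. -/
lemma curvature_entry_eq_zero (hI : IsOpenInterval I) {r : ι → ι → ℝ → ℝ}
    (hr : ∀ i j, ContinuousOn (r i j) I) (hidx : IndexNonneg r I) {m s : ℝ}
    (hm : m = Fintype.card ι) (hs : 0 < s) (hric : ∀ t ∈ I, 0 ≤ ∑ i, r i i t)
    (hτ : ∀ t ∈ I, HasDerivAt τ s t) (hsurj : ∀ T, ∃ t ∈ I, τ t = T) (i j : ι) :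
    ∀ t ∈ I, r i j t = 0 := by
  intro t₁ ht₁
  by_contra hne
  have hcτ : ContinuousOn τ I := fun t ht => (hτ t ht).continuousAt.continuousWithinAt
  -- `θ` is a factor, namely the entry at `t₁` itself, that makes `θ r i j` positive at `t₁`
  obtain ⟨θ, hθ, hθ0⟩ : ∃ θ : ℝ, 0 < θ * r i j t₁ ∧ θ ≠ 0 :=
    ⟨r i j t₁, mul_self_pos.2 hne, hne⟩
  obtain ⟨w, hw, hwI, hwφ⟩ := exists_Icc_lower_bound hI (φ := fun t => θ * r i j t)
    (continuousOn_const.mul (hr i j)) ht₁ hθ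
  let ρ : ContDiffBump t₁ := ⟨w / 4, w / 2, by positivity, by linarith⟩
  set c := t₁ - w with hc
  set d := t₁ + w with hd
  have hcd : c ≤ d := by linarith
  have hcI : c ∈ I := hwI ⟨le_rfl, hcd⟩
  have hdI : d ∈ I := hwI ⟨hcd, le_rfl⟩
  have hρ : ∀ t, HasDerivAt ρ (deriv ρ t) t := fun t =>
    ((ρ.contDiff (n := 1)).differentiable one_ne_zero t).hasDerivAt
  have hcρ : Continuous ρ := ρ.continuous
  have hcρ₁ : Continuous (deriv ρ) := (ρ.contDiff (n := 1)).continuous_deriv le_rfl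
  have hout : ∀ t, t ∉ Ioc c d → ρ t = 0 ∧ deriv ρ t = 0 := by
    intro t ht
    have h1 : t ∉ tsupport ρ := by
      rw [ρ.tsupport_eq, Real.closedBall_eq_Icc]
      intro h
      have h' : t₁ - w / 2 ≤ t ∧ t ≤ t₁ + w / 2 := h
      exact ht ⟨by linarith [h'.1], by linarith [h'.2]⟩
    exact ⟨image_eq_zero_of_notMem_tsupport h1, image_eq_zero_of_notMem_tsupport fun h =>
      h1 (tsupport_deriv_subset (𝕜 := ℝ) h)⟩
  set δ : ℝ := if i = j then 1 else 0 with hδ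
  set b₀ := -∫ t in c..d, ρ t * r i j t with hb₀
  set b₁ := ∫ t in c..d, (-2 * τ t * s * deriv ρ t * δ + τ t ^ 2 * ρ t * r i j t) with hb₁
  set q := ∫ t in c..d, (deriv ρ t ^ 2 - ρ t ^ 2 * r j j t) with hq
  have hint : ∀ g : ℝ → ℝ, ContinuousOn g I → ∀ x ∈ I, ∀ y ∈ I,
      IntervalIntegrable g MeasureTheory.volume x y := fun g hg x hx y hy =>
    (hg.mono (hI.2.1.uIcc_subset hx hy)).intervalIntegrable
  -- the index form on `(1 - τ²/T²) e_i + x ρ e_j`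
  have hquad : ∀ T > |τ c| + |τ d| + 1, ∃ Q, Q ≤ m * s * (8 / (3 * T)) ∧
      ∀ x : ℝ, 0 ≤ Q + 2 * x * (b₀ + b₁ / T ^ 2) + x ^ 2 * q := by
    intro T hT
    have hT0 : 0 < T := by linarith [abs_nonneg (τ c), abs_nonneg (τ d)]
    obtain ⟨hmono, α, hα, β, hβ, hαβ, hτα, hτβ⟩ := exists_times hI hτ (fun t _ => hs) hsurj hT0
    have hαc : α < c := (hmono.lt_iff_lt hα hcI).1 (by
      rw [hτα]; linarith [neg_abs_le (τ c), abs_nonneg (τ c), abs_nonneg (τ d)])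
    have hdβ : d < β := (hmono.lt_iff_lt hdI hβ).1 (by
      rw [hτβ]; linarith [le_abs_self (τ d), abs_nonneg (τ c), abs_nonneg (τ d)])
    have hsub : Icc α β ⊆ I := hI.2.1.out hα hβ
    set f : ℝ → ℝ := fun t => 1 - τ t ^ 2 / T ^ 2 with hf
    set f₁ : ℝ → ℝ := fun t => -2 * τ t / T ^ 2 * s with hf₁
    have hfd : ∀ t ∈ I, HasDerivAt f (f₁ t) t := fun t ht => by
      refine ((((hτ t ht).pow 2).div_const (T ^ 2)).const_sub 1).congr_deriv ?_
      simp only [hf₁]; push_cast; ring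
    have hcf : ContinuousOn f I := fun t ht => (hfd t ht).continuousAt.continuousWithinAt
    have hcf₁ : ContinuousOn f₁ I := by fun_prop
    have hfα : f α = 0 := by simp [hf, hτα, hT0.ne']
    have hfβ : f β = 0 := by simp [hf, hτβ, hT0.ne']
    have hii : ∀ i, 0 ≤ ∫ t in α..β, (f₁ t ^ 2 - f t ^ 2 * r i i t) := fun i => by
      have h := hidx i i α hα β hβ hαβ f f₁ 0 0 (fun t ht => hfd t (hsub ht))
        (fun t _ => hasDerivAt_const t (0 : ℝ)) (hcf₁.mono hsub) continuousOn_const hfα hfβ rfl rfl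
      simpa using h
    refine ⟨∫ t in α..β, (f₁ t ^ 2 - f t ^ 2 * r i i t), ?_, fun x => ?_⟩
    · have h1 : ∫ t in α..β, (f₁ t ^ 2 - f t ^ 2 * r i i t) ≤
          ∑ i, ∫ t in α..β, (f₁ t ^ 2 - f t ^ 2 * r i i t) :=
        Finset.single_le_sum (f := fun i => ∫ t in α..β, (f₁ t ^ 2 - f t ^ 2 * r i i t))
          (fun i _ => hii i) (Finset.mem_univ i)
      rw [← intervalIntegral.integral_finsetSum fun i _ => hint _ (by fun_prop) α hα β hβ] at h1
      refine h1.trans ?_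
      have h2 : ∫ t in α..β, ∑ i, (f₁ t ^ 2 - f t ^ 2 * r i i t) ≤
          ∫ t in α..β, m * s * (4 * τ t ^ 2 * s / T ^ 4) := by
        refine intervalIntegral.integral_mono_on hαβ.le (hint _ (by fun_prop) α hα β hβ)
          (hint _ (by fun_prop) α hα β hβ) fun t ht => ?_
        have h3 := mul_nonneg (sq_nonneg (f t)) (hric t (hsub ht))
        rw [Finset.sum_sub_distrib, Finset.sum_const, Finset.card_univ, nsmul_eq_mul, ← hm,
          ← Finset.mul_sum]
        have h4 : m * f₁ t ^ 2 = m * s * (4 * τ t ^ 2 * s / T ^ 4) := by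
          simp only [hf₁]; field_simp; ring
        linarith
      refine h2.trans_eq ?_
      rw [intervalIntegral.integral_const_mul, intervalIntegral.integral_eq_sub_of_hasDerivAt
        (f := fun t => 4 * τ t ^ 3 / (3 * T ^ 4)) (fun t ht => ?_)
        (hint _ (by fun_prop) α hα β hβ)]
      · simp only [hτα, hτβ]; field_simp; ring
      · rw [uIcc_of_le hαβ.le] at ht
        refine ((((hτ t (hsub ht)).pow 3).const_mul 4).div_const (3 * T ^ 4)).congr_deriv ?_
        push_cast; field_simp
    · have h := hidx i j α hα β hβ hαβ f f₁ (fun t => x * ρ t) (fun t => x * deriv ρ t)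
        (fun t ht => hfd t (hsub ht)) (fun t _ => (hρ t).const_mul x) (hcf₁.mono hsub)
        (by fun_prop) hfα hfβ
        (by rw [(hout α fun h => absurd h.1 (by linarith)).1, mul_zero])
        (by rw [(hout β fun h => absurd h.2 (by linarith)).1, mul_zero])
      refine h.trans_eq ?_
      -- the terms that contain the bump function are supported in `(c, d]`
      have hsupp : ∀ g : ℝ → ℝ, (∀ t, t ∉ Ioc c d → g t = 0) →
          ∫ t in α..β, g t = ∫ t in c..d, g t := fun g hg => by
        rw [intervalIntegral.integral_eq_integral_of_support_subset fun t ht => ?_,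
          intervalIntegral.integral_eq_integral_of_support_subset fun t ht => ?_]
        · by_contra hn; exact ht (hg t hn)
        · by_contra hn
          exact ht (hg t fun hcd' => hn ⟨by linarith [hcd'.1], by linarith [hcd'.2]⟩)
      have e1 : b₀ + b₁ / T ^ 2 = ∫ t in α..β, (f₁ t * deriv ρ t * δ - f t * ρ t * r i j t) := by
        rw [hsupp _ fun t ht => by rw [(hout t ht).1, (hout t ht).2]; ring, hb₀, hb₁,
          ← intervalIntegral.integral_neg, ← intervalIntegral.integral_div,
          ← intervalIntegral.integral_add (hint _ (by fun_prop) c hcI d hdI)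
            (hint _ (by fun_prop) c hcI d hdI)]
        refine intervalIntegral.integral_congr fun t _ => ?_
        simp only [hf, hf₁]; field_simp; ring
      have e2 : q = ∫ t in α..β, (deriv ρ t ^ 2 - ρ t ^ 2 * r j j t) := by
        rw [hsupp _ fun t ht => by rw [(hout t ht).1, (hout t ht).2]; ring]
      rw [e1, e2, ← intervalIntegral.integral_const_mul, ← intervalIntegral.integral_const_mul,
        ← intervalIntegral.integral_add (hint _ (by fun_prop) α hα β hβ)
          (hint _ (by fun_prop) α hα β hβ),
        ← intervalIntegral.integral_add (hint _ (by fun_prop) α hα β hβ)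
          (hint _ (by fun_prop) α hα β hβ)]
      refine intervalIntegral.integral_congr fun t _ => ?_
      simp only [hδ]
      ring
  have hq0 : 0 ≤ q := by
    by_contra hq
    push Not at hq
    obtain ⟨Q, -, hQ⟩ := hquad (|τ c| + |τ d| + 2) (by linarith)
    set T := |τ c| + |τ d| + 2
    have h1 := hQ 0
    -- the even part of a quadratic polynomial with negative leading coefficient is negative far out
    have h2 := hQ (1 + Q / -q)
    have h3 := hQ (-(1 + Q / -q))
    have h4 : 0 ≤ Q / -q := div_nonneg (by simpa using h1) (by linarith)
    have h5 : Q / -q * q = -Q := by rw [div_neg, neg_mul, div_mul_cancel₀ _ hq.ne]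
    nlinarith [mul_nonneg h4 h4]
  have hb0 : b₀ = 0 := by
    refine eq_zero_of_sq_le (b₁ := b₁) (C := m * s * (8 / 3) * q) (T₀ := |τ c| + |τ d| + 1)
      fun T hT => ?_
    obtain ⟨Q, hQT, hQ⟩ := hquad T hT
    have hT0 : 0 < T := by linarith [abs_nonneg (τ c), abs_nonneg (τ d)]
    have h1 : discrim q (2 * (b₀ + b₁ / T ^ 2)) Q ≤ 0 :=
      discrim_le_zero fun x => by linarith [hQ x]
    rw [discrim] at h1
    calc (b₀ + b₁ / T ^ 2) ^ 2 ≤ Q * q := by nlinarith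
      _ ≤ m * s * (8 / (3 * T)) * q := by gcongr
      _ = m * s * (8 / 3) * q / T := by field_simp
  have hpos : 0 < ∫ t in (t₁ - w / 2)..(t₁ + w / 2), ρ t * (θ * r i j t) := by
    have hss : Icc (t₁ - w / 2) (t₁ + w / 2) ⊆ Icc c d :=
      Icc_subset_Icc (by linarith) (by linarith)
    refine intervalIntegral.intervalIntegral_pos_of_pos_on ?_ (fun t ht => ?_) (by linarith)
    · refine hint _ (by fun_prop) _ (hwI (hss ⟨le_rfl, by linarith⟩)) _
        (hwI (hss ⟨by linarith, le_rfl⟩))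
    · refine mul_pos (ρ.pos_of_mem_ball ?_) ?_
      · rw [Real.ball_eq_Ioo]; exact ht
      · have := hwφ t (hss (Ioo_subset_Icc_self ht))
        linarith
  have hle : ∫ t in (t₁ - w / 2)..(t₁ + w / 2), ρ t * (θ * r i j t) ≤
      ∫ t in c..d, ρ t * (θ * r i j t) := by
    refine intervalIntegral.integral_mono_interval (by linarith) (by linarith) (by linarith) ?_
      (hint _ (by fun_prop) c hcI d hdI)
    refine (MeasureTheory.ae_restrict_iff' measurableSet_Ioc).2 (Eventually.of_forall fun t ht => ?_)
    have := hwφ t (Ioc_subset_Icc_self ht)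
    exact mul_nonneg ρ.nonneg (by linarith)
  have heq : ∫ t in c..d, ρ t * (θ * r i j t) = -(θ * b₀) := by
    rw [hb₀, mul_neg, neg_neg, ← intervalIntegral.integral_const_mul]
    exact intervalIntegral.integral_congr fun t _ => by ring
  rw [heq, hb0] at hle
  linarith

end Completeness

/-! ### Null vectors of the Minkowski form -/

section Minkowski

variable {n : ℕ}

/-- The Minkowski form `-y⁰z⁰ + y¹z¹ + … + yⁿzⁿ`, written as the Euclidean inner product minus
`2 y⁰z⁰`. -/
def mink (n : ℕ) : Model n →L[ℝ] Model n →L[ℝ] ℝ :=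
  (isBoundedBilinearMap_inner (𝕜 := ℝ) (E := Model n)).toContinuousLinearMap -
    (2 : ℝ) • (EuclideanSpace.proj (0 : Fin (n + 1)) : Model n →L[ℝ] ℝ).smulRight
    (EuclideanSpace.proj (0 : Fin (n + 1)) : Model n →L[ℝ] ℝ)

lemma mink_apply (y z : Model n) : mink n y z = inner ℝ y z - 2 * (y 0 * z 0) := by
  simp [mink]

lemma mink_comm (y z : Model n) : mink n y z = mink n z y := by
  rw [mink_apply, mink_apply, real_inner_comm, mul_comm (y 0)]

/-- The time reflection `y⁰ ↦ -y⁰`. -/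
def timeReflect (y : Model n) : Model n := y - (2 * y 0) • coordVec 0

lemma inner_coordVec (y : Model n) (i : Fin (n + 1)) : inner ℝ y (coordVec i) = y i := by
  simp [coordVec, EuclideanSpace.inner_single_right]

lemma inner_timeReflect (y z : Model n) : inner ℝ y (timeReflect z) = mink n y z := by
  rw [timeReflect, inner_sub_right, inner_smul_right, inner_coordVec, mink_apply]
  ring

lemma mink_nonneg_of_orthogonal_null {v y : Model n} (hv : v ≠ 0) (hvv : mink n v v = 0)
    (hy : mink n y v = 0) : 0 ≤ mink n y y := by
  rw [mink_apply] at *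
  have hn : 0 < inner ℝ v v := real_inner_self_pos.2 hv
  have hcs := real_inner_mul_inner_self_le y v
  have h1 : inner ℝ y v = 2 * (y 0 * v 0) := by linarith
  have h2 : inner ℝ v v = 2 * (v 0 * v 0) := by linarith
  rw [h1, h2] at hcs
  rw [h2] at hn
  have h3 : 0 ≤ (inner ℝ y y - 2 * (y 0 * y 0)) * (2 * (v 0 * v 0)) := by nlinarith
  exact nonneg_of_mul_nonneg_left h3 hn

/-- A null vector `v` and its time reflection, normalized, extend to a Euclidean orthonormal basis
the other members of which, the screen vectors, have no time component. -/
lemma exists_screen_basis {v : Model n} (hn : 2 ≤ n) (hv : v ≠ 0) (hvv : mink n v v = 0) :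
    ∃ b : OrthonormalBasis (Fin 2 ⊕ Fin (n - 1)) ℝ (Model n), ∃ c : ℝ, c ≠ 0 ∧
      b (Sum.inl 0) = c • v ∧ b (Sum.inl 1) = c • timeReflect v ∧ ∀ i,
        mink n (b (Sum.inr i)) v = 0 ∧ ∀ y, mink n (b (Sum.inr i)) y = inner ℝ (b (Sum.inr i)) y := by
  have hnv : ‖v‖ ≠ 0 := norm_ne_zero_iff.2 hv
  have hv0 : v 0 ≠ 0 := by
    intro h
    rw [mink_apply, h] at hvv
    simp at hvv
    exact hv hvv
  have hself : inner ℝ (timeReflect v) (timeReflect v) = inner ℝ v v := by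
    rw [inner_timeReflect, mink_apply, real_inner_comm, inner_timeReflect, hvv]
    rw [mink_apply] at hvv
    simp [timeReflect, coordVec]
    rw [real_inner_self_eq_norm_sq] at hvv
    linarith
  set c := ‖v‖⁻¹ with hc
  have hcc : c * (c * inner ℝ v v) = 1 := by
    rw [real_inner_self_eq_norm_sq, hc]; field_simp
  have horth : Orthonormal ℝ ((range (Sum.inl : Fin 2 → Fin 2 ⊕ Fin (n - 1))).domRestrict
      (Sum.elim ![c • v, c • timeReflect v] (fun _ => (0 : Model n)))) := by
    rw [orthonormal_iff_ite]
    rintro ⟨_, i, rfl⟩ ⟨_, j, rfl⟩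
    have h01 : inner ℝ (c • v) (c • timeReflect v) = 0 := by
      rw [inner_smul_left, inner_smul_right, inner_timeReflect, hvv]; simp
    have h10 : inner ℝ (c • timeReflect v) (c • v) = 0 := by rw [real_inner_comm, h01]
    have h00 : inner ℝ (c • v) (c • v) = 1 := by
      rw [inner_smul_left, inner_smul_right]; exact hcc
    have h11 : inner ℝ (c • timeReflect v) (c • timeReflect v) = 1 := by
      rw [inner_smul_left, inner_smul_right, hself]; exact hcc
    fin_cases i <;> fin_cases j
    · exact h00
    · exact h01
    · exact h10
    · exact h11
  obtain ⟨b, hb⟩ := horth.exists_orthonormalBasis_extension_of_card_eq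
    (by simp; omega)
  have hb0 : b (Sum.inl 0) = c • v := hb _ ⟨0, rfl⟩
  have hb1 : b (Sum.inl 1) = c • timeReflect v := hb _ ⟨1, rfl⟩
  have hc0 : c ≠ 0 := inv_ne_zero hnv
  refine ⟨b, c, hc0, hb0, hb1, fun i => ?_⟩
  have h0 : inner ℝ (b (Sum.inr i)) v = 0 := by
    have : inner ℝ (b (Sum.inr i)) (b (Sum.inl 0)) = 0 := b.orthonormal.2 (by simp)
    rw [hb0, inner_smul_right] at this
    exact (mul_eq_zero.1 this).resolve_left hc0
  have h1 : mink n (b (Sum.inr i)) v = 0 := by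
    have : inner ℝ (b (Sum.inr i)) (b (Sum.inl 1)) = 0 := b.orthonormal.2 (by simp)
    rw [hb1, inner_smul_right, inner_timeReflect] at this
    exact (mul_eq_zero.1 this).resolve_left hc0
  have h2 : b (Sum.inr i) 0 = 0 := by
    rw [mink_apply, h0] at h1
    have : b (Sum.inr i) 0 * v 0 = 0 := by linarith
    exact (mul_eq_zero.1 this).resolve_right hv0
  exact ⟨h1, fun y => by rw [mink_apply, h2]; ring⟩

/-- The analytic core: for a Jacobi equation on Minkowski space along a null direction `v₀`,
without conjugate points, completeness and convergence force the curvature to be trivial on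
`v₀^⊥ / ℝ v₀`. -/
theorem curvature_mem_span_of_complete (hn : 2 ≤ n) {I : Set ℝ} (hI : IsOpenInterval I)
    {R : ℝ → Model n →L[ℝ] Model n} (hRc : ContinuousOn R I)
    (hRs : ∀ t ∈ I, ∀ y z, mink n (R t y) z = mink n y (R t z)) {v₀ : Model n} (hv : v₀ ≠ 0)
    (hvv : mink n v₀ v₀ = 0) (hRv : ∀ t ∈ I, R t v₀ = 0) (hconj : NoConjugate R I)
    {ψ ψ₁ ψ₂ τ : ℝ → ℝ} (hψ : ∀ t ∈ I, HasDerivAt ψ (ψ₁ t) t)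
    (hψ₁ : ∀ t ∈ I, HasDerivAt ψ₁ (ψ₂ t) t) (hψ₂ : ContinuousOn ψ₂ I) {k ε : ℝ}
    (hK0 : 0 < (1 - ε ^ 2) / ((n : ℝ) - 1) + k)
    (hric : ∀ t ∈ I, 0 ≤ LinearMap.trace ℝ (Model n) (R t) + ψ₂ t - k * ψ₁ t ^ 2)
    (hτ : ∀ t ∈ I, HasDerivAt τ (Real.exp (2 * (ε - 1) / ((n : ℝ) - 1) * ψ t)) t)
    (hsurj : ∀ T, ∃ t ∈ I, τ t = T) :
    ∀ t ∈ I, ∀ x, mink n v₀ x = 0 → R t x ∈ Submodule.span ℝ {v₀} := by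
  obtain ⟨b, c, hc, hb0, hb1, hbs⟩ := exists_screen_basis hn hv hvv
  have hm : (n : ℝ) - 1 = Fintype.card (Fin (n - 1)) := by
    rw [Fintype.card_fin, Nat.cast_sub (by omega)]; simp
  have hm0 : 0 < (n : ℝ) - 1 := by
    have : (2 : ℝ) ≤ n := by exact_mod_cast hn
    linarith
  set e : Fin (n - 1) → Model n := fun i => b (Sum.inr i) with he
  have hee : ∀ i j, mink n (e i) (e j) = if i = j then 1 else 0 := fun i j => by
    simp only [he, (hbs i).2, orthonormal_iff_ite.1 b.orthonormal, Sum.inr.injEq]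
  have hev : ∀ i, mink n (e i) v₀ = 0 := fun i => (hbs i).1
  set r : Fin (n - 1) → Fin (n - 1) → ℝ → ℝ := fun i j t => mink n (R t (e i)) (e j) with hr
  have hrc : ∀ i j, ContinuousOn (r i j) I := fun i j =>
    ((mink n).continuous.comp_continuousOn (hRc.clm_apply continuousOn_const)).clm_apply
      continuousOn_const
  have hidx : IndexNonneg r I := indexNonneg_of_noConjugate hI mink_comm hRc hRs hRv
    (fun y hy => mink_nonneg_of_orthogonal_null hv hvv hy) hconj hee hev
  have hRv' : ∀ t ∈ I, ∀ x, mink n (R t x) v₀ = 0 := fun t ht x => by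
    rw [hRs t ht, hRv t ht, map_zero]
  have htr : ∀ t ∈ I, LinearMap.trace ℝ (Model n) (R t) = ∑ i, r i i t := fun t ht => by
    rw [LinearMap.trace_eq_sum_inner _ b, Fintype.sum_sum_type, Fin.sum_univ_two]
    have h0 : inner ℝ (b (Sum.inl 0)) (R t (b (Sum.inl 0))) = 0 := by
      rw [hb0, map_smul, hRv t ht]; simp
    have h1 : inner ℝ (b (Sum.inl 1)) (R t (b (Sum.inl 1))) = 0 := by
      rw [real_inner_comm]
      nth_rw 2 [hb1]
      rw [inner_smul_right, inner_timeReflect, hRv' t ht, mul_zero]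
    simp only [ContinuousLinearMap.coe_coe, h0, h1, zero_add]
    exact Finset.sum_congr rfl fun i _ => by
      rw [hr, ← (hbs i).2, mink_comm]
  have hψ0 : ∀ t ∈ I, ψ₁ t = 0 := weight_deriv_eq_zero hI hrc hidx hψ hψ₁ hψ₂ hm hm0 rfl hK0
    (fun t ht => by rw [← htr t ht]; exact hric t ht) hτ hsurj
  obtain ⟨t₀, ht₀⟩ := hI.2.2
  have hψc : ∀ t ∈ I, ψ t = ψ t₀ := fun t ht =>
    eq_of_hasDerivAt_zero hI.1 hI.2.1 (fun s hs => by simpa [hψ0 s hs] using hψ s hs) t ht t₀ ht₀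
  have hψ20 : ∀ t ∈ I, ψ₂ t = 0 := fun t ht => by
    refine (hψ₁ t ht).unique ((hasDerivAt_const t (0 : ℝ)).congr_of_eventuallyEq ?_)
    filter_upwards [hI.1.mem_nhds ht] with s hs using hψ0 s hs
  have hzero := fun i j => curvature_entry_eq_zero hI hrc hidx hm
    (Real.exp_pos (2 * (ε - 1) / ((n : ℝ) - 1) * ψ t₀))
    (fun t ht => by
      have := hric t ht
      rwa [htr t ht, hψ20 t ht, hψ0 t ht, zero_pow two_ne_zero, mul_zero, sub_zero, add_zero]
        at this)
    (fun t ht => by rw [← hψc t ht]; exact hτ t ht) hsurj i j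
  intro t ht x hx
  have hexp := fun y => b.sum_repr' y
  simp only [Fintype.sum_sum_type, Fin.sum_univ_two] at hexp
  have h1 : ∀ y, mink n v₀ y = 0 → inner ℝ (b (Sum.inl 1)) y = 0 := fun y hy => by
    rw [real_inner_comm, hb1, inner_smul_right, inner_timeReflect, mink_comm, hy, mul_zero]
  have h2 : ∀ j, inner ℝ (b (Sum.inr j)) (R t x) = 0 := fun j => by
    rw [← (hbs j).2, ← hRs t ht, ← hexp x, h1 x hx, hb0]
    simp only [map_add, map_smul, map_sum, hRv' t ht, zero_smul, smul_zero]
    have h3 : ∀ i, mink n (R t (b (Sum.inr j))) (b (Sum.inr i)) = 0 := fun i => hzero j i t ht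
    simp [h3]
  rw [← hexp (R t x), h1 _ (by rw [mink_comm]; exact hRv' t ht x), hb0]
  simp only [h2, zero_smul, Finset.sum_const_zero, add_zero]
  exact Submodule.smul_mem _ _ (Submodule.smul_mem _ _ (Submodule.mem_span_singleton_self v₀))

end Minkowski

/-! ### Sprays in local coordinates -/

/-- A Lagrangian `ℓ(x,v)` on an open set `W` of `E × E`, homogeneous of degree two in `v` (in the form
of Euler's relation) and with non-degenerate fibre Hessian. -/
structure LagrangeChart (E : Type*) [NormedAddCommGroup E] [NormedSpace ℝ E] where
  W : Set (E × E)
  isOpen_W : IsOpen W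
  ℓ : E × E → ℝ
  smooth_ℓ : ContDiffOn ℝ ∞ ℓ W
  euler : ∀ p ∈ W, fderiv ℝ ℓ p (0, p.2) = 2 * ℓ p
  nondeg : ∀ p ∈ W, ∀ y, (∀ z, fderiv ℝ (fderiv ℝ ℓ) p (0, y) (0, z) = 0) → y = 0

namespace LagrangeChart

variable {E : Type*} [NormedAddCommGroup E] [NormedSpace ℝ E] (C : LagrangeChart E)

/-- The second derivative of the Lagrangian. -/
def ℓ₂ : E × E → E × E →L[ℝ] E × E →L[ℝ] ℝ := fderiv ℝ (fderiv ℝ C.ℓ)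

/-- The third derivative of the Lagrangian. -/
def ℓ₃ : E × E → E × E →L[ℝ] E × E →L[ℝ] E × E →L[ℝ] ℝ := fderiv ℝ C.ℓ₂

variable {C} {p : E × E} {c : ℝ → E × E} {Y : E × E} {t : ℝ}

lemma mem_nhds (hp : p ∈ C.W) : C.W ∈ 𝓝 p := C.isOpen_W.mem_nhds hp

lemma contDiffAt_ℓ (hp : p ∈ C.W) : ContDiffAt ℝ ∞ C.ℓ p := C.smooth_ℓ.contDiffAt (mem_nhds hp)

lemma contDiffAt_ℓ₁ (hp : p ∈ C.W) : ContDiffAt ℝ ∞ (fderiv ℝ C.ℓ) p :=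
  (contDiffAt_ℓ hp).fderiv_right le_rfl

lemma contDiffAt_ℓ₂ (hp : p ∈ C.W) : ContDiffAt ℝ ∞ C.ℓ₂ p := (contDiffAt_ℓ₁ hp).fderiv_right le_rfl

lemma ne_zero_infty : (∞ : WithTop ℕ∞) ≠ 0 := by simp

lemma minSmoothness_two_le : minSmoothness ℝ 2 ≤ (∞ : WithTop ℕ∞) := by
  rw [minSmoothness_of_isRCLikeNormedField]
  exact WithTop.coe_le_coe.2 (le_top : (2 : ℕ∞) ≤ ⊤)

lemma hasDerivAt_ℓ (hp : c t ∈ C.W) (hc : HasDerivAt c Y t) :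
    HasDerivAt (fun s => C.ℓ (c s)) (fderiv ℝ C.ℓ (c t) Y) t :=
  ((contDiffAt_ℓ hp).differentiableAt ne_zero_infty).hasFDerivAt.comp_hasDerivAt t hc

lemma hasDerivAt_ℓ₁ (hp : c t ∈ C.W) (hc : HasDerivAt c Y t) :
    HasDerivAt (fun s => fderiv ℝ C.ℓ (c s)) (C.ℓ₂ (c t) Y) t :=
  ((contDiffAt_ℓ₁ hp).differentiableAt ne_zero_infty).hasFDerivAt.comp_hasDerivAt t hc

lemma hasDerivAt_ℓ₂ (hp : c t ∈ C.W) (hc : HasDerivAt c Y t) :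
    HasDerivAt (fun s => C.ℓ₂ (c s)) (C.ℓ₃ (c t) Y) t :=
  ((contDiffAt_ℓ₂ hp).differentiableAt ne_zero_infty).hasFDerivAt.comp_hasDerivAt t hc

lemma hasDerivAt_line (p Y : E × E) : HasDerivAt (fun s : ℝ => p + s • Y) Y 0 := by
  simpa using ((hasDerivAt_id (0 : ℝ)).smul_const Y).const_add p

lemma contDiffAt_ℓ₃_apply (hp : p ∈ C.W) (X Y Z : E × E) :
    ContDiffAt ℝ ∞ (fun q => C.ℓ₃ q X Y Z) p := by
  have h : ContDiffAt ℝ ∞ (fun q => C.ℓ₂ q Y Z) p :=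
    ((contDiffAt_ℓ₂ hp).clm_apply contDiffAt_const).clm_apply contDiffAt_const
  have h1 : ContDiffAt ℝ ∞ (fderiv ℝ fun q => C.ℓ₂ q Y Z) p := h.fderiv_right le_rfl
  refine (h1.clm_apply contDiffAt_const).congr_of_eventuallyEq (f := fun q =>
    fderiv ℝ (fun q => C.ℓ₂ q Y Z) q X) ?_
  filter_upwards [mem_nhds hp] with q hq
  have hq' : q + (0 : ℝ) • X ∈ C.W := by simpa using hq
  have h2 := ((hasDerivAt_ℓ₂ hq' (hasDerivAt_line q X)).clm_apply
    (hasDerivAt_const _ Y)).clm_apply (hasDerivAt_const _ Z)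
  have h3 : HasDerivAt (fun s : ℝ => C.ℓ₂ (q + s • X) Y Z) _ 0 :=
    HasFDerivAt.comp_hasDerivAt (f := fun s : ℝ => q + s • X) (l := fun q => C.ℓ₂ q Y Z) 0
      (((((contDiffAt_ℓ₂ hq').clm_apply contDiffAt_const).clm_apply
        contDiffAt_const).differentiableAt ne_zero_infty).hasFDerivAt) (hasDerivAt_line q X)
  simpa using h2.unique h3

/-- Two curves that agree near `t` have the same derivative at `t`. -/
lemma deriv_unique_of_eventuallyEq {V : Type*} [NormedAddCommGroup V] [NormedSpace ℝ V]
    {f h : ℝ → V} {f' h' : V} {t : ℝ} (hf : HasDerivAt f f' t) (hh : HasDerivAt h h' t)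
    (hfh : f =ᶠ[𝓝 t] h) : f' = h' :=
  hf.unique (hh.congr_of_eventuallyEq hfh)

/-- Directional derivatives of an identity that holds on `W`. -/
lemma deriv_eq_of_forall_mem {V : Type*} [NormedAddCommGroup V] [NormedSpace ℝ V]
    {f h : E × E → V} (hfh : ∀ q ∈ C.W, f q = h q) (hp : p ∈ C.W) {Y : E × E} {f' h' : V}
    (hf : HasDerivAt (fun s : ℝ => f (p + s • Y)) f' 0)
    (hh : HasDerivAt (fun s : ℝ => h (p + s • Y)) h' 0) : f' = h' := by
  refine deriv_unique_of_eventuallyEq hf hh ?_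
  have h0 : C.W ∈ 𝓝 (p + (0 : ℝ) • Y) := by simpa using mem_nhds hp
  filter_upwards [(hasDerivAt_line p Y).continuousAt.preimage_mem_nhds h0] with s hs
  exact hfh _ hs

lemma ℓ₂_symm (hp : p ∈ C.W) (Y Z : E × E) : C.ℓ₂ p Y Z = C.ℓ₂ p Z Y :=
  ((contDiffAt_ℓ hp).isSymmSndFDerivAt minSmoothness_two_le) Y Z

lemma ℓ₃_symm_left (hp : p ∈ C.W) (X Y : E × E) : C.ℓ₃ p X Y = C.ℓ₃ p Y X :=
  ((contDiffAt_ℓ₁ hp).isSymmSndFDerivAt minSmoothness_two_le) X Y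

lemma ℓ₃_symm_right (hp : p ∈ C.W) (X Y Z : E × E) : C.ℓ₃ p X Y Z = C.ℓ₃ p X Z Y := by
  have hp' : p + (0 : ℝ) • X ∈ C.W := by simpa using hp
  have h := fun Y Z => ((hasDerivAt_ℓ₂ hp' (hasDerivAt_line p X)).clm_apply
    (hasDerivAt_const _ Y)).clm_apply (hasDerivAt_const _ Z)
  simpa using deriv_eq_of_forall_mem (C := C) (f := fun q => C.ℓ₂ q Y Z)
    (h := fun q => C.ℓ₂ q Z Y) (fun q hq => ℓ₂_symm hq Y Z) hp (h Y Z) (h Z Y)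

lemma ℓ₂_split (p : E × E) (y y' : E) (Z : E × E) :
    C.ℓ₂ p (y, y') Z = C.ℓ₂ p (y, 0) Z + C.ℓ₂ p (0, y') Z := by
  rw [← add_apply, ← map_add]; simp

lemma euler_deriv (hp : p ∈ C.W) (Y : E × E) :
    C.ℓ₂ p Y (0, p.2) + fderiv ℝ C.ℓ p (0, Y.2) = 2 * fderiv ℝ C.ℓ p Y := by
  have hp' : p + (0 : ℝ) • Y ∈ C.W := by simpa using hp
  have hl := hasDerivAt_line p Y
  have h1 := (hasDerivAt_ℓ₁ hp' hl).clm_apply ((hasDerivAt_const _ (0 : E)).prodMk hl.snd)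
  have h2 := (hasDerivAt_ℓ hp' hl).const_mul 2
  simpa using deriv_eq_of_forall_mem (C := C) (f := fun q => fderiv ℝ C.ℓ q (0, q.2))
    (h := fun q => 2 * C.ℓ q) (fun q hq => C.euler q hq) hp h1 h2

/-- `g_v(z, v) = ∂ℓ/∂v (z)`. -/
lemma g_v (hp : p ∈ C.W) (z : E) : C.ℓ₂ p (0, z) (0, p.2) = fderiv ℝ C.ℓ p (0, z) := by
  have := euler_deriv hp (0, z)
  simp only at this
  linarith

lemma ℓ₂_x_v (hp : p ∈ C.W) (z : E) : C.ℓ₂ p (z, 0) (0, p.2) = 2 * fderiv ℝ C.ℓ p (z, 0) := by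
  have := euler_deriv hp (z, 0)
  have h0 : ((0 : E), (0 : E)) = 0 := rfl
  simpa [h0] using this

lemma g_v_deriv (hp : p ∈ C.W) (Y : E × E) (z : E) :
    C.ℓ₃ p Y (0, z) (0, p.2) + C.ℓ₂ p (0, z) (0, Y.2) = C.ℓ₂ p Y (0, z) := by
  have hp' : p + (0 : ℝ) • Y ∈ C.W := by simpa using hp
  have hl := hasDerivAt_line p Y
  have h1 := ((hasDerivAt_ℓ₂ hp' hl).clm_apply (hasDerivAt_const _ ((0 : E), z))).clm_apply
    ((hasDerivAt_const _ (0 : E)).prodMk hl.snd)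
  have h2 := (hasDerivAt_ℓ₁ hp' hl).clm_apply (hasDerivAt_const _ ((0 : E), z))
  simpa using deriv_eq_of_forall_mem (C := C) (f := fun q => C.ℓ₂ q (0, z) (0, q.2))
    (h := fun q => fderiv ℝ C.ℓ q (0, z)) (fun q hq => g_v hq z) hp h1 h2

/-- The Cartan tensor is annihilated by `v`. -/
lemma cartan_v (hp : p ∈ C.W) (y z : E) : C.ℓ₃ p (0, y) (0, z) (0, p.2) = 0 := by
  have := g_v_deriv hp (0, y) z
  rw [ℓ₂_symm hp (0, z)] at this
  simpa using this

lemma ℓ₂_zero_smul (p Z : E × E) (a : ℝ) (y : E) : C.ℓ₂ p (0, a • y) Z = a * C.ℓ₂ p (0, y) Z := by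
  have : ((0 : E), a • y) = a • ((0 : E), y) := by simp
  rw [this, map_smul, smul_apply, smul_eq_mul]

end LagrangeChart

/-- A Lagrangian in coordinates together with its spray coefficients `G`. They are characterized by
the Euler–Lagrange equation `el`: the derivative of `∂ℓ/∂v` along `(v, -2G)` is `∂ℓ/∂x`. -/
structure SprayChart (E : Type*) [NormedAddCommGroup E] [NormedSpace ℝ E] extends
    LagrangeChart E where
  G : E × E → E
  smooth_G : ContDiffOn ℝ ∞ G W
  el : ∀ p ∈ W, ∀ z, fderiv ℝ (fderiv ℝ ℓ) p (p.2, -(2 : ℝ) • G p) (0, z) = fderiv ℝ ℓ p (z, 0)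

namespace SprayChart

open LagrangeChart

variable {E : Type*} [NormedAddCommGroup E] [NormedSpace ℝ E] (C : SprayChart E)

/-- The spray `v ∂/∂x - 2G ∂/∂v`. -/
def F (p : E × E) : E × E := (p.2, -(2 : ℝ) • C.G p)

/-- The linearization of the spray. -/
def DF (p Y : E × E) : E × E := (Y.2, -(2 : ℝ) • fderiv ℝ C.G p Y)

/-- The nonlinear connection `∂G/∂v`. -/
def N (p : E × E) : E →L[ℝ] E := (fderiv ℝ C.G p).comp (ContinuousLinearMap.inr ℝ E E)

/-- The curvature `2 ∂G/∂x - F(N) - N N`. -/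
def R (p : E × E) : E →L[ℝ] E :=
  (2 : ℝ) • (fderiv ℝ C.G p).comp (ContinuousLinearMap.inl ℝ E E) -
    (fderiv ℝ (fderiv ℝ C.G) p (C.F p)).comp (ContinuousLinearMap.inr ℝ E E) -
    (C.N p).comp (C.N p)

lemma N_apply (p : E × E) (y : E) : C.N p y = fderiv ℝ C.G p (0, y) := rfl

lemma R_apply (p : E × E) (y : E) : C.R p y = (2 : ℝ) • fderiv ℝ C.G p (y, 0) -
    fderiv ℝ (fderiv ℝ C.G) p (C.F p) (0, y) - C.N p (C.N p y) := rfl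

variable {C} {p : E × E} {c : ℝ → E × E} {Y : E × E} {t : ℝ}

lemma contDiffAt_G (hp : p ∈ C.W) : ContDiffAt ℝ ∞ C.G p := C.smooth_G.contDiffAt (mem_nhds hp)

lemma contDiffAt_G₁ (hp : p ∈ C.W) : ContDiffAt ℝ ∞ (fderiv ℝ C.G) p :=
  (contDiffAt_G hp).fderiv_right le_rfl

lemma contDiffAt_N (hp : p ∈ C.W) : ContDiffAt ℝ ∞ C.N p :=
  (contDiffAt_G₁ hp).clm_comp contDiffAt_const

lemma contDiffAt_F (hp : p ∈ C.W) : ContDiffAt ℝ ∞ C.F p :=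
  contDiffAt_snd.prodMk (contDiffAt_const.smul (contDiffAt_G hp))

lemma contDiffAt_R (hp : p ∈ C.W) : ContDiffAt ℝ ∞ C.R p := by
  have h1 : ContDiffAt ℝ ∞ (fderiv ℝ (fderiv ℝ C.G)) p := (contDiffAt_G₁ hp).fderiv_right le_rfl
  have h2 : ContDiffAt ℝ ∞ (fun q => fderiv ℝ (fderiv ℝ C.G) q (C.F q)) p :=
    h1.clm_apply (contDiffAt_F hp)
  have h3 : ContDiffAt ℝ ∞ (fun q => (fderiv ℝ (fderiv ℝ C.G) q (C.F q)).comp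
    (ContinuousLinearMap.inr ℝ E E)) p := h2.clm_comp contDiffAt_const
  have h4 : ContDiffAt ℝ ∞ (fun q => (fderiv ℝ C.G q).comp (ContinuousLinearMap.inl ℝ E E)) p :=
    (contDiffAt_G₁ hp).clm_comp contDiffAt_const
  have h5 : ContDiffAt ℝ ∞ (fun q => (C.N q).comp (C.N q)) p :=
    (contDiffAt_N hp).clm_comp (contDiffAt_N hp)
  exact ((h4.const_smul (2 : ℝ)).sub h3).sub h5

lemma hasDerivAt_G (hp : c t ∈ C.W) (hc : HasDerivAt c Y t) :
    HasDerivAt (fun s => C.G (c s)) (fderiv ℝ C.G (c t) Y) t :=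
  ((contDiffAt_G hp).differentiableAt ne_zero_infty).hasFDerivAt.comp_hasDerivAt t hc

lemma hasDerivAt_G₁ (hp : c t ∈ C.W) (hc : HasDerivAt c Y t) :
    HasDerivAt (fun s => fderiv ℝ C.G (c s))
    (fderiv ℝ (fderiv ℝ C.G) (c t) Y) t :=
  ((contDiffAt_G₁ hp).differentiableAt ne_zero_infty).hasFDerivAt.comp_hasDerivAt t hc

lemma hasDerivAt_F (hp : c t ∈ C.W) (hc : HasDerivAt c Y t) :
    HasDerivAt (fun s => C.F (c s)) (C.DF (c t) Y) t :=
  (hc.snd).prodMk ((hasDerivAt_G hp hc).const_smul (-(2 : ℝ)))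

lemma ℓ₂_F (hp : p ∈ C.W) (z : E) : C.ℓ₂ p (C.F p) (0, z) = fderiv ℝ C.ℓ p (z, 0) := C.el p hp z

/-- The Euler–Lagrange equation, differentiated in an arbitrary direction. -/
lemma el_deriv (hp : p ∈ C.W) (Y : E × E) (z : E) :
    C.ℓ₃ p Y (C.F p) (0, z) + C.ℓ₂ p (C.DF p Y) (0, z) = C.ℓ₂ p Y (z, 0) := by
  have hp' : p + (0 : ℝ) • Y ∈ C.W := by simpa using hp
  have h1 := ((hasDerivAt_ℓ₂ hp' (hasDerivAt_line p Y)).clm_apply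
    (hasDerivAt_F hp' (hasDerivAt_line p Y))).clm_apply (hasDerivAt_const _ ((0 : E), z))
  have h2 := (hasDerivAt_ℓ₁ hp' (hasDerivAt_line p Y)).clm_apply
    (hasDerivAt_const _ ((z : E), (0 : E)))
  simpa using deriv_eq_of_forall_mem (C := C.toLagrangeChart) (f := fun q => C.ℓ₂ q (C.F q) (0, z))
    (h := fun q => fderiv ℝ C.ℓ q (z, 0)) (fun q hq => ℓ₂_F hq z) hp h1 h2

/-- The lowered nonlinear connection. -/
lemma two_g_N (hp : p ∈ C.W) (y z : E) :
    2 * C.ℓ₂ p (0, C.N p y) (0, z) = C.ℓ₃ p (C.F p) (0, y) (0, z) + C.ℓ₂ p (y, 0) (0, z) -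
      C.ℓ₂ p (z, 0) (0, y) := by
  have h1 := el_deriv hp (0, y) z
  have h2 : C.DF p (0, y) = (y, -(2 : ℝ) • C.N p y) := rfl
  have h3 : C.ℓ₂ p (0, -(2 : ℝ) • C.N p y) (0, z) = -2 * C.ℓ₂ p (0, C.N p y) (0, z) := by
    have : ((0 : E), -(2 : ℝ) • C.N p y) = -(2 : ℝ) • ((0 : E), C.N p y) := by simp
    rw [this, map_smul, smul_apply, smul_eq_mul]
  rw [h2, ℓ₂_split, h3, ℓ₃_symm_left hp, ℓ₂_symm hp (0, y)] at h1
  linarith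

/-- Compatibility of the nonlinear connection with the fibre metric along the spray. -/
lemma g_N_add (hp : p ∈ C.W) (y z : E) :
    C.ℓ₂ p (0, C.N p y) (0, z) + C.ℓ₂ p (0, y) (0, C.N p z) = C.ℓ₃ p (C.F p) (0, y) (0, z) := by
  have h1 := two_g_N hp y z
  have h2 := two_g_N hp z y
  rw [ℓ₃_symm_right hp, ℓ₂_symm hp (0, C.N p z)] at h2
  linarith

lemma g_N_sub (hp : p ∈ C.W) (y z : E) :
    C.ℓ₂ p (0, C.N p y) (0, z) - C.ℓ₂ p (0, y) (0, C.N p z) =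
      C.ℓ₂ p (y, 0) (0, z) - C.ℓ₂ p (z, 0) (0, y) := by
  have h1 := two_g_N hp y z
  have h2 := two_g_N hp z y
  rw [ℓ₃_symm_right hp, ℓ₂_symm hp (0, C.N p z)] at h2
  linarith

/-- Euler's relation `N v = 2G` for the spray coefficients. -/
lemma N_v (hp : p ∈ C.W) : C.N p p.2 = (2 : ℝ) • C.G p := by
  rw [← sub_eq_zero]
  refine C.nondeg p hp _ fun z => ?_
  change C.ℓ₂ p (0, C.N p p.2 - (2 : ℝ) • C.G p) (0, z) = 0
  have e : ((0 : E), C.N p p.2 - (2 : ℝ) • C.G p) = (0, C.N p p.2) - (0, (2 : ℝ) • C.G p) := by simp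
  rw [e, map_sub, sub_apply, ℓ₂_zero_smul]
  have h1 := two_g_N hp p.2 z
  have h2 := g_v_deriv hp (C.F p) z
  have h3 := ℓ₂_F hp z
  have h4 : C.ℓ₂ p (C.F p) (0, z) = C.ℓ₂ p (p.2, 0) (0, z) + -2 * C.ℓ₂ p (0, C.G p) (0, z) := by
    rw [F, ℓ₂_split, ℓ₂_zero_smul]
  have h5 : C.ℓ₂ p (0, z) (0, (C.F p).2) = -2 * C.ℓ₂ p (0, C.G p) (0, z) := by
    rw [ℓ₂_symm hp, F, ℓ₂_zero_smul]
  rw [ℓ₂_x_v hp, ℓ₃_symm_right hp] at h1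
  linarith

lemma R_v (hp : p ∈ C.W) : C.R p p.2 = 0 := by
  have hp' : p + (0 : ℝ) • C.F p ∈ C.W := by simpa using hp
  have hl := hasDerivAt_line p (C.F p)
  have h1 := (hasDerivAt_G₁ hp' hl).clm_apply ((hasDerivAt_const _ (0 : E)).prodMk hl.snd)
  have h2 := (hasDerivAt_G hp' hl).const_smul (2 : ℝ)
  have h := deriv_eq_of_forall_mem (C := C.toLagrangeChart) (f := fun q => fderiv ℝ C.G q (0, q.2))
    (h := fun q => (2 : ℝ) • C.G q) (fun q hq => N_v hq) hp h1 h2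
  simp only [zero_smul, add_zero] at h
  have e1 : (0, (C.F p).2) = -(2 : ℝ) • ((0 : E), C.G p) := by simp [F]
  have e2 : C.F p = (p.2, 0) - (2 : ℝ) • ((0 : E), C.G p) := by simp [F]
  rw [R_apply, N_v hp, map_smul, N_apply]
  have h3 : fderiv ℝ (fderiv ℝ C.G) p (C.F p) (0, p.2) =
      (2 : ℝ) • fderiv ℝ C.G p (p.2, 0) - (2 : ℝ) • fderiv ℝ C.G p (0, C.G p) := by
    rw [e1, map_smul] at h
    have h4 : fderiv ℝ C.G p (C.F p) =
        fderiv ℝ C.G p (p.2, 0) - (2 : ℝ) • fderiv ℝ C.G p (0, C.G p) := by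
      rw [e2, map_sub, map_smul]
    rw [h4] at h
    have := eq_sub_of_add_eq h
    rw [this]
    module
  rw [h3]
  module

end SprayChart

namespace SprayChart

open LagrangeChart

variable {E : Type*} [NormedAddCommGroup E] [NormedSpace ℝ E] {C C' : SprayChart E}
  {p : E × E} {γ : ℝ → E × E} {t : ℝ}

/-! ### Parallel fields along a geodesic, in one chart -/

/-- The scalar product of two parallel fields along an integral curve of the spray is constant. -/
lemma hasDerivAt_g_parallel (hp : γ t ∈ C.W) (hγ : HasDerivAt γ (C.F (γ t)) t) {y z : ℝ → E}
    (hy : HasDerivAt y (-C.N (γ t) (y t)) t) (hz : HasDerivAt z (-C.N (γ t) (z t)) t) :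
    HasDerivAt (fun s => C.ℓ₂ (γ s) (0, y s) (0, z s)) 0 t := by
  have h := ((hasDerivAt_ℓ₂ hp hγ).clm_apply ((hasDerivAt_const t (0 : E)).prodMk hy)).clm_apply
    ((hasDerivAt_const t (0 : E)).prodMk hz)
  refine h.congr_deriv ?_
  have h1 := g_N_add hp (y t) (z t)
  have e : ∀ x : E, ((0 : E), -x) = -((0 : E), x) := fun x => by simp
  simp only [add_apply, e, map_neg, neg_apply]
  linarith

/-- The velocity of a geodesic is parallel. -/
lemma hasDerivAt_velocity (hp : γ t ∈ C.W) (hγ : HasDerivAt γ (C.F (γ t)) t) :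
    HasDerivAt (fun s => (γ s).2) (-C.N (γ t) (γ t).2) t := by
  have h := hγ.snd
  rw [N_v hp, ← neg_smul]
  exact h

/-- A parallel field `y` gives a curve `(y, y') = (y, -N y)` that solves the linearized spray
equation with the forcing term `R y`. -/
lemma hasDerivAt_parallel_lift (hp : γ t ∈ C.W) (hγ : HasDerivAt γ (C.F (γ t)) t) {y : ℝ → E}
    (hy : HasDerivAt y (-C.N (γ t) (y t)) t) :
    HasDerivAt (fun s => (y s, -C.N (γ s) (y s)))
      (C.DF (γ t) (y t, -C.N (γ t) (y t)) + (0, C.R (γ t) (y t))) t := by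
  have h1 := ((hasDerivAt_G₁ hp hγ).clm_apply ((hasDerivAt_const t (0 : E)).prodMk hy)).neg
  refine (hy.prodMk h1).congr_deriv ?_
  ext1
  · simp [DF]
  · have e : fderiv ℝ C.G (γ t) (y t, -C.N (γ t) (y t)) =
        fderiv ℝ C.G (γ t) (y t, 0) - fderiv ℝ C.G (γ t) (0, C.N (γ t) (y t)) := by
      rw [← map_sub]; simp
    have e' : fderiv ℝ C.G (γ t) (0, -C.N (γ t) (y t)) =
        -fderiv ℝ C.G (γ t) (0, C.N (γ t) (y t)) := by
      have e0 : ((0 : E), -C.N (γ t) (y t)) = -((0 : E), C.N (γ t) (y t)) := by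
        rw [Prod.neg_mk, neg_zero]
      rw [e0, map_neg]
    simp only [DF, R_apply, Prod.snd_add, e, e']
    rw [N_apply C (γ t) (C.N (γ t) (y t))]
    module

/-- The curvature is symmetric with respect to the fibre metric: the symplectic product of the lifts
of two parallel fields vanishes identically, and its derivative is `g(Ry,z) - g(y,Rz)`. -/
lemma R_symm (hp : ∀ᶠ s in 𝓝 t, γ s ∈ C.W) (hγ : ∀ᶠ s in 𝓝 t, HasDerivAt γ (C.F (γ s)) s)
    {y z : ℝ → E} (hy : ∀ᶠ s in 𝓝 t, HasDerivAt y (-C.N (γ s) (y s)) s)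
    (hz : ∀ᶠ s in 𝓝 t, HasDerivAt z (-C.N (γ s) (z s)) s) :
    C.ℓ₂ (γ t) (0, C.R (γ t) (y t)) (0, z t) = C.ℓ₂ (γ t) (0, y t) (0, C.R (γ t) (z t)) := by
  have hpt := hp.self_of_nhds
  have key : ∀ {y z : ℝ → E}, HasDerivAt y (-C.N (γ t) (y t)) t →
      HasDerivAt z (-C.N (γ t) (z t)) t →
      HasDerivAt (fun s => C.ℓ₂ (γ s) (y s, -C.N (γ s) (y s)) (0, z s))
        (C.ℓ₂ (γ t) (y t, -C.N (γ t) (y t)) (z t, -C.N (γ t) (z t)) +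
          C.ℓ₂ (γ t) (0, C.R (γ t) (y t)) (0, z t)) t := by
    intro y z hy hz
    have h := ((hasDerivAt_ℓ₂ hpt hγ.self_of_nhds).clm_apply
      (hasDerivAt_parallel_lift hpt hγ.self_of_nhds hy)).clm_apply
        ((hasDerivAt_const t (0 : E)).prodMk hz)
    refine h.congr_deriv ?_
    have h1 := el_deriv hpt (y t, -C.N (γ t) (y t)) (z t)
    have e : (z t, -C.N (γ t) (z t)) = (z t, 0) + ((0 : E), -C.N (γ t) (z t)) := by simp
    simp only [add_apply, map_add, ℓ₃_symm_left hpt (C.F (γ t))]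
    rw [e, map_add]
    linarith
  have h0 : ∀ᶠ s in 𝓝 t, C.ℓ₂ (γ s) (y s, -C.N (γ s) (y s)) (0, z s) -
      C.ℓ₂ (γ s) (z s, -C.N (γ s) (z s)) (0, y s) = 0 := by
    filter_upwards [hp] with s hs
    have h1 := g_N_sub hs (y s) (z s)
    have e : ∀ x : E, ((0 : E), -x) = -((0 : E), x) := fun x => by simp
    rw [ℓ₂_split, ℓ₂_split (C := C.toLagrangeChart) (γ s) (z s), e, e, map_neg, map_neg, neg_apply, neg_apply,
      ℓ₂_symm hs (0, C.N (γ s) (z s))]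
    linarith
  have h1 := deriv_unique_of_eventuallyEq ((key hy.self_of_nhds hz.self_of_nhds).sub
    (key hz.self_of_nhds hy.self_of_nhds)) (hasDerivAt_const t (0 : ℝ)) h0
  have h2 := ℓ₂_symm hpt (y t, -C.N (γ t) (y t)) (z t, -C.N (γ t) (z t))
  rw [ℓ₂_symm hpt (0, y t)]
  linarith

/-! ### Change of coordinates -/

/-- The map of `E × E` induced by a change of coordinates `φ`. -/
def tangentLift (φ : E → E) (q : E × E) : E × E := (φ q.1, fderiv ℝ φ q.1 q.2)

/-- The derivative of `tangentLift φ`. -/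
def tangentLift₁ (φ : E → E) (q Y : E × E) : E × E :=
  (fderiv ℝ φ q.1 Y.1, fderiv ℝ (fderiv ℝ φ) q.1 Y.1 q.2 + fderiv ℝ φ q.1 Y.2)

section Phi

variable {φ : E → E} {c : ℝ → E × E} {Y : E × E}

lemma hasDerivAt_phi₁ (hφ : ContDiffAt ℝ ∞ φ (c t).1) (hc : HasDerivAt c Y t) :
    HasDerivAt (fun s => fderiv ℝ φ (c s).1) (fderiv ℝ (fderiv ℝ φ) (c t).1 Y.1) t := by
  have h1 : ContDiffAt ℝ ∞ (fderiv ℝ φ) (c t).1 := hφ.fderiv_right le_rfl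
  exact (h1.differentiableAt ne_zero_infty).hasFDerivAt.comp_hasDerivAt t hc.fst

lemma hasDerivAt_phi₂ (hφ : ContDiffAt ℝ ∞ φ (c t).1) (hc : HasDerivAt c Y t) :
    HasDerivAt (fun s => fderiv ℝ (fderiv ℝ φ) (c s).1)
      (fderiv ℝ (fderiv ℝ (fderiv ℝ φ)) (c t).1 Y.1) t := by
  have h1 : ContDiffAt ℝ ∞ (fderiv ℝ φ) (c t).1 := hφ.fderiv_right le_rfl
  have h2 : ContDiffAt ℝ ∞ (fderiv ℝ (fderiv ℝ φ)) (c t).1 := h1.fderiv_right le_rfl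
  exact (h2.differentiableAt ne_zero_infty).hasFDerivAt.comp_hasDerivAt t hc.fst

lemma hasDerivAt_tangentLift (hφ : ContDiffAt ℝ ∞ φ (c t).1) (hc : HasDerivAt c Y t) :
    HasDerivAt (fun s => tangentLift φ (c s)) (tangentLift₁ φ (c t) Y) t :=
  ((hφ.differentiableAt ne_zero_infty).hasFDerivAt.comp_hasDerivAt t hc.fst).prodMk
    ((hasDerivAt_phi₁ hφ hc).clm_apply hc.snd)

lemma phi₂_symm {x : E} (hφ : ContDiffAt ℝ ∞ φ x) (y z : E) :
    fderiv ℝ (fderiv ℝ φ) x y z = fderiv ℝ (fderiv ℝ φ) x z y :=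
  (hφ.isSymmSndFDerivAt minSmoothness_two_le) y z

lemma phi₃_symm {x : E} (hφ : ContDiffAt ℝ ∞ φ x) (y z w : E) :
    fderiv ℝ (fderiv ℝ (fderiv ℝ φ)) x y z w = fderiv ℝ (fderiv ℝ (fderiv ℝ φ)) x z y w := by
  have h1 : ContDiffAt ℝ ∞ (fderiv ℝ φ) x := hφ.fderiv_right le_rfl
  rw [(h1.isSymmSndFDerivAt minSmoothness_two_le) y z]

end Phi

/-- `φ` is a change of coordinates from the chart `C` to the chart `C'` at `q`. -/
structure IsTransition (C C' : SprayChart E) (φ : E → E) (q : E × E) : Prop where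
  mem : q ∈ C.W
  mem' : tangentLift φ q ∈ C'.W
  smooth : ContDiffAt ℝ ∞ φ q.1
  surj : Function.Surjective (fderiv ℝ φ q.1)
  lagrangian : C.ℓ =ᶠ[𝓝 q] fun q' => C'.ℓ (tangentLift φ q')

variable {φ : E → E} {q : E × E}

/-- An identity that holds at all transition points near `q` can be differentiated at `q`. -/
lemma IsTransition.deriv_eq {V : Type*} [NormedAddCommGroup V] [NormedSpace ℝ V]
    (h : ∀ᶠ q' in 𝓝 q, IsTransition C C' φ q') {f k : E × E → V}
    (hfk : ∀ q', IsTransition C C' φ q' → f q' = k q') {Y : E × E} {f' k' : V}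
    (hf : HasDerivAt (fun s : ℝ => f (q + s • Y)) f' 0)
    (hk : HasDerivAt (fun s : ℝ => k (q + s • Y)) k' 0) : f' = k' := by
  refine deriv_unique_of_eventuallyEq hf hk ?_
  have h0 : ∀ᶠ q' in 𝓝 (q + (0 : ℝ) • Y), IsTransition C C' φ q' := by simpa using h
  filter_upwards [(hasDerivAt_line q Y).continuousAt.eventually h0] with s hs
  exact hfk _ hs

lemma IsTransition.ℓ_deriv (h : IsTransition C C' φ q) (Y : E × E) :
    fderiv ℝ C.ℓ q Y = fderiv ℝ C'.ℓ (tangentLift φ q) (tangentLift₁ φ q Y) := by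
  have hl := hasDerivAt_line q Y
  have hq0 : q + (0 : ℝ) • Y = q := by simp
  have h1 := hasDerivAt_ℓ (C := C.toLagrangeChart) (by rw [hq0]; exact h.mem) hl
  have h2 := hasDerivAt_ℓ (C := C'.toLagrangeChart) (c := fun s : ℝ => tangentLift φ (q + s • Y)) (t := 0)
    (by simpa using h.mem') (hasDerivAt_tangentLift (by simpa using h.smooth) hl)
  have := deriv_unique_of_eventuallyEq h1 h2 (by
    have hE : ∀ᶠ q' in 𝓝 (q + (0 : ℝ) • Y), C.ℓ q' = C'.ℓ (tangentLift φ q') := by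
      rw [hq0]; exact h.lagrangian
    exact hl.continuousAt.eventually hE)
  simpa using this

lemma tangentLift₁_zero_left (φ : E → E) (q : E × E) (z : E) :
    tangentLift₁ φ q (0, z) = (0, fderiv ℝ φ q.1 z) := by
  simp [tangentLift₁]

lemma IsTransition.ℓ₂_deriv (h : ∀ᶠ q' in 𝓝 q, IsTransition C C' φ q') (Y : E × E) (z : E) :
    C.ℓ₂ q Y (0, z) = C'.ℓ₂ (tangentLift φ q) (tangentLift₁ φ q Y) (0, fderiv ℝ φ q.1 z) +
      fderiv ℝ C'.ℓ (tangentLift φ q) (0, fderiv ℝ (fderiv ℝ φ) q.1 Y.1 z) := by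
  have hl := hasDerivAt_line q Y
  have hq0 : q + (0 : ℝ) • Y = q := by simp
  have hq := h.self_of_nhds
  have h1 := (hasDerivAt_ℓ₁ (C := C.toLagrangeChart) (by rw [hq0]; exact hq.mem) hl).clm_apply
    (hasDerivAt_const _ ((0 : E), z))
  have h2 := (hasDerivAt_ℓ₁ (C := C'.toLagrangeChart) (c := fun s : ℝ => tangentLift φ (q + s • Y)) (t := 0)
    (by simpa using hq.mem') (hasDerivAt_tangentLift (by simpa using hq.smooth) hl)).clm_apply
    ((hasDerivAt_const _ (0 : E)).prodMk
      ((hasDerivAt_phi₁ (by simpa using hq.smooth) hl).clm_apply (hasDerivAt_const _ z)))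
  have := IsTransition.deriv_eq h (f := fun q => fderiv ℝ C.ℓ q (0, z))
    (k := fun q => fderiv ℝ C'.ℓ (tangentLift φ q) (0, fderiv ℝ φ q.1 z))
    (fun q' hq' => by rw [hq'.ℓ_deriv, tangentLift₁_zero_left]) h1 h2
  simpa using this

/-- The sprays correspond to each other: both satisfy the Euler–Lagrange equation, which has only
one solution because the fibre Hessian is non-degenerate. -/
lemma IsTransition.spray (h : ∀ᶠ q' in 𝓝 q, IsTransition C C' φ q') :
    tangentLift₁ φ q (C.F q) = C'.F (tangentLift φ q) := by
  have hq := h.self_of_nhds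
  have key : ∀ z, C'.ℓ₂ (tangentLift φ q) (tangentLift₁ φ q (C.F q)) (0, fderiv ℝ φ q.1 z) =
      C'.ℓ₂ (tangentLift φ q) (C'.F (tangentLift φ q)) (0, fderiv ℝ φ q.1 z) := by
    intro z
    have h1 := IsTransition.ℓ₂_deriv h (C.F q) z
    rw [ℓ₂_F hq.mem, hq.ℓ_deriv] at h1
    rw [ℓ₂_F hq.mem']
    have h2 : tangentLift₁ φ q (z, 0) = (fderiv ℝ φ q.1 z, 0) +
        (0, fderiv ℝ (fderiv ℝ φ) q.1 (C.F q).1 z) := by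
      simp [tangentLift₁, F, phi₂_symm hq.smooth z]
    rw [h2, map_add] at h1
    linarith
  have e : tangentLift₁ φ q (C.F q) = C'.F (tangentLift φ q) +
      (0, (tangentLift₁ φ q (C.F q)).2 - (C'.F (tangentLift φ q)).2) := by
    ext1 <;> simp [tangentLift₁, F, tangentLift]
  have h0 : (tangentLift₁ φ q (C.F q)).2 - (C'.F (tangentLift φ q)).2 = 0 := by
    refine C'.nondeg _ hq.mem' _ fun w => ?_
    obtain ⟨z, rfl⟩ := hq.surj w
    have := key z
    rw [e, map_add, add_apply] at this
    simpa [LagrangeChart.ℓ₂] using this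
  rw [e, h0]
  ext1 <;> simp

/-- Transformation law of the nonlinear connection. -/
lemma IsTransition.N_eq (h : ∀ᶠ q' in 𝓝 q, IsTransition C C' φ q') (y : E) :
    C'.N (tangentLift φ q) (fderiv ℝ φ q.1 y) =
      fderiv ℝ φ q.1 (C.N q y) - fderiv ℝ (fderiv ℝ φ) q.1 y q.2 := by
  have hq := h.self_of_nhds
  have hl := hasDerivAt_line q (0, y)
  have hq0 : q + (0 : ℝ) • ((0 : E), y) = q := by simp
  have hs : ContDiffAt ℝ ∞ φ (q + (0 : ℝ) • ((0 : E), y)).1 := by simpa using hq.smooth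
  have hF := hasDerivAt_F (C := C) (by rw [hq0]; exact hq.mem) hl
  have h1 := (((hasDerivAt_phi₂ hs hl).clm_apply hF.fst).clm_apply hl.snd).add
    ((hasDerivAt_phi₁ hs hl).clm_apply hF.snd)
  have h2 := (hasDerivAt_F (C := C') (c := fun s : ℝ => tangentLift φ (q + s • ((0 : E), y)))
    (t := 0) (by simpa using hq.mem') (hasDerivAt_tangentLift hs hl)).snd
  have h' : ∀ᶠ q' in 𝓝 q, ∀ᶠ q'' in 𝓝 q', IsTransition C C' φ q'' := eventually_eventually_nhds.2 h
  have h3 := deriv_unique_of_eventuallyEq h1 h2 (by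
    have hE : ∀ᶠ q' in 𝓝 (q + (0 : ℝ) • ((0 : E), y)), ∀ᶠ q'' in 𝓝 q', IsTransition C C' φ q'' := by
      rw [hq0]; exact h'
    filter_upwards [hl.continuousAt.eventually hE] with s hs
    exact congrArg Prod.snd (IsTransition.spray hs))
  simp only [zero_smul, add_zero, map_zero, zero_apply, zero_add, DF, F, tangentLift₁_zero_left,
    map_smul, ← N_apply, phi₂_symm hq.smooth q.2 y] at h3
  have h4 : (2 : ℝ) • C'.N (tangentLift φ q) (fderiv ℝ φ q.1 y) =
      (2 : ℝ) • (fderiv ℝ φ q.1 (C.N q y) - fderiv ℝ (fderiv ℝ φ) q.1 y q.2) := by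
    have h5 := congrArg Neg.neg h3
    rw [← neg_smul, neg_neg] at h5
    rw [← h5]
    module
  exact smul_right_injective E (two_ne_zero (α := ℝ)) h4

/-- The linearized sprays correspond to each other. -/
lemma IsTransition.linearized (h : ∀ᶠ q' in 𝓝 q, IsTransition C C' φ q') (Y : E × E) :
    fderiv ℝ (fderiv ℝ φ) q.1 Y.1 (C.F q).1 = fderiv ℝ (fderiv ℝ φ) q.1 (C.F q).1 Y.1 ∧
    fderiv ℝ (fderiv ℝ (fderiv ℝ φ)) q.1 (C.F q).1 Y.1 q.2 +
        fderiv ℝ (fderiv ℝ φ) q.1 (C.DF q Y).1 q.2 +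
        fderiv ℝ (fderiv ℝ φ) q.1 (C.F q).1 Y.2 + fderiv ℝ (fderiv ℝ φ) q.1 Y.1 (C.F q).2 +
        fderiv ℝ φ q.1 (C.DF q Y).2 = (C'.DF (tangentLift φ q) (tangentLift₁ φ q Y)).2 := by
  have hq := h.self_of_nhds
  have hl := hasDerivAt_line q Y
  have hq0 : q + (0 : ℝ) • Y = q := by simp
  have hs : ContDiffAt ℝ ∞ φ (q + (0 : ℝ) • Y).1 := by simpa using hq.smooth
  have hF := hasDerivAt_F (C := C) (by rw [hq0]; exact hq.mem) hl
  have h1 := (((hasDerivAt_phi₂ hs hl).clm_apply hF.fst).clm_apply hl.snd).add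
    ((hasDerivAt_phi₁ hs hl).clm_apply hF.snd)
  have h2 := (hasDerivAt_F (C := C') (c := fun s : ℝ => tangentLift φ (q + s • Y))
    (t := 0) (by simpa using hq.mem') (hasDerivAt_tangentLift hs hl)).snd
  have h' : ∀ᶠ q' in 𝓝 q, ∀ᶠ q'' in 𝓝 q', IsTransition C C' φ q'' := eventually_eventually_nhds.2 h
  have h3 := deriv_unique_of_eventuallyEq h1 h2 (by
    have hE : ∀ᶠ q' in 𝓝 (q + (0 : ℝ) • Y), ∀ᶠ q'' in 𝓝 q', IsTransition C C' φ q'' := by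
      rw [hq0]; exact h'
    filter_upwards [hl.continuousAt.eventually hE] with s hs
    exact congrArg Prod.snd (IsTransition.spray hs))
  refine ⟨phi₂_symm hq.smooth _ _, ?_⟩
  simp only [hq0] at h3
  rw [← h3, phi₃_symm hq.smooth]
  simp only [add_apply]
  abel

/-- A parallel field is parallel in every chart. -/
lemma IsTransition.parallel (h : ∀ᶠ q' in 𝓝 (γ t), IsTransition C C' φ q')
    (hγ : HasDerivAt γ (C.F (γ t)) t) {y : ℝ → E} (hy : HasDerivAt y (-C.N (γ t) (y t)) t) :
    HasDerivAt (fun s => fderiv ℝ φ (γ s).1 (y s))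
      (-C'.N (tangentLift φ (γ t)) (fderiv ℝ φ (γ t).1 (y t))) t := by
  have hq := h.self_of_nhds
  refine ((hasDerivAt_phi₁ hq.smooth hγ).clm_apply hy).congr_deriv ?_
  rw [IsTransition.N_eq h, map_neg, phi₂_symm hq.smooth (y t)]
  simp only [F]
  abel

/-- Naturality of the curvature under a change of coordinates. The lift `(y, -N y)` of a parallel
field is mapped to the lift of the transformed field, and the linearized spray equations with
forcing terms `R y` correspond to each other. -/
lemma IsTransition.R_eq (h : ∀ᶠ q' in 𝓝 (γ t), IsTransition C C' φ q')
    (hγ : ∀ᶠ s in 𝓝 t, HasDerivAt γ (C.F (γ s)) s) {y : ℝ → E}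
    (hy : ∀ᶠ s in 𝓝 t, HasDerivAt y (-C.N (γ s) (y s)) s) :
    C'.R (tangentLift φ (γ t)) (fderiv ℝ φ (γ t).1 (y t)) =
      fderiv ℝ φ (γ t).1 (C.R (γ t) (y t)) := by
  have hq := h.self_of_nhds
  have hγt := hγ.self_of_nhds
  have hyt := hy.self_of_nhds
  have hγ' : HasDerivAt (fun s => tangentLift φ (γ s)) (C'.F (tangentLift φ (γ t))) t := by
    rw [← IsTransition.spray h]
    exact hasDerivAt_tangentLift hq.smooth hγt
  have h1 := (hasDerivAt_parallel_lift (C := C') hq.mem' hγ' (IsTransition.parallel h hγt hyt)).snd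
  have hY := hasDerivAt_parallel_lift hq.mem hγt hyt
  have h2 := (((hasDerivAt_phi₂ hq.smooth hγt).clm_apply hyt).clm_apply hγt.snd).add
    ((hasDerivAt_phi₁ hq.smooth hγt).clm_apply hY.snd)
  have h' : ∀ᶠ q' in 𝓝 (γ t), ∀ᶠ q'' in 𝓝 q', IsTransition C C' φ q'' :=
    eventually_eventually_nhds.2 h
  have h3 := deriv_unique_of_eventuallyEq h1 h2 (by
    filter_upwards [hγt.continuousAt.eventually h'] with s hs
    rw [IsTransition.N_eq hs]
    simp only [Pi.add_apply, map_neg]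
    abel)
  have h4 := (IsTransition.linearized h (y t, -C.N (γ t) (y t))).2
  have e : (fderiv ℝ φ (γ t).1 (y t), -C'.N (tangentLift φ (γ t)) (fderiv ℝ φ (γ t).1 (y t))) =
      tangentLift₁ φ (γ t) (y t, -C.N (γ t) (y t)) := by
    rw [IsTransition.N_eq h]
    ext1
    · rfl
    · simp only [tangentLift₁, map_neg]; abel
  rw [e, Prod.snd_add, ← h4] at h3
  simp only [Prod.snd_add, map_add, add_apply] at h3
  rw [show (C.DF (γ t) (y t, -C.N (γ t) (y t))).1 = -C.N (γ t) (y t) from rfl] at h3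
  have h5 := sub_eq_zero.2 h3
  rw [← sub_eq_zero, ← h5]
  abel

end SprayChart

/-! ### The coordinate formulas of the spray, the connection and the curvature -/

section Coord

open LagrangeChart SprayChart

variable {n : ℕ}

lemma sum_smul_coordVec (y : Model n) : ∑ α, y α • coordVec α = y := by
  ext β
  simp [coordVec, Finset.sum_apply, Pi.single_apply]

lemma sum_smul_coordVec_apply (a : Fin (n + 1) → ℝ) (β : Fin (n + 1)) :
    (∑ α, a α • coordVec α : Model n) β = a β := by
  simp [coordVec, Finset.sum_apply, Pi.single_apply]

/-- A linear functional evaluated through the components of its argument. -/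
lemma sum_apply_coordVec {V : Type*} [NormedAddCommGroup V] [NormedSpace ℝ V]
    (f : Model n →L[ℝ] V) (y : Model n) : ∑ α, y α • f (coordVec α) = f y := by
  conv_rhs => rw [← sum_smul_coordVec y]
  simp

variable {f : Model n → Model n → ℝ} {W : Set (Model n × Model n)} {p : Model n × Model n}

lemma pdx_eq (hf : DifferentiableAt ℝ (Function.uncurry f) p) (α : Fin (n + 1)) :
    pdx α f p.1 p.2 = fderiv ℝ (Function.uncurry f) p (coordVec α, 0) := by
  have h : HasFDerivAt (fun y => f y p.2)
      ((fderiv ℝ (Function.uncurry f) p).comp (ContinuousLinearMap.inl ℝ _ _)) p.1 :=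
    hf.hasFDerivAt.comp (f := fun y => (y, p.2)) p.1 (hasFDerivAt_prodMk_left p.1 p.2)
  rw [pdx, h.fderiv]
  rfl

lemma pdv_eq (hf : DifferentiableAt ℝ (Function.uncurry f) p) (α : Fin (n + 1)) :
    pdv α f p.1 p.2 = fderiv ℝ (Function.uncurry f) p (0, coordVec α) := by
  have h : HasFDerivAt (fun y => f p.1 y)
      ((fderiv ℝ (Function.uncurry f) p).comp (ContinuousLinearMap.inr ℝ _ _)) p.2 :=
    hf.hasFDerivAt.comp (f := fun y => (p.1, y)) p.2 (hasFDerivAt_prodMk_right p.1 p.2)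
  rw [pdv, h.fderiv]
  rfl

lemma differentiableAt_clm_apply_const {E F V : Type*} [NormedAddCommGroup E] [NormedSpace ℝ E]
    [NormedAddCommGroup F] [NormedSpace ℝ F] [NormedAddCommGroup V] [NormedSpace ℝ V]
    {A : E → F →L[ℝ] V} {p : E} (hA : DifferentiableAt ℝ A p) (Y : F) :
    DifferentiableAt ℝ (fun q => A q Y) p :=
  hA.clm_apply (differentiableAt_const Y)

lemma fderiv_clm_apply_const {E F V : Type*} [NormedAddCommGroup E] [NormedSpace ℝ E]
    [NormedAddCommGroup F] [NormedSpace ℝ F] [NormedAddCommGroup V] [NormedSpace ℝ V]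
    {A : E → F →L[ℝ] V} {p : E} (hA : DifferentiableAt ℝ A p) (Y : F) (X : E) :
    fderiv ℝ (fun q => A q Y) p X = fderiv ℝ A p X Y := by
  rw [(hA.hasFDerivAt.clm_apply (hasFDerivAt_const Y p)).fderiv]
  simp

/-- `f` agrees on `W` with the function `k` of the pair `(x, v)`. -/
def Represents (W : Set (Model n × Model n)) (f : Model n → Model n → ℝ)
    (k : Model n × Model n → ℝ) : Prop :=
  ∀ p ∈ W, f p.1 p.2 = k p

lemma Represents.eventuallyEq {k : Model n × Model n → ℝ} (hW : IsOpen W)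
    (h : Represents W f k) (hp : p ∈ W) : Function.uncurry f =ᶠ[𝓝 p] k := by
  filter_upwards [hW.mem_nhds hp] with q hq using h q hq

lemma Represents.pdx {k : Model n × Model n → ℝ} (hW : IsOpen W) (h : Represents W f k)
    (hk : ∀ p ∈ W, DifferentiableAt ℝ k p) (α : Fin (n + 1)) :
    Represents W (pdx α f) (fun p => fderiv ℝ k p (coordVec α, 0)) := fun p hp => by
  have he := h.eventuallyEq hW hp
  rw [pdx_eq ((hk p hp).congr_of_eventuallyEq he), he.fderiv_eq]

lemma Represents.pdv {k : Model n × Model n → ℝ} (hW : IsOpen W) (h : Represents W f k)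
    (hk : ∀ p ∈ W, DifferentiableAt ℝ k p) (α : Fin (n + 1)) :
    Represents W (pdv α f) (fun p => fderiv ℝ k p (0, coordVec α)) := fun p hp => by
  have he := h.eventuallyEq hW hp
  rw [pdv_eq ((hk p hp).congr_of_eventuallyEq he), he.fderiv_eq]

lemma contDiffOn_det {E ι : Type*} [NormedAddCommGroup E] [NormedSpace ℝ E] [Fintype ι]
    [DecidableEq ι] {A : E → Matrix ι ι ℝ} {s : Set E}
    (hA : ∀ i j, ContDiffOn ℝ ∞ (fun p => A p i j) s) : ContDiffOn ℝ ∞ (fun p => (A p).det) s := by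
  simp only [Matrix.det_apply]
  exact ContDiffOn.sum fun σ _ => (contDiffOn_prod fun i _ => hA _ _).const_smul _

lemma contDiffOn_matrix_inv {E ι : Type*} [NormedAddCommGroup E] [NormedSpace ℝ E] [Fintype ι]
    [DecidableEq ι] {A : E → Matrix ι ι ℝ} {s : Set E}
    (hA : ∀ i j, ContDiffOn ℝ ∞ (fun p => A p i j) s) (h0 : ∀ p ∈ s, (A p).det ≠ 0) (i j : ι) :
    ContDiffOn ℝ ∞ (fun p => (A p)⁻¹ i j) s := by
  simp only [Matrix.inv_def, Matrix.smul_apply, smul_eq_mul, Ring.inverse_eq_inv',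
    Matrix.adjugate_apply]
  refine ((contDiffOn_det hA).inv h0).mul (contDiffOn_det fun k l => ?_)
  simp only [Matrix.updateRow_apply]
  split_ifs
  · exact contDiffOn_const
  · exact hA k l

variable (ℓ : Model n → Model n → ℝ) (Λ : LagrangeChart (Model n))

/-- The Lagrangian of the chart `Λ` is the function `ℓ(x,v)`. -/
def IsLagrangianOf : Prop := Λ.ℓ = Function.uncurry ℓ

variable {ℓ Λ}

lemma represents_gLow (h : IsLagrangianOf ℓ Λ) (α β : Fin (n + 1)) :
    Represents Λ.W (gLow ℓ α β) (fun p => Λ.ℓ₂ p (0, coordVec α) (0, coordVec β)) := by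
  have h0 : Represents Λ.W ℓ Λ.ℓ := fun p _ => by rw [h]; rfl
  have h1 := h0.pdv Λ.isOpen_W (fun p hp => (contDiffAt_ℓ hp).differentiableAt ne_zero_infty) β
  have hd := fun (p) (hp : p ∈ Λ.W) => (contDiffAt_ℓ₁ hp).differentiableAt ne_zero_infty
  intro p hp
  exact (h1.pdv Λ.isOpen_W (fun p hp => differentiableAt_clm_apply_const (hd p hp) _) α p hp).trans
    (fderiv_clm_apply_const (hd p hp) _ _)

lemma pdx_gLow (h : IsLagrangianOf ℓ Λ) (α β γ : Fin (n + 1)) (hp : p ∈ Λ.W) :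
    pdx γ (gLow ℓ α β) p.1 p.2 = Λ.ℓ₃ p (coordVec γ, 0) (0, coordVec α) (0, coordVec β) := by
  have hd := fun (p) (hp : p ∈ Λ.W) => (contDiffAt_ℓ₂ hp).differentiableAt ne_zero_infty
  have hd' := fun (p) (hp : p ∈ Λ.W) =>
    differentiableAt_clm_apply_const (hd p hp) ((0 : Model n), coordVec α)
  refine ((represents_gLow h α β).pdx Λ.isOpen_W
    (fun p hp => differentiableAt_clm_apply_const (hd' p hp) _) γ p hp).trans ?_
  refine (fderiv_clm_apply_const (hd' p hp) _ _).trans ?_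
  exact DFunLike.congr_fun (fderiv_clm_apply_const (hd p hp) _ _) _

lemma pdv_gLow (h : IsLagrangianOf ℓ Λ) (α β γ : Fin (n + 1)) (hp : p ∈ Λ.W) :
    pdv γ (gLow ℓ α β) p.1 p.2 = Λ.ℓ₃ p (0, coordVec γ) (0, coordVec α) (0, coordVec β) := by
  have hd := fun (p) (hp : p ∈ Λ.W) => (contDiffAt_ℓ₂ hp).differentiableAt ne_zero_infty
  have hd' := fun (p) (hp : p ∈ Λ.W) =>
    differentiableAt_clm_apply_const (hd p hp) ((0 : Model n), coordVec α)
  refine ((represents_gLow h α β).pdv Λ.isOpen_W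
    (fun p hp => differentiableAt_clm_apply_const (hd' p hp) _) γ p hp).trans ?_
  refine (fderiv_clm_apply_const (hd' p hp) _ _).trans ?_
  exact DFunLike.congr_fun (fderiv_clm_apply_const (hd p hp) _ _) _

/-- The matrix `g_{αβ}(v)`. -/
def gMat (ℓ : Model n → Model n → ℝ) (p : Model n × Model n) :
    Matrix (Fin (n + 1)) (Fin (n + 1)) ℝ :=
  Matrix.of fun μ ν => gLow ℓ μ ν p.1 p.2

lemma gUp_eq (α β : Fin (n + 1)) (p : Model n × Model n) :
    gUp ℓ α β p.1 p.2 = (gMat ℓ p)⁻¹ α β := rfl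

lemma gMat_mulVec (h : IsLagrangianOf ℓ Λ) (hp : p ∈ Λ.W) (y : Model n) (α : Fin (n + 1)) :
    ∑ β, gMat ℓ p α β * y β = Λ.ℓ₂ p (0, coordVec α) (0, y) := by
  have := sum_apply_coordVec ((Λ.ℓ₂ p (0, coordVec α)).comp (ContinuousLinearMap.inr ℝ _ _)) y
  simp only [ContinuousLinearMap.comp_apply, ContinuousLinearMap.inr_apply] at this
  rw [← this]
  refine Finset.sum_congr rfl fun β _ => ?_
  rw [smul_eq_mul, mul_comm, gMat, Matrix.of_apply, represents_gLow h α β p hp]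

lemma det_gMat_ne_zero (h : IsLagrangianOf ℓ Λ) (hp : p ∈ Λ.W) : (gMat ℓ p).det ≠ 0 := by
  intro h0
  obtain ⟨w, hw, hw0⟩ := Matrix.exists_mulVec_eq_zero_iff.2 h0
  set y : Model n := WithLp.toLp 2 w with hy
  have h1 : ∀ α, Λ.ℓ₂ p (0, coordVec α) (0, y) = 0 := fun α => by
    rw [← gMat_mulVec h hp y α]
    exact congrFun hw0 α
  have h2 : y = 0 := by
    refine Λ.nondeg p hp y fun z => ?_
    change Λ.ℓ₂ p (0, y) (0, z) = 0
    have := sum_apply_coordVec ((Λ.ℓ₂ p (0, y)).comp (ContinuousLinearMap.inr ℝ _ _)) z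
    simp only [ContinuousLinearMap.comp_apply, ContinuousLinearMap.inr_apply] at this
    rw [← this]
    exact Finset.sum_eq_zero fun α _ => by rw [ℓ₂_symm hp, h1, smul_zero]
  exact hw (by simpa [hy] using congrArg WithLp.ofLp h2)

lemma contDiffOn_gUp (h : IsLagrangianOf ℓ Λ) (α β : Fin (n + 1)) :
    ContDiffOn ℝ ∞ (fun p : Model n × Model n => gUp ℓ α β p.1 p.2) Λ.W := by
  refine contDiffOn_matrix_inv (A := gMat ℓ) (fun μ ν => ?_) (fun p hp => det_gMat_ne_zero h hp) α β
  refine ContDiffOn.congr (f := fun p => Λ.ℓ₂ p (0, coordVec μ) (0, coordVec ν)) ?_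
    fun p hp => represents_gLow h μ ν p hp
  exact fun p hp => (((contDiffAt_ℓ₂ hp).clm_apply contDiffAt_const).clm_apply
    contDiffAt_const).contDiffWithinAt

/-- The vector with components `∑ g^{αδ} X_δ`. -/
def raise (ℓ : Model n → Model n → ℝ) (p : Model n × Model n) (X : Fin (n + 1) → ℝ) : Model n :=
  ∑ α, (∑ δ, gUp ℓ α δ p.1 p.2 * X δ) • coordVec α

lemma raise_apply (X : Fin (n + 1) → ℝ) (α : Fin (n + 1)) :
    raise ℓ p X α = ∑ δ, gUp ℓ α δ p.1 p.2 * X δ := sum_smul_coordVec_apply _ α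

lemma g_raise (h : IsLagrangianOf ℓ Λ) (hp : p ∈ Λ.W) (X : Fin (n + 1) → ℝ) (δ : Fin (n + 1)) :
    Λ.ℓ₂ p (0, raise ℓ p X) (0, coordVec δ) = X δ := by
  rw [ℓ₂_symm hp, ← gMat_mulVec h hp]
  have hu : IsUnit (gMat ℓ p).det := (det_gMat_ne_zero h hp).isUnit
  have h1 : (gMat ℓ p).mulVec ((gMat ℓ p)⁻¹.mulVec X) = X := by
    rw [Matrix.mulVec_mulVec, Matrix.mul_nonsing_inv _ hu, Matrix.one_mulVec]
  have h2 := congrFun h1 δ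
  simp only [Matrix.mulVec, dotProduct] at h2
  simp only [raise_apply, gUp_eq]
  exact h2

lemma eq_of_g_coordVec (hp : p ∈ Λ.W) {y y' : Model n}
    (h : ∀ δ, Λ.ℓ₂ p (0, y) (0, coordVec δ) = Λ.ℓ₂ p (0, y') (0, coordVec δ)) : y = y' := by
  rw [← sub_eq_zero]
  refine Λ.nondeg p hp _ fun z => ?_
  change Λ.ℓ₂ p (0, y - y') (0, z) = 0
  have e : ((0 : Model n), y - y') = (0, y) - (0, y') := by simp
  have := fun y => sum_apply_coordVec ((Λ.ℓ₂ p (0, y)).comp (ContinuousLinearMap.inr ℝ _ _)) z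
  simp only [ContinuousLinearMap.comp_apply, ContinuousLinearMap.inr_apply] at this
  rw [e, map_sub, sub_apply, ← this y, ← this y', sub_eq_zero]
  exact Finset.sum_congr rfl fun δ _ => by rw [h δ]

/-- Contraction of the Christoffel symbols with two vectors. -/
lemma sum_raise (p : Model n × Model n) (X : Fin (n + 1) → Fin (n + 1) → Fin (n + 1) → ℝ)
    (α : Fin (n + 1)) (y z : Model n) :
    ∑ β, ∑ γ, (∑ δ, gUp ℓ α δ p.1 p.2 * X δ β γ) * y β * z γ =
      raise ℓ p (fun δ => ∑ β, ∑ γ, X δ β γ * y β * z γ) α := by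
  simp only [raise_apply, Finset.mul_sum, Finset.sum_mul]
  rw [Finset.sum_congr rfl fun β _ => Finset.sum_comm, Finset.sum_comm]
  exact Finset.sum_congr rfl fun δ _ => Finset.sum_congr rfl fun β _ =>
    Finset.sum_congr rfl fun γ _ => by ring

/-- Evaluation of a trilinear expression through components. -/
lemma sum_sum_bilin (b : Model n →L[ℝ] Model n →L[ℝ] ℝ) (y z : Model n) :
    ∑ β, ∑ γ, b (coordVec β) (coordVec γ) * y β * z γ = b y z := by
  have h1 : ∀ β, ∑ γ, b (coordVec β) (coordVec γ) * y β * z γ = y β * b (coordVec β) z := fun β => by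
    rw [← sum_apply_coordVec (b (coordVec β)) z, Finset.mul_sum]
    exact Finset.sum_congr rfl fun γ _ => by rw [smul_eq_mul]; ring
  rw [Finset.sum_congr rfl fun β _ => h1 β, ← sum_apply_coordVec b y]
  simp

end Coord

section Coord

open LagrangeChart SprayChart

variable {n : ℕ} {p : Model n × Model n} {ℓ : Model n → Model n → ℝ} {Λ : LagrangeChart (Model n)}

/-- Restriction of a bilinear form on `E × E` to the fibre directions, as a function of the form. -/
def fibrePart (E : Type*) [NormedAddCommGroup E] [NormedSpace ℝ E] :
    (E × E →L[ℝ] E × E →L[ℝ] ℝ) →L[ℝ] E →L[ℝ] E →L[ℝ] ℝ :=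
  ((ContinuousLinearMap.compL ℝ E (E × E) (E →L[ℝ] ℝ)).flip (ContinuousLinearMap.inr ℝ E E)).comp
    (ContinuousLinearMap.compL ℝ (E × E) (E × E →L[ℝ] ℝ) (E →L[ℝ] ℝ)
      ((ContinuousLinearMap.compL ℝ E (E × E) ℝ).flip (ContinuousLinearMap.inr ℝ E E)))

/-- The trilinear form `∂_x ∂_v ∂_v ℓ`. -/
def cubicX (Λ : LagrangeChart (Model n)) (p : Model n × Model n) :
    Model n →L[ℝ] Model n →L[ℝ] Model n →L[ℝ] ℝ :=
  (fibrePart (Model n)).comp ((Λ.ℓ₃ p).comp (ContinuousLinearMap.inl ℝ _ _))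

/-- The trilinear form `∂_v ∂_v ∂_v ℓ`. -/
def cubicV (Λ : LagrangeChart (Model n)) (p : Model n × Model n) :
    Model n →L[ℝ] Model n →L[ℝ] Model n →L[ℝ] ℝ :=
  (fibrePart (Model n)).comp ((Λ.ℓ₃ p).comp (ContinuousLinearMap.inr ℝ _ _))

lemma cubicX_apply (x y z : Model n) :
    cubicX Λ p x y z = Λ.ℓ₃ p (x, 0) (0, y) (0, z) := rfl

lemma cubicV_apply (x y z : Model n) :
    cubicV Λ p x y z = Λ.ℓ₃ p (0, x) (0, y) (0, z) := rfl

lemma cubicX_symm (hp : p ∈ Λ.W) (x y z : Model n) : cubicX Λ p x y z = cubicX Λ p x z y :=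
  ℓ₃_symm_right hp _ _ _

lemma cubicV_symm (hp : p ∈ Λ.W) (x y z : Model n) : cubicV Λ p x y z = cubicV Λ p x z y :=
  ℓ₃_symm_right hp _ _ _

/-- The combination of first derivatives of a metric that enters the Christoffel symbols, summed
against two vectors. -/
lemma sum_christoffel_type (T : Model n →L[ℝ] Model n →L[ℝ] Model n →L[ℝ] ℝ)
    (A : Model n →L[ℝ] Model n) (hT : ∀ x y z, T x y z = T x z y) (e y z : Model n) :
    ∑ β, ∑ γ, (1 / 2 * (T (A (coordVec β)) e (coordVec γ) + T (A (coordVec γ)) (coordVec β) e -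
      T (A e) (coordVec β) (coordVec γ))) * y β * z γ =
      1 / 2 * (T (A y) e z + T (A z) e y - T (A e) y z) := by
  have h1 := sum_sum_bilin ((T.comp A).flip e) y z
  have h2 := sum_sum_bilin ((T.comp A).flip e).flip y z
  have h3 := sum_sum_bilin (T (A e)) y z
  simp only [ContinuousLinearMap.flip_apply, ContinuousLinearMap.comp_apply] at h1 h2
  rw [← h1, ← h2, ← h3, ← Finset.sum_add_distrib, ← Finset.sum_sub_distrib, Finset.mul_sum]
  refine Finset.sum_congr rfl fun β _ => ?_
  rw [← Finset.sum_add_distrib, ← Finset.sum_sub_distrib, Finset.mul_sum]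
  refine Finset.sum_congr rfl fun γ _ => ?_
  rw [hT _ (coordVec β) e]
  ring

/-- The expression `(∂_β g_{δγ} + ∂_γ g_{βδ} - ∂_δ g_{βγ})/2` for the formal Christoffel symbols. -/
lemma formalChristoffel_eq (h : IsLagrangianOf ℓ Λ) (hp : p ∈ Λ.W) (α β γ : Fin (n + 1)) :
    formalChristoffel ℓ α β γ p.1 p.2 = ∑ δ, gUp ℓ α δ p.1 p.2 *
      (1 / 2 * (cubicX Λ p (coordVec β) (coordVec δ) (coordVec γ) +
        cubicX Λ p (coordVec γ) (coordVec β) (coordVec δ) -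
        cubicX Λ p (coordVec δ) (coordVec β) (coordVec γ))) := by
  rw [formalChristoffel, Finset.mul_sum]
  refine Finset.sum_congr rfl fun δ _ => ?_
  simp only [pdx_gLow h _ _ _ hp, cubicX_apply]
  ring

/-- The spray coefficients as a vector-valued function on the chart domain of `TM`. -/
def sprayVec (ℓ : Model n → Model n → ℝ) (p : Model n × Model n) : Model n :=
  ∑ α, sprayCoeff ℓ α p.1 p.2 • coordVec α

lemma sprayVec_apply (α : Fin (n + 1)) : sprayVec ℓ p α = sprayCoeff ℓ α p.1 p.2 :=
  sum_smul_coordVec_apply _ α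

lemma sprayVec_eq (h : IsLagrangianOf ℓ Λ) (hp : p ∈ Λ.W) :
    sprayVec ℓ p = (1 / 2 : ℝ) • raise ℓ p fun δ => 1 / 2 * (cubicX Λ p p.2 (coordVec δ) p.2 +
      cubicX Λ p p.2 (coordVec δ) p.2 - cubicX Λ p (coordVec δ) p.2 p.2) := by
  ext α
  rw [sprayVec_apply, sprayCoeff, PiLp.smul_apply, smul_eq_mul]
  simp only [formalChristoffel_eq h hp, sum_raise]
  refine congrArg (fun X => (1 / 2 : ℝ) * raise ℓ p X α) (funext fun δ => ?_)
  exact sum_christoffel_type (cubicX Λ p) (ContinuousLinearMap.id ℝ _) (cubicX_symm hp)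
    (coordVec δ) p.2 p.2

lemma contDiffOn_sprayVec (h : IsLagrangianOf ℓ Λ) : ContDiffOn ℝ ∞ (sprayVec ℓ) Λ.W := by
  refine ContDiffOn.congr (f := fun p => ∑ α, ((1 / 2 : ℝ) * ∑ β, ∑ γ, (∑ δ, gUp ℓ α δ p.1 p.2 *
      (1 / 2 * (cubicX Λ p (coordVec β) (coordVec δ) (coordVec γ) +
        cubicX Λ p (coordVec γ) (coordVec β) (coordVec δ) -
        cubicX Λ p (coordVec δ) (coordVec β) (coordVec γ)))) * p.2 β * p.2 γ) •
          (coordVec α : Model n)) ?_ ?_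
  · have hX : ∀ x y z, ContDiffOn ℝ ∞ (fun p => cubicX Λ p x y z) Λ.W := fun x y z q hq => by
      exact (contDiffAt_ℓ₃_apply hq _ _ _).contDiffWithinAt
    have hv : ∀ β, ContDiffOn ℝ ∞ (fun p : Model n × Model n => p.2 β) Λ.W := fun β =>
      ((EuclideanSpace.proj β : Model n →L[ℝ] ℝ).contDiff.comp contDiff_snd).contDiffOn
    refine ContDiffOn.sum fun α _ => ?_
    have hc : ContDiffOn ℝ ∞ (fun _ : Model n × Model n => (coordVec α : Model n)) Λ.W :=
      contDiffOn_const
    refine ContDiffOn.fun_smul ?_ hc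
    refine contDiffOn_const.mul (ContDiffOn.sum fun β _ => ContDiffOn.sum fun γ _ => ?_)
    refine ((ContDiffOn.sum fun δ _ => (contDiffOn_gUp h α δ).mul ?_).mul (hv β)).mul (hv γ)
    exact contDiffOn_const.mul (((hX _ _ _).add (hX _ _ _)).sub (hX _ _ _))
  · intro q hq
    simp only [sprayVec, sprayCoeff, formalChristoffel_eq h hq]

/-- The spray coefficients of the coordinate formula satisfy the Euler–Lagrange equation. -/
lemma sprayVec_el (h : IsLagrangianOf ℓ Λ) (hp : p ∈ Λ.W) (z : Model n) :
    Λ.ℓ₂ p (p.2, -(2 : ℝ) • sprayVec ℓ p) (0, z) = fderiv ℝ Λ.ℓ p (z, 0) := by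
  have key : ∀ δ, Λ.ℓ₂ p (p.2, -(2 : ℝ) • sprayVec ℓ p) (0, coordVec δ) =
      fderiv ℝ Λ.ℓ p (coordVec δ, 0) := fun δ => by
    rw [ℓ₂_split, ℓ₂_zero_smul, sprayVec_eq h hp, ℓ₂_zero_smul, g_raise h hp]
    have h1 := g_v_deriv hp (p.2, 0) (coordVec δ)
    have h2 := g_v_deriv hp (coordVec δ, 0) p.2
    have h3 := ℓ₂_x_v hp (coordVec δ)
    have h0 : ((0 : Model n), (0 : Model n)) = 0 := rfl
    simp only [h0, map_zero, add_zero] at h1 h2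
    simp only [cubicX_apply, h1, h2, h3]
    ring
  have h1 := sum_apply_coordVec ((Λ.ℓ₂ p (p.2, -(2 : ℝ) • sprayVec ℓ p)).comp
    (ContinuousLinearMap.inr ℝ _ _)) z
  have h2 := sum_apply_coordVec ((fderiv ℝ Λ.ℓ p).comp (ContinuousLinearMap.inl ℝ _ _)) z
  simp only [ContinuousLinearMap.comp_apply, ContinuousLinearMap.inr_apply,
    ContinuousLinearMap.inl_apply] at h1 h2
  rw [← h1, ← h2]
  exact Finset.sum_congr rfl fun δ _ => by rw [key]

/-- The chart `Λ` with the spray given by the coordinate formula. -/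
def coordSpray (ℓ : Model n → Model n → ℝ) (Λ : LagrangeChart (Model n))
    (h : IsLagrangianOf ℓ Λ) : SprayChart (Model n) where
  toLagrangeChart := Λ
  G := sprayVec ℓ
  smooth_G := contDiffOn_sprayVec h
  el := fun _ hp z => sprayVec_el h hp z

variable (h : IsLagrangianOf ℓ Λ)

lemma represents_sprayCoeff (α : Fin (n + 1)) :
    Represents Λ.W (sprayCoeff ℓ α) (fun p => (coordSpray ℓ Λ h).G p α) :=
  fun _ _ => (sprayVec_apply α).symm

lemma fderiv_component {E : Type*} [NormedAddCommGroup E] [NormedSpace ℝ E] {A : E → Model n}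
    {p : E} (hA : DifferentiableAt ℝ A p) (α : Fin (n + 1)) :
    DifferentiableAt ℝ (fun q => A q α) p ∧
      ∀ X, fderiv ℝ (fun q => A q α) p X = fderiv ℝ A p X α := by
  have h1 := (EuclideanSpace.proj α : Model n →L[ℝ] ℝ).hasFDerivAt.comp p hA.hasFDerivAt
  exact ⟨h1.differentiableAt, fun X => DFunLike.congr_fun h1.fderiv X⟩

lemma represents_nonlinConn (α β : Fin (n + 1)) :
    Represents Λ.W (nonlinConn ℓ α β) (fun p => (coordSpray ℓ Λ h).N p (coordVec β) α) := by
  have hd := fun (p) (hp : p ∈ Λ.W) =>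
    (contDiffAt_G (C := coordSpray ℓ Λ h) hp).differentiableAt ne_zero_infty
  intro p hp
  exact ((represents_sprayCoeff h α).pdv Λ.isOpen_W
    (fun p hp => (fderiv_component (hd p hp) α).1) β p hp).trans
      ((fderiv_component (hd p hp) α).2 _)

lemma pdx_sprayCoeff (α β : Fin (n + 1)) (hp : p ∈ Λ.W) :
    pdx β (sprayCoeff ℓ α) p.1 p.2 = fderiv ℝ (coordSpray ℓ Λ h).G p (coordVec β, 0) α := by
  have hd := fun (p) (hp : p ∈ Λ.W) =>
    (contDiffAt_G (C := coordSpray ℓ Λ h) hp).differentiableAt ne_zero_infty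
  exact ((represents_sprayCoeff h α).pdx Λ.isOpen_W
    (fun p hp => (fderiv_component (hd p hp) α).1) β p hp).trans
      ((fderiv_component (hd p hp) α).2 _)

lemma pd_nonlinConn (α β γ : Fin (n + 1)) (hp : p ∈ Λ.W) :
    pdx γ (nonlinConn ℓ α β) p.1 p.2 =
        fderiv ℝ (fderiv ℝ (coordSpray ℓ Λ h).G) p (coordVec γ, 0) (0, coordVec β) α ∧
      pdv γ (nonlinConn ℓ α β) p.1 p.2 =
        fderiv ℝ (fderiv ℝ (coordSpray ℓ Λ h).G) p (0, coordVec γ) (0, coordVec β) α := by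
  have hd := fun (p) (hp : p ∈ Λ.W) =>
    (contDiffAt_G₁ (C := coordSpray ℓ Λ h) hp).differentiableAt ne_zero_infty
  have hd' := fun (p) (hp : p ∈ Λ.W) =>
    differentiableAt_clm_apply_const (hd p hp) ((0 : Model n), coordVec β)
  have hX : ∀ X, fderiv ℝ (fun q => (coordSpray ℓ Λ h).N q (coordVec β) α) p X =
      fderiv ℝ (fderiv ℝ (coordSpray ℓ Λ h).G) p X (0, coordVec β) α := fun X =>
    ((fderiv_component (hd' p hp) α).2 X).trans
      (congrArg (fun y : Model n => y α) (fderiv_clm_apply_const (hd p hp) _ X))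
  exact ⟨((represents_nonlinConn h α β).pdx Λ.isOpen_W
      (fun p hp => (fderiv_component (hd' p hp) α).1) γ p hp).trans (hX _),
    ((represents_nonlinConn h α β).pdv Λ.isOpen_W
      (fun p hp => (fderiv_component (hd' p hp) α).1) γ p hp).trans (hX _)⟩

lemma sum_apply_coordVec_apply (f : Model n →L[ℝ] Model n) (y : Model n) (α : Fin (n + 1)) :
    ∑ β, f (coordVec β) α * y β = f y α := by
  have := sum_apply_coordVec ((EuclideanSpace.proj α : Model n →L[ℝ] ℝ).comp f) y
  refine Eq.trans ?_ this
  exact Finset.sum_congr rfl fun β _ => mul_comm _ _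

/-- The curvature coefficients are the matrix of the curvature endomorphism. -/
lemma curvCoeff_eq (α β : Fin (n + 1)) (hp : p ∈ Λ.W) :
    curvCoeff ℓ α β p.1 p.2 = (coordSpray ℓ Λ h).R p (coordVec β) α := by
  set C := coordSpray ℓ Λ h with hC
  have h1 : ∑ γ, (pdx γ (nonlinConn ℓ α β) p.1 p.2 * p.2 γ -
      2 * pdv γ (nonlinConn ℓ α β) p.1 p.2 * sprayCoeff ℓ γ p.1 p.2) =
      fderiv ℝ (fderiv ℝ C.G) p (C.F p) (0, coordVec β) α := by
    let D : Model n × Model n →L[ℝ] ℝ := (EuclideanSpace.proj α : Model n →L[ℝ] ℝ).comp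
      ((fderiv ℝ (fderiv ℝ C.G) p).flip (0, coordVec β))
    have e1 := sum_apply_coordVec (D.comp (ContinuousLinearMap.inl ℝ _ _)) p.2
    have e2 := sum_apply_coordVec (D.comp (ContinuousLinearMap.inr ℝ _ _)) (C.G p)
    have e3 : D (C.F p) = D (p.2, 0) - 2 * D (0, C.G p) := by
      have : C.F p = (p.2, 0) - (2 : ℝ) • ((0 : Model n), C.G p) := by simp [F]
      rw [this, map_sub, map_smul, smul_eq_mul]
    change _ = D (C.F p)
    simp only [ContinuousLinearMap.comp_apply, ContinuousLinearMap.inr_apply,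
      ContinuousLinearMap.inl_apply, smul_eq_mul] at e1 e2
    rw [e3, ← e1, ← e2, Finset.mul_sum, ← Finset.sum_sub_distrib]
    refine Finset.sum_congr rfl fun γ _ => ?_
    rw [(pd_nonlinConn h α β γ hp).1, (pd_nonlinConn h α β γ hp).2,
      represents_sprayCoeff h γ p hp]
    change D (coordVec γ, 0) * p.2 γ - 2 * D (0, coordVec γ) * C.G p γ = _
    ring
  have h2 : ∑ γ, nonlinConn ℓ α γ p.1 p.2 * nonlinConn ℓ γ β p.1 p.2 =
      C.N p (C.N p (coordVec β)) α := by
    rw [← sum_apply_coordVec_apply (C.N p) (C.N p (coordVec β)) α]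
    exact Finset.sum_congr rfl fun γ _ => by
      rw [represents_nonlinConn h α γ p hp, represents_nonlinConn h γ β p hp]
  rw [curvCoeff, h1, h2, pdx_sprayCoeff h α β hp, SprayChart.R_apply]
  simp [hC]

lemma curvTerm_eq (hp : p ∈ Λ.W) (w : Model n) :
    curvTerm ℓ p.1 p.2 w = (coordSpray ℓ Λ h).R p w := by
  ext α
  rw [curvTerm, sum_smul_coordVec_apply, ← sum_apply_coordVec_apply]
  exact Finset.sum_congr rfl fun β _ => by rw [curvCoeff_eq h α β hp]

lemma sum_curvCoeff_eq_trace (hp : p ∈ Λ.W) : ∑ α, curvCoeff ℓ α α p.1 p.2 =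
    LinearMap.trace ℝ (Model n) ((coordSpray ℓ Λ h).R p : Model n →ₗ[ℝ] Model n) := by
  rw [LinearMap.trace_eq_sum_inner _ (EuclideanSpace.basisFun (Fin (n + 1)) ℝ)]
  refine Finset.sum_congr rfl fun α _ => ?_
  rw [curvCoeff_eq h α α hp, EuclideanSpace.basisFun_apply, EuclideanSpace.inner_single_left]
  simp [coordVec]

/-- Contracted with the reference vector, the Chern connection is the nonlinear connection. Two of
the three Cartan tensor terms vanish because the Cartan tensor annihilates `v`, and the remaining
one, which contains `N v = 2G`, completes the derivative of `g` along the spray. -/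
lemma chernTerm_eq (hp : p ∈ Λ.W) (y : Model n) :
    chernTerm ℓ p.1 p.2 y = (coordSpray ℓ Λ h).N p y := by
  set C := coordSpray ℓ Λ h with hC
  have hc : ∀ α β γ, chern ℓ α β γ p.1 p.2 = ∑ δ, gUp ℓ α δ p.1 p.2 *
      (1 / 2 * (cubicX Λ p (coordVec β) (coordVec δ) (coordVec γ) +
        cubicX Λ p (coordVec γ) (coordVec β) (coordVec δ) -
        cubicX Λ p (coordVec δ) (coordVec β) (coordVec γ)) -
      1 / 2 * (cubicV Λ p (C.N p (coordVec β)) (coordVec δ) (coordVec γ) +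
        cubicV Λ p (C.N p (coordVec γ)) (coordVec β) (coordVec δ) -
        cubicV Λ p (C.N p (coordVec δ)) (coordVec β) (coordVec γ))) := fun α β γ => by
    have hN : ∀ β y z, ∑ μ, cubicV Λ p (coordVec μ) y z * C.N p (coordVec β) μ =
        cubicV Λ p (C.N p (coordVec β)) y z := fun β y z => by
      refine Eq.trans ?_ (sum_apply_coordVec (((cubicV Λ p).flip y).flip z) (C.N p (coordVec β)))
      exact Finset.sum_congr rfl fun μ _ => mul_comm _ _
    rw [chern, formalChristoffel_eq h hp, Finset.mul_sum, ← Finset.sum_sub_distrib]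
    refine Finset.sum_congr rfl fun δ _ => ?_
    rw [← Finset.mul_sum]
    have e : ∑ μ, (pdv μ (gLow ℓ δ γ) p.1 p.2 * nonlinConn ℓ μ β p.1 p.2 +
        pdv μ (gLow ℓ β δ) p.1 p.2 * nonlinConn ℓ μ γ p.1 p.2 -
        pdv μ (gLow ℓ β γ) p.1 p.2 * nonlinConn ℓ μ δ p.1 p.2) =
        cubicV Λ p (C.N p (coordVec β)) (coordVec δ) (coordVec γ) +
        cubicV Λ p (C.N p (coordVec γ)) (coordVec β) (coordVec δ) -
        cubicV Λ p (C.N p (coordVec δ)) (coordVec β) (coordVec γ) := by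
      rw [← hN, ← hN, ← hN, ← Finset.sum_add_distrib, ← Finset.sum_sub_distrib]
      refine Finset.sum_congr rfl fun μ _ => ?_
      simp only [pdv_gLow h _ _ _ hp, cubicV_apply, represents_nonlinConn h _ _ p hp, hC]
    rw [e]
    ring
  have hr : chernTerm ℓ p.1 p.2 y = raise ℓ p fun δ =>
      1 / 2 * (cubicX Λ p p.2 (coordVec δ) y + cubicX Λ p y (coordVec δ) p.2 -
        cubicX Λ p (coordVec δ) p.2 y) -
      1 / 2 * (cubicV Λ p (C.N p p.2) (coordVec δ) y + cubicV Λ p (C.N p y) (coordVec δ) p.2 -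
        cubicV Λ p (C.N p (coordVec δ)) p.2 y) := by
    ext α
    rw [chernTerm, sum_smul_coordVec_apply]
    simp only [hc, sum_raise]
    refine congrArg (fun X => raise ℓ p X α) (funext fun δ => ?_)
    have e1 := sum_christoffel_type (cubicX Λ p) (ContinuousLinearMap.id ℝ _) (cubicX_symm hp)
      (coordVec δ) p.2 y
    have e2 := sum_christoffel_type (cubicV Λ p) (C.N p) (cubicV_symm hp) (coordVec δ) p.2 y
    simp only [ContinuousLinearMap.id_apply] at e1
    rw [← e1, ← e2, ← Finset.sum_sub_distrib]
    refine Finset.sum_congr rfl fun β _ => ?_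
    rw [← Finset.sum_sub_distrib]
    exact Finset.sum_congr rfl fun γ _ => by ring
  rw [hr]
  refine eq_of_g_coordVec hp fun δ => ?_
  rw [g_raise h hp]
  have h1 : 2 * Λ.ℓ₂ p (0, C.N p y) (0, coordVec δ) = Λ.ℓ₃ p (C.F p) (0, y) (0, coordVec δ) +
      Λ.ℓ₂ p (y, 0) (0, coordVec δ) - Λ.ℓ₂ p (coordVec δ, 0) (0, y) :=
    two_g_N (C := C) hp y (coordVec δ)
  have h2 := g_v_deriv hp (y, 0) (coordVec δ)
  have h3 := g_v_deriv hp (coordVec δ, 0) y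
  have h0 : ((0 : Model n), (0 : Model n)) = 0 := rfl
  simp only [h0, map_zero, add_zero] at h2 h3
  have h4 := cartan_v hp (C.N p y) (coordVec δ)
  have h5 := cartan_v hp (C.N p (coordVec δ)) y
  rw [ℓ₃_symm_right hp] at h5
  have h6 : Λ.ℓ₃ p (C.F p) (0, y) (0, coordVec δ) = Λ.ℓ₃ p (p.2, 0) (0, coordVec δ) (0, y) -
      Λ.ℓ₃ p (0, C.N p p.2) (0, coordVec δ) (0, y) := by
    have : C.F p = (p.2, 0) - ((0 : Model n), C.N p p.2) := by
      rw [N_v (C := C) hp]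
      simp [F]
    rw [this, map_sub, sub_apply, sub_apply, ℓ₃_symm_right hp, ℓ₃_symm_right hp (0, C.N p p.2)]
  have h7 : Λ.ℓ₃ p (coordVec δ, 0) (0, p.2) (0, y) = Λ.ℓ₃ p (coordVec δ, 0) (0, y) (0, p.2) :=
    ℓ₃_symm_right hp _ _ _
  simp only [cubicX_apply, cubicV_apply, h2, h4, h5, h7, h3]
  linarith

end Coord

/-! ### Bundle charts of a Lorentz–Finsler manifold -/

section Charts

open LagrangeChart SprayChart

variable {n : ℕ} {M : Type*} [TopologicalSpace M] [ChartedSpace (Model n) M]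

/-- The coordinate domain of the slit tangent bundle. -/
def slitDomain (n : ℕ) {M : Type*} [TopologicalSpace M] [ChartedSpace (Model n) M] (p : M) : Set (Model n × Model n) := (chartAt (Model n) p).target ×ˢ {0}ᶜ

lemma isOpen_slitDomain (p : M) : IsOpen (slitDomain n p) :=
  (chartAt (Model n) p).open_target.prod isOpen_compl_singleton

variable [IsManifold 𝓘(ℝ, Model n) ∞ M] {p q m : M}

/-- The map `T_mM → ℝⁿ⁺¹` sending a tangent vector to its components in the preferred chart at `p`. -/
def coordMap (p m : M) : Model n →L[ℝ] Model n := tangentCoordChange 𝓘(ℝ, Model n) m p m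

lemma bundleChart_apply (p : M) (w : TM n M) :
    bundleChart n p w = (chartAt (Model n) p w.1, coordMap p w.1 w.2) := rfl

lemma bundleChart_source (p : M) :
    (bundleChart n p).source = {w : TM n M | w.1 ∈ (chartAt (Model n) p).source} := by
  ext w
  rw [bundleChart, extChartAt_source]
  exact TangentBundle.mem_chart_source_iff w ⟨p, 0⟩

lemma bundleChart_target (p : M) :
    (bundleChart n p).target = (chartAt (Model n) p).target ×ˢ univ := by
  ext x
  rw [bundleChart]
  erw [FiberBundle.extChartAt_target]
  simp only [mfld_simps]
  constructor
  · rintro ⟨h, -⟩; exact h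
  · intro h; exact ⟨h, (chartAt (Model n) p).map_target h⟩

lemma coordMap_self (m : M) (y : Model n) : coordMap m m y = y :=
  tangentCoordChange_self (mem_extChartAt_source m)

/-- The change of coordinates between the preferred charts at `p` and at `q`. -/
def transition (p q : M) (x : Model n) : Model n :=
  chartAt (Model n) q ((chartAt (Model n) p).symm x)

lemma fderiv_transition (hp : m ∈ (chartAt (Model n) p).source)
    (hq : m ∈ (chartAt (Model n) q).source) (y : Model n) :
    fderiv ℝ (transition p q) (chartAt (Model n) p m) (coordMap p m y) = coordMap q m y := by
  have h := tangentCoordChange_comp (I := 𝓘(ℝ, Model n)) (w := m) (x := p) (y := q) (z := m) (v := y)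
    ⟨⟨mem_extChartAt_source m, by simpa using hp⟩, by simpa using hq⟩
  rw [coordMap, coordMap, ← h, tangentCoordChange_def (x := p)]
  simp only [mfld_simps, fderivWithin_univ]
  rfl

lemma coordMap_bijective (hp : m ∈ (chartAt (Model n) p).source) :
    Function.Bijective (coordMap p m : Model n → Model n) := by
  have hm := mem_chart_source (Model n) m
  have h1 : ∀ y : Model n, fderiv ℝ (transition p m) (chartAt (Model n) p m) (coordMap p m y) = y :=
    fun y => by rw [fderiv_transition hp hm, coordMap_self]
  have h2 : Function.Injective (coordMap p m : Model n → Model n) :=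
    Function.LeftInverse.injective h1
  exact ⟨h2, LinearMap.injective_iff_surjective
    (f := ((coordMap p m : Model n →L[ℝ] Model n) : Model n →ₗ[ℝ] Model n)) |>.1 h2⟩

lemma coordMap_ne_zero (hp : m ∈ (chartAt (Model n) p).source) {y : Model n} (hy : y ≠ 0) :
    coordMap p m y ≠ 0 := fun h => hy ((coordMap_bijective hp).1 (h.trans (map_zero _).symm))

lemma contDiffAt_transition {x : Model n} (hx : x ∈ (chartAt (Model n) p).target)
    (hq : (chartAt (Model n) p).symm x ∈ (chartAt (Model n) q).source) :
    ContDiffAt ℝ ∞ (transition p q) x := by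
  have h := contDiffWithinAt_ext_coord_change (I := 𝓘(ℝ, Model n)) (n := ∞) q p (y := x)
    (by simpa only [mfld_simps] using ⟨hx, hq⟩)
  rw [show range 𝓘(ℝ, Model n) = univ from range_id, contDiffWithinAt_univ] at h
  exact h

namespace LorentzFinsler

variable (S : LorentzFinsler n M)

lemma localL_bundleChart {w : TM n M} (hw : w.1 ∈ (chartAt (Model n) p).source) :
    Function.uncurry (S.localL p) (bundleChart n p w) = S.L w := by
  have := (bundleChart n p).left_inv (x := w) (by rw [bundleChart_source]; exact hw)
  exact congrArg S.L this

/-- Every point of the coordinate domain comes from a tangent vector. -/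
lemma exists_bundleChart_eq {x : Model n × Model n} (hx : x.1 ∈ (chartAt (Model n) p).target) :
    ∃ (m : M) (u : Model n), m ∈ (chartAt (Model n) p).source ∧
      (bundleChart n p).symm x = (⟨m, u⟩ : TM n M) ∧ chartAt (Model n) p m = x.1 ∧
        coordMap p m u = x.2 := by
  have ht : x ∈ (bundleChart n p : PartialEquiv (TM n M) _).target := by
    rw [bundleChart_target]; exact ⟨hx, mem_univ _⟩
  have h1 := (bundleChart n p).map_target ht
  have h2 := (bundleChart n p).right_inv ht
  rw [bundleChart_source] at h1
  rw [bundleChart_apply] at h2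
  exact ⟨_, _, h1, rfl, congrArg Prod.fst h2, congrArg Prod.snd h2⟩

lemma contDiffOn_localL (p : M) :
    ContDiffOn ℝ ∞ (Function.uncurry (S.localL p)) (slitDomain n p) := by
  have h1 : ContMDiffOn 𝓘(ℝ, Model n × Model n) 𝓘(ℝ, Model n).tangent ∞ (bundleChart n p).symm (bundleChart n p).target :=
    contMDiffOn_extChartAt_symm (I := 𝓘(ℝ, Model n).tangent) (⟨p, 0⟩ : TM n M)
  refine contMDiffOn_iff_contDiffOn.1 (S.smooth.comp (h1.mono ?_) ?_)
  · rw [bundleChart_target]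
    exact prod_mono_right (subset_univ _)
  · rintro x ⟨hx, hx0⟩
    obtain ⟨m, u, -, h3, -, h4⟩ := exists_bundleChart_eq (p := p) hx
    rw [mem_preimage, h3]
    rintro (rfl : u = 0)
    exact hx0 ((map_zero _).symm.trans h4).symm

lemma localL_smul {x : Model n} (hx : x ∈ (chartAt (Model n) p).target) (v : Model n) {c : ℝ}
    (hc : 0 < c) : S.localL p x (c • v) = c ^ 2 * S.localL p x v := by
  obtain ⟨m, u, hm, -, h1, h2⟩ := exists_bundleChart_eq (p := p) (x := (x, v)) hx
  have e1 := S.localL_bundleChart (p := p) (w := ⟨m, u⟩) hm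
  have e2 := S.localL_bundleChart (p := p) (w := ⟨m, c • u⟩) hm
  rw [bundleChart_apply] at e1 e2
  simp only [map_smul, h1, h2] at e1 e2
  exact e2.trans ((S.homogeneous m u c hc).trans (congrArg _ e1.symm))

lemma euler_localL {x : Model n × Model n} (hx : x ∈ slitDomain n p) :
    fderiv ℝ (Function.uncurry (S.localL p)) x (0, x.2) = 2 * Function.uncurry (S.localL p) x := by
  have hd := ((S.contDiffOn_localL p).contDiffAt
    ((isOpen_slitDomain p).mem_nhds hx)).differentiableAt ne_zero_infty
  have hx' : x + (0 : ℝ) • ((0 : Model n), x.2) = x := by simp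
  have h1 : HasDerivAt (fun s : ℝ => Function.uncurry (S.localL p) (x + s • (0, x.2)))
      (fderiv ℝ (Function.uncurry (S.localL p)) x (0, x.2)) 0 :=
    HasFDerivAt.comp_hasDerivAt (l := Function.uncurry (S.localL p))
      (f := fun s : ℝ => x + s • ((0 : Model n), x.2)) 0
      (by rw [hx']; exact hd.hasFDerivAt) (hasDerivAt_line x (0, x.2))
  have h2 : HasDerivAt (fun s : ℝ => (1 + s) ^ 2 * Function.uncurry (S.localL p) x)
      (2 * Function.uncurry (S.localL p) x) 0 := by
    have := (((hasDerivAt_id (0 : ℝ)).const_add 1).pow 2).mul_const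
      (Function.uncurry (S.localL p) x)
    simpa using this
  refine deriv_unique_of_eventuallyEq h1 h2 ?_
  filter_upwards [Ioi_mem_nhds (show (-1 : ℝ) < 0 by norm_num)] with s hs
  have e : x + s • ((0 : Model n), x.2) = (x.1, (1 + s) • x.2) := by
    ext1
    · simp
    · simp [add_smul]
  rw [e]
  exact S.localL_smul hx.1 x.2 (by have := mem_Ioi.1 hs; linarith)

/-- The fibre Hessian in terms of the coordinate expression of the Lagrangian. -/
lemma fibreHess_eq (hm : m ∈ (chartAt (Model n) p).source) {u : Model n} (hu : u ≠ 0)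
    (a b : Model n) : fibreHess S.L m u a b =
      fderiv ℝ (fderiv ℝ (Function.uncurry (S.localL p))) (bundleChart n p (⟨m, u⟩ : TM n M))
        (0, coordMap p m a) (0, coordMap p m b) := by
  set ℓ := Function.uncurry (S.localL p) with hℓ
  set B : Model n →L[ℝ] Model n := coordMap p m with hB
  set x := chartAt (Model n) p m with hx
  have hmem : ∀ v : Model n, v ≠ 0 → ((x, B v) : Model n × Model n) ∈ slitDomain n p := fun v hv =>
    ⟨(chartAt (Model n) p).map_source hm, coordMap_ne_zero hm hv⟩
  have hsm : ∀ v : Model n, v ≠ 0 → ContDiffAt ℝ ∞ ℓ (x, B v) := fun v hv =>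
    (S.contDiffOn_localL p).contDiffAt ((isOpen_slitDomain p).mem_nhds (hmem v hv))
  have hf : (fun v : Model n => S.L ⟨m, v⟩) = fun v => ℓ (x, B v) := by
    funext v
    exact (S.localL_bundleChart (p := p) (w := ⟨m, v⟩) hm).symm
  have hin : ∀ v : Model n, HasFDerivAt (fun v : Model n => (x, B v))
      ((ContinuousLinearMap.inr ℝ (Model n) (Model n)).comp B) v := fun v =>
    (hasFDerivAt_prodMk_right x (B v)).comp v B.hasFDerivAt
  have h1 : ∀ v : Model n, v ≠ 0 → fderiv ℝ (fun v : Model n => S.L ⟨m, v⟩) v =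
      (fderiv ℝ ℓ (x, B v)).comp ((ContinuousLinearMap.inr ℝ (Model n) (Model n)).comp B) :=
    fun v hv => by
      rw [hf]
      exact (((hsm v hv).differentiableAt ne_zero_infty).hasFDerivAt.comp v (hin v)).fderiv
  have h2 : ContDiffAt ℝ ∞ (fderiv ℝ ℓ) (x, B u) := (hsm u hu).fderiv_right le_rfl
  have h3 := (h2.differentiableAt ne_zero_infty).hasFDerivAt.comp u (hin u)
  have h4 : fderiv ℝ (fun v : Model n => S.L ⟨m, v⟩) =ᶠ[𝓝 u] fun v =>
      (fderiv ℝ ℓ (x, B v)).comp ((ContinuousLinearMap.inr ℝ (Model n) (Model n)).comp B) := by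
    filter_upwards [isOpen_ne.mem_nhds hu] with v hv
    exact h1 v hv
  have h5 := (h3.clm_comp (hasFDerivAt_const ((ContinuousLinearMap.inr ℝ (Model n) (Model n)).comp B)
    u)).congr_of_eventuallyEq h4
  rw [fibreHess, h5.fderiv]
  simp [bundleChart_apply, ← hx, ← hB]

/-- The Lagrangian in the bundle chart at `p`. -/
def lagrangeChart (p : M) : LagrangeChart (Model n) where
  W := slitDomain n p
  isOpen_W := isOpen_slitDomain p
  ℓ := Function.uncurry (S.localL p)
  smooth_ℓ := S.contDiffOn_localL p
  euler := fun _ hx => S.euler_localL hx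
  nondeg := fun x hx y hy => by
    obtain ⟨m, u, hm, -, h1, h2⟩ := exists_bundleChart_eq (p := p) hx.1
    have hu : u ≠ 0 := by
      rintro rfl
      exact hx.2 ((map_zero _).symm.trans h2).symm
    obtain ⟨a, rfl⟩ := (coordMap_bijective hm).2 y
    have hB := S.fibreHess_eq hm hu a
    have e : bundleChart n p (⟨m, u⟩ : TM n M) = x := by
      rw [bundleChart_apply]
      exact Prod.ext h1 h2
    simp only [e, hy] at hB
    obtain ⟨β, hβ⟩ := S.lorentzian m u hu
    have ha : a = 0 := by
      rw [← β.sum_repr a]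
      refine Finset.sum_eq_zero fun j _ => ?_
      have h3 : fibreHess S.L m u a (β j) = β.repr a j * (if j = 0 then -1 else 1) := by
        conv_lhs => rw [← β.sum_repr a]
        simp only [fibreHess, map_sum, map_smul, _root_.sum_apply, smul_apply, smul_eq_mul]
        simp only [fibreHess] at hβ
        simp [hβ]
      rw [hB] at h3
      have h4 : β.repr a j = 0 := by
        by_cases hj : j = 0 <;> simpa [hj] using h3.symm
      rw [h4, zero_smul]
    rw [ha, map_zero]

lemma isLagrangianOf_lagrangeChart (p : M) : IsLagrangianOf (S.localL p) (S.lagrangeChart p) := rfl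

/-- The Lagrangian and the geodesic spray in the bundle chart at `p`. -/
def sprayChart (p : M) : SprayChart (Model n) := 
  coordSpray (S.localL p) (S.lagrangeChart p) (S.isLagrangianOf_lagrangeChart p)

lemma bundleChart_mem_W (hm : m ∈ (chartAt (Model n) p).source) {u : Model n} (hu : u ≠ 0) :
    bundleChart n p (⟨m, u⟩ : TM n M) ∈ (S.sprayChart p).W :=
  ⟨(chartAt (Model n) p).map_source hm, coordMap_ne_zero hm hu⟩

lemma fibreHess_eq_ℓ₂ (hm : m ∈ (chartAt (Model n) p).source) {u : Model n} (hu : u ≠ 0)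
    (a b : Model n) : fibreHess S.L m u a b =
      (S.sprayChart p).ℓ₂ (bundleChart n p (⟨m, u⟩ : TM n M))
        (0, coordMap p m a) (0, coordMap p m b) :=
  S.fibreHess_eq hm hu a b

lemma tangentLift_bundleChart (hp : m ∈ (chartAt (Model n) p).source)
    (hq : m ∈ (chartAt (Model n) q).source) (u : Model n) :
    tangentLift (transition p q) (bundleChart n p (⟨m, u⟩ : TM n M)) =
      bundleChart n q (⟨m, u⟩ : TM n M) := by
  rw [bundleChart_apply, bundleChart_apply, tangentLift]
  refine Prod.ext ?_ (fderiv_transition hp hq u)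
  exact congrArg (chartAt (Model n) q) ((chartAt (Model n) p).left_inv hp)

/-- The points whose base point lies in both coordinate domains are transition points. -/
lemma eventually_isTransition (hp : m ∈ (chartAt (Model n) p).source)
    (hq : m ∈ (chartAt (Model n) q).source) {u : Model n} (hu : u ≠ 0) :
    ∀ᶠ x in 𝓝 (bundleChart n p (⟨m, u⟩ : TM n M)),
      IsTransition (S.sprayChart p) (S.sprayChart q) (transition p q) x := by
  set U : Set (Model n × Model n) :=
    ((chartAt (Model n) p).target ∩ (chartAt (Model n) p).symm ⁻¹' (chartAt (Model n) q).source) ×ˢ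
      {0}ᶜ with hU
  have hUo : IsOpen U :=
    ((chartAt (Model n) p).isOpen_inter_preimage_symm (chartAt (Model n) q).open_source).prod
      isOpen_compl_singleton
  have key : ∀ x ∈ U, ∃ (m : M) (u : Model n), m ∈ (chartAt (Model n) p).source ∧
      m ∈ (chartAt (Model n) q).source ∧ u ≠ 0 ∧ bundleChart n p (⟨m, u⟩ : TM n M) = x := by
    rintro x ⟨⟨hx1, hx2⟩, hx0⟩
    obtain ⟨m, u, hm, -, h1, h2⟩ := exists_bundleChart_eq (p := p) hx1
    refine ⟨m, u, hm, ?_, ?_, Prod.ext h1 h2⟩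
    · rw [mem_preimage, ← h1, (chartAt (Model n) p).left_inv hm] at hx2
      exact hx2
    · rintro rfl
      exact hx0 ((map_zero _).symm.trans h2).symm
  have hmem : bundleChart n p (⟨m, u⟩ : TM n M) ∈ U := by
    refine ⟨⟨(chartAt (Model n) p).map_source hp, ?_⟩, coordMap_ne_zero hp hu⟩
    change (chartAt (Model n) p).symm (chartAt (Model n) p m) ∈ (chartAt (Model n) q).source
    rw [(chartAt (Model n) p).left_inv hp]
    exact hq
  filter_upwards [hUo.mem_nhds hmem] with x hx
  obtain ⟨m', u', hp', hq', hu', rfl⟩ := key x hx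
  refine ⟨S.bundleChart_mem_W hp' hu', ?_, ?_, ?_, ?_⟩
  · rw [tangentLift_bundleChart hp' hq']
    exact S.bundleChart_mem_W hq' hu'
  · refine contDiffAt_transition ((chartAt (Model n) p).map_source hp') ?_
    change (chartAt (Model n) p).symm (chartAt (Model n) p m') ∈ (chartAt (Model n) q).source
    rw [(chartAt (Model n) p).left_inv hp']
    exact hq'
  · intro y
    obtain ⟨z, rfl⟩ := (coordMap_bijective hq').2 y
    exact ⟨_, fderiv_transition hp' hq' z⟩
  · filter_upwards [hUo.mem_nhds hx] with x' hx'
    obtain ⟨m'', u'', hp'', hq'', -, rfl⟩ := key x' hx'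
    rw [tangentLift_bundleChart hp'' hq'']
    exact (S.localL_bundleChart (w := ⟨m'', u''⟩) hp'').trans
      (S.localL_bundleChart (w := ⟨m'', u''⟩) hq'').symm

end LorentzFinsler

end Charts

/-! ### Geodesics in bundle charts -/

section Geodesics

open LagrangeChart SprayChart

variable {n : ℕ} {M : Type*} [TopologicalSpace M] [ChartedSpace (Model n) M]
  {η : ℝ → M} {t : ℝ}

lemma velocity_eq_deriv (hd : MDifferentiableAt 𝓘(ℝ, ℝ) 𝓘(ℝ, Model n) η t) :
    velocity n η t = deriv (fun s => chartAt (Model n) (η t) (η s)) t := by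
  refine (congrArg (fun f : ℝ →L[ℝ] Model n => f 1) hd.mfderiv).trans ?_
  simp only [mfld_simps, fderivWithin_univ]
  rfl

variable [IsManifold 𝓘(ℝ, Model n) ∞ M] {p q m : M} {S : LorentzFinsler n M} {I : Set ℝ}

/-- A smooth solution of the geodesic equation whose velocity has no zeros. -/
structure LorentzFinsler.IsGeodesic (S : LorentzFinsler n M) (I : Set ℝ) (η : ℝ → M) : Prop where
  interval : IsOpenInterval I
  smooth : ContMDiffOn 𝓘(ℝ, ℝ) 𝓘(ℝ, Model n) ∞ η I
  velocity_ne_zero : ∀ t ∈ I, (velocity n η t : Model n) ≠ 0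
  geodesic : ∀ t ∈ I, S.GeodesicEqAt η t

/-- The lift of a curve to `TM`, in the bundle chart at `p`. -/
def chartLift (n : ℕ) {M : Type*} [TopologicalSpace M] [ChartedSpace (Model n) M]
    [IsManifold 𝓘(ℝ, Model n) ∞ M] (η : ℝ → M) (p : M) (t : ℝ) : Model n × Model n :=
  bundleChart n p (lift n η t)

namespace LorentzFinsler.IsGeodesic

lemma chartLift_self (η : ℝ → M) (t : ℝ) :
    chartLift n η (η t) t = (chartAt (Model n) (η t) (η t), velocity n η t) := by
  rw [chartLift, bundleChart_apply]
  exact Prod.ext rfl (coordMap_self _ _)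

lemma contMDiffAt (hη : S.IsGeodesic I η) (ht : t ∈ I) : ContMDiffAt 𝓘(ℝ, ℝ) 𝓘(ℝ, Model n) ∞ η t :=
  hη.smooth.contMDiffAt (IsOpen.mem_nhds hη.interval.1 ht)

lemma eventually_mem_source (hη : S.IsGeodesic I η) (ht : t ∈ I) (hp : η t ∈ (chartAt (Model n) p).source) :
    ∀ᶠ s in 𝓝 t, s ∈ I ∧ η s ∈ (chartAt (Model n) p).source :=
  Filter.Eventually.and (IsOpen.mem_nhds hη.interval.1 ht) ((hη.contMDiffAt ht).continuousAt.eventually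
    ((chartAt (Model n) p).open_source.mem_nhds hp))

lemma contDiffAt_chart (hη : S.IsGeodesic I η) (ht : t ∈ I) (hp : η t ∈ (chartAt (Model n) p).source) :
    ContDiffAt ℝ ∞ (fun s => chartAt (Model n) p (η s)) t :=
  ((contMDiffAt_extChartAt' (I := 𝓘(ℝ, Model n)) hp).comp t (hη.contMDiffAt ht)).contDiffAt

lemma coordMap_velocity (hη : S.IsGeodesic I η) (ht : t ∈ I) (hp : η t ∈ (chartAt (Model n) p).source) :
    coordMap p (η t) (velocity n η t) = deriv (fun s => chartAt (Model n) p (η s)) t := by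
  have hs := mem_chart_source (Model n) (η t)
  have hv := velocity_eq_deriv ((hη.contMDiffAt ht).mdifferentiableAt ne_zero_infty)
  have h1 := ((hη.contDiffAt_chart ht hs).differentiableAt ne_zero_infty).hasDerivAt
  have h2 : ContDiffAt ℝ ∞ (transition (η t) p) (chartAt (Model n) (η t) (η t)) :=
    contDiffAt_transition ((chartAt (Model n) (η t)).map_source hs)
      (by rw [(chartAt (Model n) (η t)).left_inv hs]; exact hp)
  have h3 := HasFDerivAt.comp_hasDerivAt (f := fun s => chartAt (Model n) (η t) (η s)) t
    (h2.differentiableAt ne_zero_infty).hasFDerivAt h1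
  have h4 : (fun s => chartAt (Model n) p (η s)) =ᶠ[𝓝 t]
      transition (η t) p ∘ fun s => chartAt (Model n) (η t) (η s) := by
    filter_upwards [hη.eventually_mem_source ht hs] with s hs'
    exact congrArg (chartAt (Model n) p) ((chartAt (Model n) (η t)).left_inv hs'.2).symm
  rw [(h3.congr_of_eventuallyEq h4).deriv]
  exact (fderiv_transition hs hp (velocity n η t)).symm.trans
    (congrArg _ ((coordMap_self _ _).trans hv))

lemma chartLift_eq (hη : S.IsGeodesic I η) (ht : t ∈ I) (hp : η t ∈ (chartAt (Model n) p).source) :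
    chartLift n η p t = (chartAt (Model n) p (η t), deriv (fun s => chartAt (Model n) p (η s)) t) :=
  Prod.ext rfl (hη.coordMap_velocity ht hp)

lemma chartLift_mem_W (hη : S.IsGeodesic I η) (ht : t ∈ I) (hp : η t ∈ (chartAt (Model n) p).source) :
    chartLift n η p t ∈ (S.sprayChart p).W :=
  S.bundleChart_mem_W hp (hη.velocity_ne_zero t ht)

lemma chartLift_eventuallyEq (hη : S.IsGeodesic I η) (ht : t ∈ I) (hp : η t ∈ (chartAt (Model n) p).source) :
    chartLift n η p =ᶠ[𝓝 t]
      fun t => (chartAt (Model n) p (η t), deriv (fun s => chartAt (Model n) p (η s)) t) := by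
  filter_upwards [hη.eventually_mem_source ht hp] with s hs
  exact hη.chartLift_eq hs.1 hs.2

lemma contDiffAt_chartLift (hη : S.IsGeodesic I η) (ht : t ∈ I) (hp : η t ∈ (chartAt (Model n) p).source) :
    ContDiffAt ℝ ∞ (chartLift n η p) t := by
  refine ContDiffAt.congr_of_eventuallyEq ?_ (hη.chartLift_eventuallyEq ht hp)
  have h1 : ContDiffAt ℝ ∞ (fderiv ℝ fun s => chartAt (Model n) p (η s)) t :=
    (hη.contDiffAt_chart ht hp).fderiv_right le_rfl
  exact (hη.contDiffAt_chart ht hp).prodMk (h1.clm_apply contDiffAt_const)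

/-- In every bundle chart, the lift of a geodesic is an integral curve of the spray. -/
lemma hasDerivAt_chartLift (hη : S.IsGeodesic I η) (ht : t ∈ I) (hp : η t ∈ (chartAt (Model n) p).source) :
    HasDerivAt (chartLift n η p) ((S.sprayChart p).F (chartLift n η p t)) t := by
  set c : ℝ → Model n := fun s => chartAt (Model n) p (η s) with hc
  have h0 := hη.contDiffAt_chart ht hp
  have h1 : ContDiffAt ℝ ∞ (fderiv ℝ c) t := h0.fderiv_right le_rfl
  have h2 : ContDiffAt ℝ ∞ (deriv c) t := h1.clm_apply contDiffAt_const
  have h3 := (h0.differentiableAt ne_zero_infty).hasDerivAt.prodMk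
    (h2.differentiableAt ne_zero_infty).hasDerivAt
  refine (h3.congr_of_eventuallyEq (hη.chartLift_eventuallyEq ht hp)).congr_deriv ?_
  rw [hη.chartLift_eq ht hp]
  refine Prod.ext rfl ?_
  ext α
  have h4 := hη.geodesic t ht p hp α
  have h5 : (sprayVec (S.localL p) (c t, deriv c t)) α = _ := sprayVec_apply α
  change deriv (deriv c) t α = (-(2 : ℝ) • sprayVec (S.localL p) (c t, deriv c t)) α
  rw [PiLp.smul_apply, h5, sprayCoeff, smul_eq_mul]
  simp only at h4
  linarith

lemma eventually_hasDerivAt_chartLift (hη : S.IsGeodesic I η) (ht : t ∈ I) (hp : η t ∈ (chartAt (Model n) p).source) :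
    ∀ᶠ s in 𝓝 t, HasDerivAt (chartLift n η p) ((S.sprayChart p).F (chartLift n η p s)) s := by
  filter_upwards [hη.eventually_mem_source ht hp] with s hs
  exact hη.hasDerivAt_chartLift hs.1 hs.2

lemma eventually_isTransition (hη : S.IsGeodesic I η) (ht : t ∈ I) (hp : η t ∈ (chartAt (Model n) p).source)
    (hq : η t ∈ (chartAt (Model n) q).source) : ∀ᶠ x in 𝓝 (chartLift n η p t),
      IsTransition (S.sprayChart p) (S.sprayChart q) (transition p q) x :=
  S.eventually_isTransition hp hq (hη.velocity_ne_zero t ht)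

/-- A vector field along `η` that is smooth in bundle charts is smooth. -/
lemma contMDiffAt_of_coordMap (hη : S.IsGeodesic I η) {Y : ∀ t, TangentSpace 𝓘(ℝ, Model n) (η t)} (ht : t ∈ I)
    (hp : η t ∈ (chartAt (Model n) p).source)
    (hY : ContDiffAt ℝ ∞ (fun s => coordMap p (η s) (Y s)) t) :
    ContMDiffAt 𝓘(ℝ, ℝ) 𝓘(ℝ, Model n).tangent ∞ (fun s => (⟨η s, Y s⟩ : TM n M)) t := by
  have h1 : ContMDiffOn 𝓘(ℝ, Model n × Model n) 𝓘(ℝ, Model n).tangent ∞ (bundleChart n p).symm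
      (bundleChart n p).target :=
    contMDiffOn_extChartAt_symm (I := 𝓘(ℝ, Model n).tangent) (⟨p, 0⟩ : TM n M)
  have h2 : ContDiffAt ℝ ∞ (fun s => bundleChart n p (⟨η s, Y s⟩ : TM n M)) t :=
    (hη.contDiffAt_chart ht hp).prodMk hY
  have hmem : bundleChart n p (⟨η t, Y t⟩ : TM n M) ∈ (bundleChart n p : PartialEquiv (TM n M) _).target :=
    (bundleChart n p).map_source (by rw [bundleChart_source]; exact hp)
  have hopen : IsOpen (bundleChart n p : PartialEquiv (TM n M) _).target := by
    rw [bundleChart_target]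
    exact (chartAt (Model n) p).open_target.prod isOpen_univ
  have h3 := (h1.contMDiffAt (hopen.mem_nhds hmem)).comp t h2.contMDiffAt
  refine h3.congr_of_eventuallyEq ?_
  filter_upwards [hη.eventually_mem_source ht hp] with s hs
  exact ((bundleChart n p).left_inv (by rw [bundleChart_source]; exact hs.2)).symm

lemma contMDiffAt_lift (hη : S.IsGeodesic I η) (ht : t ∈ I) :
    ContMDiffAt 𝓘(ℝ, ℝ) 𝓘(ℝ, Model n).tangent ∞ (lift n η) t :=
  hη.contMDiffAt_of_coordMap ht (mem_chart_source (Model n) (η t))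
    (hη.contDiffAt_chartLift ht (mem_chart_source (Model n) (η t))).snd

end LorentzFinsler.IsGeodesic

end Geodesics

/-! ### Parallel frames along a geodesic -/

section Frames

open LagrangeChart SprayChart

/-- A family of parallel fields is parallel in every chart. -/
lemma SprayChart.IsTransition.parallel_clm {E V : Type*} [NormedAddCommGroup E] [NormedSpace ℝ E]
    [NormedAddCommGroup V] [NormedSpace ℝ V] {C C' : SprayChart E} {φ : E → E} {γ : ℝ → E × E} {t : ℝ}
    (h : ∀ᶠ q' in 𝓝 (γ t), IsTransition C C' φ q')
    (hγ : HasDerivAt γ (C.F (γ t)) t) {B : ℝ → V →L[ℝ] E}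
    (hB : HasDerivAt B (-(C.N (γ t)).comp (B t)) t) :
    HasDerivAt (fun s => (fderiv ℝ φ (γ s).1).comp (B s))
      (-(C'.N (tangentLift φ (γ t))).comp ((fderiv ℝ φ (γ t).1).comp (B t))) t := by
  have hq := h.self_of_nhds
  refine ((hasDerivAt_phi₁ hq.smooth hγ).clm_comp hB).congr_deriv ?_
  ext x
  simp only [add_apply, neg_apply, ContinuousLinearMap.comp_apply, ContinuousLinearMap.comp_neg]
  rw [IsTransition.N_eq h, phi₂_symm hq.smooth (B t x)]
  simp only [F]
  abel

lemma contDiffAt_neg_compL {E : Type*} [NormedAddCommGroup E] [NormedSpace ℝ E] {A : ℝ → E →L[ℝ] E}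
    {t : ℝ} (hA : ContDiffAt ℝ ∞ A t) :
    ContDiffAt ℝ ∞ (fun s => -(ContinuousLinearMap.compL ℝ E E E (A s))) t :=
  ((ContinuousLinearMap.compL ℝ E E E).contDiff.contDiffAt.comp t hA).neg

variable {n : ℕ} {M : Type*} [TopologicalSpace M] [ChartedSpace (Model n) M]
  [IsManifold 𝓘(ℝ, Model n) ∞ M] {p q m : M} {S : LorentzFinsler n M} {I : Set ℝ} {η : ℝ → M}
  {t : ℝ} {E : ℝ → Model n →L[ℝ] Model n}

/-- A linear family `E t : ℝⁿ⁺¹ → T_{η(t)}M`, in the bundle chart at `p`. -/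
def chartFrame (η : ℝ → M) (E : ℝ → Model n →L[ℝ] Model n) (p : M) (t : ℝ) : Model n →L[ℝ] Model n :=
  (coordMap p (η t)).comp (E t)

/-- The equation of parallel translation for a frame `E` at the parameter `t`, in the bundle chart
at `p`. -/
def LorentzFinsler.ParallelInChart (S : LorentzFinsler n M) (η : ℝ → M)
    (E : ℝ → Model n →L[ℝ] Model n) (p : M) (t : ℝ) : Prop :=
  HasDerivAt (chartFrame η E p)
    (-((S.sprayChart p).N (chartLift n η p t)).comp (chartFrame η E p t)) t

/-- The frame `E` along `η` is parallel at the parameter `t`. -/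
def LorentzFinsler.ParallelAt (S : LorentzFinsler n M) (η : ℝ → M)
    (E : ℝ → Model n →L[ℝ] Model n) (t : ℝ) : Prop :=
  ∀ p : M, η t ∈ (chartAt (Model n) p).source → S.ParallelInChart η E p t

/-- The endomorphism `R_{η̇(t)}` of `T_{η(t)}M`. -/
def LorentzFinsler.curvOp (S : LorentzFinsler n M) (η : ℝ → M) (t : ℝ) : Model n →L[ℝ] Model n :=
  (S.sprayChart (η t)).R (chartLift n η (η t) t)

/-- The inverse of `coordMap p m`. -/
def coordMapInv (p m : M) : Model n →L[ℝ] Model n := tangentCoordChange 𝓘(ℝ, Model n) p m m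

lemma coordMapInv_coordMap (hm : m ∈ (chartAt (Model n) p).source) (y : Model n) :
    coordMapInv p m (coordMap p m y) = y := by
  have h := tangentCoordChange_comp (I := 𝓘(ℝ, Model n)) (w := m) (x := p) (y := m) (z := m) (v := y)
    ⟨⟨mem_extChartAt_source m, by simpa using hm⟩, mem_extChartAt_source m⟩
  exact h.trans (coordMap_self m y)

lemma coordMap_coordMapInv (hm : m ∈ (chartAt (Model n) p).source) (y : Model n) :
    coordMap p m (coordMapInv p m y) = y := by
  obtain ⟨z, rfl⟩ := (coordMap_bijective hm).2 y
  rw [coordMapInv_coordMap hm]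

namespace LorentzFinsler.IsGeodesic

lemma chartFrame_eventuallyEq (hη : S.IsGeodesic I η) (E : ℝ → Model n →L[ℝ] Model n) (ht : t ∈ I)
    (hp : η t ∈ (chartAt (Model n) p).source) (hq : η t ∈ (chartAt (Model n) q).source) :
    chartFrame η E q =ᶠ[𝓝 t] fun s =>
      (fderiv ℝ (transition p q) (chartLift n η p s).1).comp (chartFrame η E p s) := by
  filter_upwards [hη.eventually_mem_source ht hp, hη.eventually_mem_source ht hq] with s hs hs'
  ext1 y
  exact (fderiv_transition hs.2 hs'.2 (E s y)).symm

/-- The equation of parallel translation does not depend on the chart. -/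
lemma parallelAt_of_chart (hη : S.IsGeodesic I η) (ht : t ∈ I)
    (hp : η t ∈ (chartAt (Model n) p).source) (h : S.ParallelInChart η E p t) :
    S.ParallelAt η E t := by
  intro q hq
  have h1 := IsTransition.parallel_clm (hη.eventually_isTransition ht hp hq)
    (hη.hasDerivAt_chartLift ht hp) h
  have h2 := hη.chartFrame_eventuallyEq E ht hp hq
  refine (h1.congr_of_eventuallyEq h2).congr_deriv ?_
  have h3 : tangentLift (transition p q) (chartLift n η p t) = chartLift n η q t :=
    tangentLift_bundleChart hp hq _
  rw [h2.self_of_nhds, h3]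

/-- Around every parameter there is an interval that `η` maps to the domain of a given chart. -/
lemma exists_interval (hη : S.IsGeodesic I η) (ht : t ∈ I)
    (hp : η t ∈ (chartAt (Model n) p).source) :
    ∃ J : Set ℝ, IsOpenInterval J ∧ t ∈ J ∧ J ⊆ I ∧ ∀ s ∈ J, η s ∈ (chartAt (Model n) p).source := by
  obtain ⟨δ, hδ, h⟩ := Metric.eventually_nhds_iff_ball.1 (hη.eventually_mem_source ht hp)
  rw [Real.ball_eq_Ioo] at h
  exact ⟨Ioo (t - δ) (t + δ), ⟨isOpen_Ioo, ordConnected_Ioo, ⟨t, by constructor <;> linarith⟩⟩,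
    by constructor <;> linarith, fun s hs => (h s hs).1, fun s hs => (h s hs).2⟩

/-- The coefficient of the equation of parallel translation, acting on frames. -/
def _root_.FinslerST.LorentzFinsler.transportOp (S : LorentzFinsler n M) (η : ℝ → M) (p : M) (t : ℝ) :
    (Model n →L[ℝ] Model n) →L[ℝ] Model n →L[ℝ] Model n :=
  -(ContinuousLinearMap.compL ℝ (Model n) (Model n) (Model n)
    ((S.sprayChart p).N (chartLift n η p t)))

lemma contDiffAt_transportOp (hη : S.IsGeodesic I η) (ht : t ∈ I)
    (hp : η t ∈ (chartAt (Model n) p).source) : ContDiffAt ℝ ∞ (S.transportOp η p) t :=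
  contDiffAt_neg_compL ((contDiffAt_N (hη.chartLift_mem_W ht hp)).comp t
    (hη.contDiffAt_chartLift ht hp))

/-- Every frame at one point of a geodesic extends to a parallel frame. -/
lemma exists_parallel (hη : S.IsGeodesic I η) {t₀ : ℝ} (ht₀ : t₀ ∈ I)
    (E₀ : Model n →L[ℝ] Model n) : ∃ E : ℝ → Model n →L[ℝ] Model n, E t₀ = E₀ ∧
      ∀ t ∈ I, S.ParallelAt η E t := by
  refine (exists_global_of_local (S.ParallelAt η) ?_ hη.interval fun t ht => ?_).1 t₀ ht₀ E₀
  · intro f g t hfg h p hp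
    have h1 : chartFrame η f p =ᶠ[𝓝 t] chartFrame η g p := by
      filter_upwards [hfg] with s hs
      rw [chartFrame, chartFrame, hs]
    have h2 := (h p hp).congr_of_eventuallyEq h1.symm
    rwa [h1.self_of_nhds] at h2
  · have hp := mem_chart_source (Model n) (η t)
    set p := η t
    obtain ⟨J, hJ, htJ, hJI, hJs⟩ := hη.exists_interval ht hp
    have hA : ContinuousOn (S.transportOp η p) J := fun s hs =>
      (hη.contDiffAt_transportOp (hJI hs) (hJs s hs)).continuousAt.continuousWithinAt
    obtain ⟨hex, huniq⟩ := linearODE (S.transportOp η p) hJ hA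
    refine ⟨J, hJ.1, hJ.2.1, htJ, hJI, fun s hs x => ?_, ?_⟩
    · obtain ⟨B, hB0, hB⟩ := hex s hs ((coordMap p (η s)).comp x)
      refine ⟨fun r => (coordMapInv p (η r)).comp (B r), ?_, fun r hr => ?_⟩
      · simp only [hB0]
        ext1 y
        exact coordMapInv_coordMap (hJs s hs) (x y)
      · refine hη.parallelAt_of_chart (hJI hr) (hJs r hr) ?_
        have h1 : ∀ r ∈ J, chartFrame η (fun r => (coordMapInv p (η r)).comp (B r)) p r = B r :=
          fun r hr => by
            ext1 y
            exact coordMap_coordMapInv (hJs r hr) (B r y)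
        have h2 : chartFrame η (fun r => (coordMapInv p (η r)).comp (B r)) p =ᶠ[𝓝 r] B := by
          filter_upwards [hJ.1.mem_nhds hr] with r' hr'
          exact h1 r' hr'
        rw [ParallelInChart, h1 r hr]
        exact (hB r hr).congr_of_eventuallyEq h2
    · intro f g K hKJ hKo hKc hf hg s hs hfg r hr
      have h1 := huniq (chartFrame η f p) (chartFrame η g p) K hKJ hKo hKc
        (fun r hr => hf r hr p (hJs r (hKJ hr))) (fun r hr => hg r hr p (hJs r (hKJ hr))) s hs
        (by rw [chartFrame, chartFrame, hfg]) r hr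
      ext1 y
      exact (coordMap_bijective (hJs r (hKJ hr))).1 (DFunLike.congr_fun h1 y)

lemma contDiffAt_chartFrame (hη : S.IsGeodesic I η) (hE : ∀ t ∈ I, S.ParallelAt η E t) (ht : t ∈ I)
    (hp : η t ∈ (chartAt (Model n) p).source) : ContDiffAt ℝ ∞ (chartFrame η E p) t := by
  obtain ⟨J, hJ, htJ, hJI, hJs⟩ := hη.exists_interval ht hp
  have hA : ContDiffOn ℝ ∞ (S.transportOp η p) J := fun s hs =>
    (hη.contDiffAt_transportOp (hJI hs) (hJs s hs)).contDiffWithinAt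
  exact (contDiffOn_of_linearODE hJ.1 hA fun r hr => hE r (hJI hr) p (hJs r hr)).contDiffAt
    (hJ.1.mem_nhds htJ)

/-- The columns of a parallel frame are parallel fields. -/
lemma hasDerivAt_chartFrame_apply (hE : ∀ t ∈ I, S.ParallelAt η E t) (ht : t ∈ I)
    (hp : η t ∈ (chartAt (Model n) p).source) (y : Model n) :
    HasDerivAt (fun s => chartFrame η E p s y)
      (-(S.sprayChart p).N (chartLift n η p t) (chartFrame η E p t y)) t := by
  have h : HasDerivAt (chartFrame η E p) _ t := hE t ht p hp
  simpa using h.clm_apply (hasDerivAt_const t y)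

lemma eventually_hasDerivAt_chartFrame_apply (hη : S.IsGeodesic I η)
    (hE : ∀ t ∈ I, S.ParallelAt η E t) (ht : t ∈ I)
    (hp : η t ∈ (chartAt (Model n) p).source) (y : Model n) :
    ∀ᶠ s in 𝓝 t, HasDerivAt (fun s => chartFrame η E p s y)
      (-(S.sprayChart p).N (chartLift n η p s) (chartFrame η E p s y)) s := by
  filter_upwards [hη.eventually_mem_source ht hp] with s hs
  exact hasDerivAt_chartFrame_apply hE hs.1 hs.2 y

lemma chartFrame_self (η : ℝ → M) (E : ℝ → Model n →L[ℝ] Model n) (t : ℝ) :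
    chartFrame η E (η t) t = E t := by
  ext1 y
  exact coordMap_self (η t) (E t y)

/-- Parallel translation preserves the metric `g_{η̇}`. -/
lemma hasDerivAt_fibreHess (hη : S.IsGeodesic I η) (hE : ∀ t ∈ I, S.ParallelAt η E t) (ht : t ∈ I)
    (y z : Model n) :
    HasDerivAt (fun s => fibreHess S.L (η s) (velocity n η s) (E s y) (E s z)) 0 t := by
  have hp := mem_chart_source (Model n) (η t)
  refine (hasDerivAt_g_parallel (hη.chartLift_mem_W ht hp) (hη.hasDerivAt_chartLift ht hp)
    (hasDerivAt_chartFrame_apply hE ht hp y)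
    (hasDerivAt_chartFrame_apply hE ht hp z)).congr_of_eventuallyEq ?_
  filter_upwards [hη.eventually_mem_source ht hp] with s hs
  exact S.fibreHess_eq_ℓ₂ hs.2 (hη.velocity_ne_zero s hs.1) _ _

/-- The scalar product of a parallel field with the velocity is constant. -/
lemma hasDerivAt_fibreHess_velocity (hη : S.IsGeodesic I η) (hE : ∀ t ∈ I, S.ParallelAt η E t)
    (ht : t ∈ I) (y : Model n) :
    HasDerivAt (fun s => fibreHess S.L (η s) (velocity n η s) (E s y) (velocity n η s)) 0 t := by
  have hp := mem_chart_source (Model n) (η t)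
  refine (hasDerivAt_g_parallel (hη.chartLift_mem_W ht hp) (hη.hasDerivAt_chartLift ht hp)
    (hasDerivAt_chartFrame_apply hE ht hp y)
    (hasDerivAt_velocity (hη.chartLift_mem_W ht hp)
      (hη.hasDerivAt_chartLift ht hp))).congr_of_eventuallyEq ?_
  filter_upwards [hη.eventually_mem_source ht hp] with s hs
  exact S.fibreHess_eq_ℓ₂ hs.2 (hη.velocity_ne_zero s hs.1) _ _

/-- The curvature in an arbitrary chart. -/
lemma curvOp_chart (hη : S.IsGeodesic I η) (hE : ∀ t ∈ I, S.ParallelAt η E t) (ht : t ∈ I)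
    (hp : η t ∈ (chartAt (Model n) p).source) (y : Model n) :
    (S.sprayChart p).R (chartLift n η p t) (chartFrame η E p t y) =
      coordMap p (η t) (S.curvOp η t (E t y)) := by
  have hs := mem_chart_source (Model n) (η t)
  have h := IsTransition.R_eq (hη.eventually_isTransition ht hs hp)
    (hη.eventually_hasDerivAt_chartLift ht hs)
    (hη.eventually_hasDerivAt_chartFrame_apply hE ht hs y)
  rw [chartFrame_self] at h
  have h1 : tangentLift (transition (η t) p) (chartLift n η (η t) t) = chartLift n η p t :=
    tangentLift_bundleChart hs hp _
  have h2 : ∀ z, fderiv ℝ (transition (η t) p) (chartLift n η (η t) t).1 z = coordMap p (η t) z :=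
    fun z => (congrArg _ (coordMap_self (η t) z).symm).trans (fderiv_transition hs hp z)
  rw [h1, h2, h2] at h
  exact h

/-- The curvature is symmetric with respect to `g_{η̇}`. -/
lemma curvOp_symm (hη : S.IsGeodesic I η) (hE : ∀ t ∈ I, S.ParallelAt η E t) (ht : t ∈ I)
    (y z : Model n) :
    fibreHess S.L (η t) (velocity n η t) (S.curvOp η t (E t y)) (E t z) =
      fibreHess S.L (η t) (velocity n η t) (E t y) (S.curvOp η t (E t z)) := by
  have hp := mem_chart_source (Model n) (η t)
  have h := R_symm ((hη.eventually_mem_source ht hp).mono fun s hs => hη.chartLift_mem_W hs.1 hs.2)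
    (hη.eventually_hasDerivAt_chartLift ht hp)
    (hη.eventually_hasDerivAt_chartFrame_apply hE ht hp y)
    (hη.eventually_hasDerivAt_chartFrame_apply hE ht hp z)
  rw [chartFrame_self] at h
  have h1 := fun a b => S.fibreHess_eq_ℓ₂ hp (hη.velocity_ne_zero t ht) a b
  simp only [coordMap_self] at h1
  exact (h1 _ _).trans (h.trans (h1 _ _).symm)

lemma curvOp_velocity (hη : S.IsGeodesic I η) (ht : t ∈ I) :
    S.curvOp η t (velocity n η t) = 0 := by
  have h := R_v (hη.chartLift_mem_W ht (mem_chart_source (Model n) (η t)))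
  have h1 := chartLift_self (n := n) η t
  exact (congrArg (S.curvOp η t) (congrArg Prod.snd h1).symm).trans h

lemma curvature_eq (hη : S.IsGeodesic I η) (ht : t ∈ I) (w : Model n) :
    S.curvature (η t) (velocity n η t) w = S.curvOp η t w := by
  have h := curvTerm_eq (h := S.isLagrangianOf_lagrangeChart (η t))
    (hη.chartLift_mem_W ht (mem_chart_source (Model n) (η t))) w
  refine Eq.trans ?_ h
  rw [chartLift_self]
  rfl

lemma ricci_eq (hη : S.IsGeodesic I η) (ht : t ∈ I) : S.ricci (lift n η t) =
    LinearMap.trace ℝ (Model n) (S.curvOp η t : Model n →ₗ[ℝ] Model n) := by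
  have h := sum_curvCoeff_eq_trace
    (h := S.isLagrangianOf_lagrangeChart (η t))
    (hη.chartLift_mem_W ht (mem_chart_source (Model n) (η t)))
  refine Eq.trans ?_ h
  rw [chartLift_self]
  rfl

/-- The covariant derivative of a field given by its components in a parallel frame. -/
lemma covDeriv_eq (hη : S.IsGeodesic I η) (hE : ∀ t ∈ I, S.ParallelAt η E t) (ht : t ∈ I)
    {Y : ∀ t, TangentSpace 𝓘(ℝ, Model n) (η t)} {y : ℝ → Model n} {y' : Model n}
    (hY : ∀ᶠ s in 𝓝 t, Y s = E s (y s)) (hy : HasDerivAt y y' t) :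
    S.covDeriv η Y t = E t y' := by
  have hp := mem_chart_source (Model n) (η t)
  have h1 : HasDerivAt (chartFrame η E (η t)) _ t := hE t ht _ hp
  have h2 := h1.clm_apply hy
  have h3 : (fun s => (bundleChart n (η t) ⟨η s, Y s⟩).2) =ᶠ[𝓝 t]
      fun s => chartFrame η E (η t) s (y s) := by
    filter_upwards [hY] with s hs
    exact congrArg (coordMap (η t) (η s)) hs
  have h4 := chernTerm_eq (h := S.isLagrangianOf_lagrangeChart (η t))
    (hη.chartLift_mem_W ht hp) (E t (y t))
  have h5 : chernTerm (S.localL (η t)) (chartAt (Model n) (η t) (η t)) (velocity n η t) (Y t) =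
      (S.sprayChart (η t)).N (chartLift n η (η t) t) (E t (y t)) := by
    refine Eq.trans ?_ h4
    rw [chartLift_self]
    exact congrArg _ hY.self_of_nhds
  have h6 := (h2.congr_of_eventuallyEq h3).deriv
  rw [chartFrame_self] at h6
  exact (congrArg₂ (· + ·) h6 h5).trans (neg_add_cancel_comm (G := Model n) _ _)

end LorentzFinsler.IsGeodesic

end Frames

/-! ### The Jacobi equation in a parallel frame -/

section Reduction

open LagrangeChart SprayChart

variable {n : ℕ} {M : Type*} [TopologicalSpace M] [ChartedSpace (Model n) M]

lemma fibreHess_zero_left (L : TM n M → ℝ) (x : M) (v b : Model n) : fibreHess L x v 0 b = 0 := by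
  simp [fibreHess]

variable [IsManifold 𝓘(ℝ, Model n) ∞ M] {p q m : M} {S : LorentzFinsler n M} {I : Set ℝ} {η : ℝ → M}
  {t : ℝ} {E : ℝ → Model n →L[ℝ] Model n}

lemma eq_zero_of_mink_eq_zero {y : Model n} (h : ∀ z, mink n y z = 0) : y = 0 := by
  ext i
  have h1 := h (coordVec i)
  rw [mink_apply, inner_coordVec] at h1
  by_cases hi : i = 0
  · subst hi
    simp [coordVec] at h1
    simp only [PiLp.zero_apply]
    linarith
  · simpa [coordVec, Ne.symm hi] using h1

/-- A Lorentzian form is isometric to the Minkowski form. -/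
lemma IsLorentzian.exists_isometry {B : Model n →L[ℝ] Model n →L[ℝ] ℝ}
    (hB : IsLorentzian fun a b => B a b) :
    ∃ E₀ : Model n →L[ℝ] Model n, ∀ y z, B (E₀ y) (E₀ z) = mink n y z := by
  obtain ⟨b, hb⟩ := hB
  refine ⟨∑ i, (EuclideanSpace.proj i : Model n →L[ℝ] ℝ).smulRight (b i), fun y z => ?_⟩
  have e : ∀ y : Model n, (∑ i, (EuclideanSpace.proj i : Model n →L[ℝ] ℝ).smulRight (b i)) y =
      ∑ i, y i • b i := fun y => by simp [_root_.sum_apply]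
  simp only [e, map_sum, map_smul, _root_.sum_apply, smul_apply, smul_eq_mul, hb]
  rw [mink_apply, PiLp.inner_apply]
  have h1 : ∀ i, (∑ j, y j * (z i * if j = i then (if j = 0 then -1 else 1) else 0)) =
      inner ℝ (y i) (z i) - 2 * (if i = 0 then y i * z i else 0) := fun i => by
    rw [Finset.sum_eq_single i]
    · by_cases hi : i = 0
      · simp [hi]; ring
      · simp [hi]; ring
    · intro j _ hj
      simp [hj]
    · simp
  simp only [Finset.mul_sum, mul_left_comm (z _) (y _), h1, Finset.sum_sub_distrib]
  simp

namespace LorentzFinsler.IsGeodesic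

/-- Along a geodesic there is a parallel frame that is orthonormal with respect to `g_{η̇}`. -/
lemma exists_orthonormal_frame (hη : S.IsGeodesic I η) :
    ∃ E : ℝ → Model n →L[ℝ] Model n, (∀ t ∈ I, S.ParallelAt η E t) ∧ ∀ t ∈ I, ∀ y z,
      fibreHess S.L (η t) (velocity n η t) (E t y) (E t z) = mink n y z := by
  obtain ⟨t₀, ht₀⟩ := hη.interval.2.2
  obtain ⟨E₀, hE₀⟩ := IsLorentzian.exists_isometry
    (B := fderiv ℝ (fderiv ℝ fun u : Model n => S.L ⟨η t₀, u⟩) (velocity n η t₀))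
    (S.lorentzian (η t₀) (velocity n η t₀) (hη.velocity_ne_zero t₀ ht₀))
  obtain ⟨E, hE0, hE⟩ := hη.exists_parallel ht₀ E₀
  refine ⟨E, hE, fun t ht y z => ?_⟩
  rw [eq_of_hasDerivAt_zero hη.interval.1 hη.interval.2.1
    (fun t ht => hη.hasDerivAt_fibreHess hE ht y z) t ht t₀ ht₀, hE0]
  exact hE₀ y z

/-- An orthonormal frame consists of isomorphisms. -/
lemma isUnit_of_orthonormal (hEg : ∀ t ∈ I, ∀ y z,
      fibreHess S.L (η t) (velocity n η t) (E t y) (E t z) = mink n y z) (ht : t ∈ I) :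
    IsUnit (E t) := by
  have hinj : Function.Injective (E t) := (injective_iff_map_eq_zero _).2 fun y hy =>
    eq_zero_of_mink_eq_zero fun z => by
      rw [← hEg t ht, hy]
      exact fibreHess_zero_left S.L (η t) (velocity n η t) (E t z)
  rw [ContinuousLinearMap.isUnit_iff_bijective]
  exact ⟨hinj, LinearMap.injective_iff_surjective (f := (E t : Model n →ₗ[ℝ] Model n)) |>.1 hinj⟩

/-- The velocity has constant components in a parallel orthonormal frame. -/
lemma exists_velocity_components (hη : S.IsGeodesic I η) (hE : ∀ t ∈ I, S.ParallelAt η E t)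
    (hEg : ∀ t ∈ I, ∀ y z,
      fibreHess S.L (η t) (velocity n η t) (E t y) (E t z) = mink n y z) :
    ∃ v₀ : Model n, ∀ t ∈ I, E t v₀ = velocity n η t := by
  have hsurj : ∀ t ∈ I, ∃ v, E t v = velocity n η t := fun t ht =>
    (ContinuousLinearMap.isUnit_iff_bijective.1 (isUnit_of_orthonormal hEg ht)).2 _
  obtain ⟨t₀, ht₀⟩ := hη.interval.2.2
  obtain ⟨v₀, hv₀⟩ := hsurj t₀ ht₀
  refine ⟨v₀, fun t ht => ?_⟩
  obtain ⟨v, hv⟩ := hsurj t ht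
  rw [← hv]
  refine congrArg (E t) (sub_eq_zero.1 (eq_zero_of_mink_eq_zero fun y => ?_))
  have h1 := eq_of_hasDerivAt_zero hη.interval.1 hη.interval.2.1
    (fun t ht => hη.hasDerivAt_fibreHess_velocity hE ht y) t ht t₀ ht₀
  have h2 : mink n y v = mink n y v₀ := by
    rw [← hEg t ht, ← hEg t₀ ht₀, hv, hv₀]
    exact h1
  rw [map_sub, sub_apply, mink_comm v₀ y, mink_comm v y, h2, sub_self]

/-- The curvature endomorphism `R_{η̇(t)}` in the frame `E`. -/
def _root_.FinslerST.LorentzFinsler.frameCurv (S : LorentzFinsler n M) (η : ℝ → M) (E : ℝ → Model n →L[ℝ] Model n) (t : ℝ) :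
    Model n →L[ℝ] Model n :=
  Ring.inverse (E t) * (S.curvOp η t * E t)

lemma frame_frameCurv (hu : IsUnit (E t)) (y : Model n) :
    E t (S.frameCurv η E t y) = S.curvOp η t (E t y) := by
  have h : E t * S.frameCurv η E t = S.curvOp η t * E t := by
    rw [frameCurv, Ring.mul_inverse_cancel_left _ _ hu]
  exact DFunLike.congr_fun h y

lemma contDiffOn_frameCurv (hη : S.IsGeodesic I η) (hE : ∀ t ∈ I, S.ParallelAt η E t)
    (hu : ∀ t ∈ I, IsUnit (E t)) : ContDiffOn ℝ ∞ (S.frameCurv η E) I := by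
  intro t ht
  have hp := mem_chart_source (Model n) (η t)
  have hB := hη.contDiffAt_chartFrame hE ht hp
  have hR : ContDiffAt ℝ ∞ (fun s => (S.sprayChart (η t)).R (chartLift n η (η t) s)) t :=
    (contDiffAt_R (hη.chartLift_mem_W ht hp)).comp t (hη.contDiffAt_chartLift ht hp)
  have hunit : ∀ s ∈ I, η s ∈ (chartAt (Model n) (η t)).source →
      IsUnit (chartFrame η E (η t) s) := fun s hs hps => by
    rw [ContinuousLinearMap.isUnit_iff_bijective]
    exact (coordMap_bijective hps).comp (ContinuousLinearMap.isUnit_iff_bijective.1 (hu s hs))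
  obtain ⟨B₀, hB₀⟩ := hunit t ht hp
  have hinv : ContDiffAt ℝ ∞ (fun s => Ring.inverse (chartFrame η E (η t) s)) t := by
    have h := contDiffAt_ringInverse ℝ (n := ∞) B₀
    rw [hB₀] at h
    exact h.comp t hB
  refine ContDiffAt.contDiffWithinAt (ContDiffAt.congr_of_eventuallyEq
    (hinv.clm_comp (hR.clm_comp hB)) ?_)
  filter_upwards [hη.eventually_mem_source ht hp] with s hs
  have h1 : chartFrame η E (η t) s * S.frameCurv η E s =
      (S.sprayChart (η t)).R (chartLift n η (η t) s) * chartFrame η E (η t) s := by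
    ext1 y
    refine Eq.trans ?_ (hη.curvOp_chart hE hs.1 hs.2 y).symm
    exact congrArg (coordMap (η t) (η s)) (frame_frameCurv (hu s hs.1) y)
  have h2 := Ring.inverse_mul_cancel_left _ (S.frameCurv η E s) (hunit s hs.1 hs.2)
  rw [h1] at h2
  exact h2.symm

lemma frameCurv_symm (hη : S.IsGeodesic I η) (hE : ∀ t ∈ I, S.ParallelAt η E t)
    (hEg : ∀ t ∈ I, ∀ y z,
      fibreHess S.L (η t) (velocity n η t) (E t y) (E t z) = mink n y z) (ht : t ∈ I)
    (y z : Model n) : mink n (S.frameCurv η E t y) z = mink n y (S.frameCurv η E t z) := by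
  have hu := isUnit_of_orthonormal hEg ht
  rw [← hEg t ht, ← hEg t ht, frame_frameCurv hu, frame_frameCurv hu]
  exact hη.curvOp_symm hE ht y z

lemma trace_frameCurv (hη : S.IsGeodesic I η) (ht : t ∈ I) (hu : IsUnit (E t)) :
    LinearMap.trace ℝ (Model n) (S.frameCurv η E t : Model n →ₗ[ℝ] Model n) =
      S.ricci (lift n η t) := by
  rw [hη.ricci_eq ht]
  have h : (S.frameCurv η E t : Model n →ₗ[ℝ] Model n) =
      ((Ring.inverse (E t) : Model n →L[ℝ] Model n) : Model n →ₗ[ℝ] Model n) *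
        ((S.curvOp η t : Model n →ₗ[ℝ] Model n) * (E t : Model n →ₗ[ℝ] Model n)) := rfl
  rw [h, LinearMap.trace_mul_comm, mul_assoc]
  have h1 : (E t : Model n →ₗ[ℝ] Model n) * ((Ring.inverse (E t) : Model n →L[ℝ] Model n) : Model n →ₗ[ℝ] Model n) = 1 :=
    congrArg (fun f : Model n →L[ℝ] Model n => (f : Model n →ₗ[ℝ] Model n))
      (Ring.mul_inverse_cancel _ hu)
  rw [h1, mul_one]

/-- A solution of the Jacobi equation in the frame `E` gives a Jacobi field. -/
lemma isJacobiField (hη : S.IsGeodesic I η) (hE : ∀ t ∈ I, S.ParallelAt η E t)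
    (hu : ∀ t ∈ I, IsUnit (E t)) {y y₁ : ℝ → Model n} (hy : ∀ t ∈ I, HasDerivAt y (y₁ t) t)
    (hy₁ : ∀ t ∈ I, HasDerivAt y₁ (-(S.frameCurv η E t (y t))) t) :
    S.IsJacobiField I η fun t => E t (y t) := by
  have hys : ContDiffOn ℝ ∞ (fun t => (y t, y₁ t)) I :=
    contDiffOn_of_linearODE hη.interval.1
      (contDiffOn_secondOrderSystem (hη.contDiffOn_frameCurv hE hu).neg) fun r hr =>
        hasDerivAt_secondOrderSystem (hy r hr) (hy₁ r hr)
  refine ⟨fun t ht => ?_, fun t ht => ?_⟩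
  · have hp := mem_chart_source (Model n) (η t)
    refine (hη.contMDiffAt_of_coordMap ht hp ?_).contMDiffWithinAt
    have h1 : ContDiffAt ℝ ∞ y t := (hys.contDiffAt (hη.interval.1.mem_nhds ht)).fst
    exact (hη.contDiffAt_chartFrame hE ht hp).clm_apply h1
  · have h1 : ∀ s ∈ I, S.covDeriv η (fun t => E t (y t)) s = E s (y₁ s) := fun s hs =>
      hη.covDeriv_eq hE hs (Eventually.of_forall fun _ => rfl) (hy s hs)
    have h2 : S.covDeriv η (S.covDeriv η fun t => E t (y t)) t =
        E t (-(S.frameCurv η E t (y t))) := by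
      refine hη.covDeriv_eq hE ht ?_ (hy₁ t ht)
      filter_upwards [hη.interval.1.mem_nhds ht] with s hs
      exact h1 s hs
    have h3 : S.curvature (η t) (velocity n η t) (E t (y t)) = E t (S.frameCurv η E t (y t)) :=
      (hη.curvature_eq ht _).trans (frame_frameCurv (hu t ht) _).symm
    refine (congrArg₂ (· + ·) h2 h3).trans ?_
    exact (congrArg (· + E t (S.frameCurv η E t (y t))) (map_neg (E t) _)).trans
      (neg_add_cancel (G := Model n) _)

/-- Without conjugate points along the geodesic, the Jacobi equation in the frame has no conjugate
points. -/
lemma noConjugate_frameCurv (hη : S.IsGeodesic I η) (hE : ∀ t ∈ I, S.ParallelAt η E t)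
    (hu : ∀ t ∈ I, IsUnit (E t)) (hconj : ¬ S.HasConjugatePair I η) :
    NoConjugate (S.frameCurv η E) I := by
  intro y y₁ hy hy₁ s hs t ht hst hys hyt r hr
  by_contra hne
  refine hconj ⟨fun t => E t (y t), hη.isJacobiField hE hu hy hy₁, ⟨r, hr, fun h => hne ?_⟩,
    s, hs, t, ht, hst, ?_, ?_⟩
  · exact (ContinuousLinearMap.isUnit_iff_bijective.1 (hu r hr)).1
      (Eq.trans h (map_zero (E r)).symm)
  · exact (congrArg (E s) hys).trans (map_zero _)
  · exact (congrArg (E t) hyt).trans (map_zero _)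

end LorentzFinsler.IsGeodesic

end Reduction

/-! ### Lightlike geodesics of a weighted spacetime -/

section Weighted

open LagrangeChart SprayChart

variable {n : ℕ} {M : Type*} [TopologicalSpace M] [ChartedSpace (Model n) M]

lemma lift_comp_add_const {η : ℝ → M} {a s : ℝ}
    (hd : MDifferentiableAt 𝓘(ℝ, ℝ) 𝓘(ℝ, Model n) η (s + a)) :
    lift n (fun r => η (r + a)) s = lift n η (s + a) := by
  have hd' : MDifferentiableAt 𝓘(ℝ, ℝ) 𝓘(ℝ, Model n) (fun r => η (r + a)) s := by
    have h : MDifferentiableAt 𝓘(ℝ, ℝ) 𝓘(ℝ, ℝ) (fun r : ℝ => r + a) s :=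
      (differentiableAt_id.add_const a).mdifferentiableAt
    exact MDifferentiableAt.comp s hd h
  have h1 : velocity n (fun r => η (r + a)) s = velocity n η (s + a) :=
    (velocity_eq_deriv hd').trans
      ((deriv_comp_add_const (f := fun r => chartAt (Model n) (η (s + a)) (η r)) a s).trans
        (velocity_eq_deriv hd).symm)
  exact congrArg (fun v : Model n => (⟨η (s + a), v⟩ : TM n M)) h1

variable [IsManifold 𝓘(ℝ, Model n) ∞ M] {I : Set ℝ} {η : ℝ → M} {t : ℝ} {N : WithTop ℝ} {ε : ℝ}

/-- Euler's relation `g_u(u,u) = 2 L(u)`. -/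
lemma LorentzFinsler.fibreHess_self (S : LorentzFinsler n M) {m : M} {u : Model n} (hu : u ≠ 0) :
    fibreHess S.L m u u u = 2 * S.L ⟨m, u⟩ := by
  have hm := mem_chart_source (Model n) m
  rw [S.fibreHess_eq_ℓ₂ hm hu]
  have hW := S.bundleChart_mem_W hm hu
  have h1 := LagrangeChart.g_v (C := (S.sprayChart m).toLagrangeChart) hW (coordMap m m u)
  have h2 := (S.sprayChart m).euler _ hW
  exact h1.trans (h2.trans (congrArg (2 * ·) (S.localL_bundleChart (w := ⟨m, u⟩) hm)))

lemma FinslerSpacetime.IsCausalGeodesic.isGeodesic {S : FinslerSpacetime n M}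
    (hη : S.IsCausalGeodesic I η) : S.toLorentzFinsler.IsGeodesic I η where
  interval := hη.interval
  smooth := hη.smooth
  velocity_ne_zero := fun t ht => (connectedComponentIn_subset _ _ (hη.future t ht)).2
  geodesic := hη.geodesic

/-- Causal geodesics can be reparametrized by translations. -/
lemma FinslerSpacetime.IsCausalGeodesic.translate {S : FinslerSpacetime n M}
    (hη : S.IsCausalGeodesic I η) {J : Set ℝ} (hJ : IsOpenInterval J) {a : ℝ}
    (hJI : ∀ s ∈ J, s + a ∈ I) : S.IsCausalGeodesic J fun s => η (s + a) where
  interval := hJ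
  smooth := by
    have h : ContMDiffOn 𝓘(ℝ, ℝ) 𝓘(ℝ, ℝ) ∞ (fun s : ℝ => s + a) J :=
      (contDiff_id.add contDiff_const).contMDiff.contMDiffOn
    exact hη.smooth.comp h hJI
  future := fun s hs => by
    rw [lift_comp_add_const
      ((hη.isGeodesic.contMDiffAt (hJI s hs)).mdifferentiableAt ne_zero_infty)]
    exact hη.future _ (hJI s hs)
  geodesic := fun s hs p hp => by
    have h := hη.geodesic (s + a) (hJI s hs) p hp
    have e : deriv (fun s => chartAt (Model n) p (η (s + a))) =
        fun s => deriv (fun s => chartAt (Model n) p (η s)) (s + a) :=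
      funext fun s => deriv_comp_add_const (f := fun s => chartAt (Model n) p (η s)) a s
    simp only at h ⊢
    rw [e, deriv_comp_add_const (f := deriv fun s => chartAt (Model n) p (η s))]
    exact h

variable {S : WeightedSpacetime n M}

lemma contDiffOn_ψAlong (hη : S.IsCausalGeodesic I η) : ContDiffOn ℝ ∞ (S.ψAlong η) I :=
  contMDiffOn_iff_contDiffOn.1 (S.ψ_smooth.comp
    (fun _ ht => (hη.isGeodesic.contMDiffAt_lift ht).contMDiffWithinAt) hη.future)

/-- The convergence condition, evaluated at an arbitrary parameter of a lightlike geodesic. -/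
lemma ricciN_nonneg (hconv : S.NullConvergence N) (hη : S.IsLightlikeGeodesic I η) (ht : t ∈ I) :
    0 ≤ S.ricciN N η t := by
  obtain ⟨δ, hδ, h⟩ := Metric.isOpen_iff.1 hη.interval.1 t ht
  have hJI : ∀ s ∈ Ioo (-δ) δ, s + t ∈ I := fun s hs => h (by
    rw [Real.ball_eq_Ioo]
    constructor <;> linarith [hs.1, hs.2])
  have hJ : IsOpenInterval (Ioo (-δ) δ) :=
    ⟨isOpen_Ioo, ordConnected_Ioo, ⟨0, by constructor <;> linarith⟩⟩
  have h0 : (0 : ℝ) ∈ Ioo (-δ) δ := by constructor <;> linarith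
  have hl : ∀ s ∈ Ioo (-δ) δ, lift n (fun r => η (r + t)) s = lift n η (s + t) := fun s hs =>
    lift_comp_add_const
      ((hη.isGeodesic.contMDiffAt (hJI s hs)).mdifferentiableAt ne_zero_infty)
  have h1 := hconv (lift n η t) (hη.future t ht) (hη.lightlike t ht) δ hδ _
    (hη.toIsCausalGeodesic.translate hJ hJI) (by simpa using hl 0 h0)
  have h2 : S.ψAlong (fun r => η (r + t)) =ᶠ[𝓝 0] fun s => S.ψAlong η (s + t) := by
    filter_upwards [isOpen_Ioo.mem_nhds h0] with s hs
    exact congrArg S.ψ (hl s hs)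
  have h3 : deriv (fun s => S.ψAlong η (s + t)) = fun s => deriv (S.ψAlong η) (s + t) :=
    funext fun s => deriv_comp_add_const (f := S.ψAlong η) t s
  have h4 : deriv (S.ψAlong fun r => η (r + t)) 0 = deriv (S.ψAlong η) t := by
    rw [h2.deriv_eq, h3]
    exact congrArg (deriv (S.ψAlong η)) (zero_add t)
  have h5 : deriv (deriv (S.ψAlong fun r => η (r + t))) 0 = deriv (deriv (S.ψAlong η)) t := by
    rw [h2.deriv.deriv_eq, h3, deriv_comp_add_const (f := deriv (S.ψAlong η)), zero_add]
  have h6 : lift n (fun r => η (r + t)) 0 = lift n η t := by simpa using hl 0 h0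
  have e : S.ricciN N (fun r => η (r + t)) 0 = S.ricciN N η t := by
    unfold WeightedSpacetime.ricciN
    rw [h4, h5, h6]
  rwa [e] at h1

/-- In the null range of `ε`, the weighted Ricci curvature bound has the form
`Ric + ψ'' - k (ψ')² ≥ 0` with a constant `k` satisfying `(1 - ε²)/(n - 1) + k > 0`. -/
lemma exists_ricci_bound (hn : 2 ≤ n)
    (hN : N < ((1 : ℝ) : WithTop ℝ) ∨ ((n : ℝ) : WithTop ℝ) ≤ N) (hε : NullRange n N ε)
    (hric : ∀ t ∈ I, 0 ≤ S.ricciN N η t) :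
    ∃ k : ℝ, 0 < (1 - ε ^ 2) / ((n : ℝ) - 1) + k ∧ ∀ t ∈ I,
      0 ≤ S.ricci (lift n η t) + deriv (deriv (S.ψAlong η)) t - k * deriv (S.ψAlong η) t ^ 2 := by
  have hn2 : (2 : ℝ) ≤ n := by exact_mod_cast hn
  have hm : 0 < (n : ℝ) - 1 := by linarith
  induction N using WithTop.recTopCoe with
  | top =>
    refine ⟨0, ?_, fun t ht => ?_⟩
    · have h1 : ε ^ 2 < 1 := (sq_lt_one_iff_abs_lt_one ε).2 hε
      have : 0 < (1 - ε ^ 2) / ((n : ℝ) - 1) := div_pos (by linarith) hm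
      linarith
    · have h := EReal.coe_nonneg.1 (hric t ht)
      simpa using h
  | coe r =>
    have hr1 : r ≠ 1 := by
      rintro rfl
      rcases hN with h | h
      · exact lt_irrefl _ h
      · have := WithTop.coe_le_coe.1 h
        linarith
    by_cases hrn : r = n
    · -- Here `ψ' = 0` along the geodesic, so any sufficiently large `k` will do.
      refine ⟨ε ^ 2 / ((n : ℝ) - 1), ?_, fun t ht => ?_⟩
      · rw [← add_div, sub_add_cancel]
        positivity
      · have h := hric t ht
        simp only [WeightedSpacetime.ricciN, if_pos hrn] at h
        split_ifs at h with h0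
        · rw [h0]
          have := EReal.coe_nonneg.1 h
          simpa using this
        · exact absurd h (by simp)
    · refine ⟨1 / (r - n), ?_, fun t ht => ?_⟩
      · have hε' : |ε| < Real.sqrt ((r - 1) / (r - n)) := by
          simpa only [NullRange, if_neg hr1, if_neg hrn] using hε
        have h1 : ε ^ 2 < (r - 1) / (r - n) := by
          rw [← sq_abs]
          exact (Real.lt_sqrt (abs_nonneg ε)).1 hε'
        have h2 : r - n ≠ 0 := sub_ne_zero.2 hrn
        have h3 : (1 - (r - 1) / (r - n)) / ((n : ℝ) - 1) + 1 / (r - n) = 0 := by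
          field_simp
          ring
        have h4 : (1 - (r - 1) / (r - n)) / ((n : ℝ) - 1) < (1 - ε ^ 2) / ((n : ℝ) - 1) :=
          div_lt_div_of_pos_right (by linarith) hm
        linarith
      · have h := hric t ht
        simp only [WeightedSpacetime.ricciN, if_neg hrn] at h
        have := EReal.coe_nonneg.1 h
        rwa [div_eq_inv_mul, ← one_div] at this

lemma hasDerivAt_τ (hη : S.IsCausalGeodesic I η) {t₀ : ℝ} (ht₀ : t₀ ∈ I) (ht : t ∈ I) :
    HasDerivAt (S.τ ε η t₀) (Real.exp (2 * (ε - 1) / ((n : ℝ) - 1) * S.ψAlong η t)) t := by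
  have hc : ContinuousOn (fun s => Real.exp (2 * (ε - 1) / ((n : ℝ) - 1) * S.ψAlong η s)) I :=
    Real.continuous_exp.comp_continuousOn
      (continuousOn_const.mul (contDiffOn_ψAlong hη).continuousOn)
  have hat : ContinuousAt _ t := hc.continuousAt (hη.interval.1.mem_nhds ht)
  exact intervalIntegral.integral_hasDerivAt_right
    ((hc.mono (hη.interval.2.1.uIcc_subset ht₀ ht)).intervalIntegrable)
    (hc.stronglyMeasurableAtFilter hη.interval.1 t ht) hat

/-- For an `ε`-complete geodesic, the parameter `τ_ε` takes all real values. -/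
lemma exists_τ_eq (hη : S.IsCausalGeodesic I η) (hε : S.EpsComplete ε I η) {t₀ : ℝ} (ht₀ : t₀ ∈ I)
    (T : ℝ) : ∃ t ∈ I, S.τ ε η t₀ t = T := by
  have : PreconnectedSpace I := Subtype.preconnectedSpace hη.interval.2.1.isPreconnected
  have : Nonempty I := ⟨⟨t₀, ht₀⟩⟩
  have hc : Continuous fun t : I => S.τ ε η t₀ t := by
    have h : ContinuousOn (S.τ ε η t₀) I := fun t ht =>
      (hasDerivAt_τ hη ht₀ ht).continuousAt.continuousWithinAt
    exact h.comp_continuous continuous_subtype_val fun t => t.2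
  obtain ⟨h1, h2⟩ := hε.2 t₀ ht₀
  obtain ⟨t, ht⟩ := mem_range_of_exists_le_of_exists_ge hc (h2.eventually_le_atBot T).exists
    (h1.eventually_ge_atTop T).exists
  exact ⟨t, t.2, ht⟩

/-- Along an `ε`-complete lightlike geodesic without conjugate points, null convergence forces the
curvature to be trivial on `η̇^⊥ / ℝ η̇`. -/
theorem not_nullGenericAlong (hn : 2 ≤ n)
    (hN : N < ((1 : ℝ) : WithTop ℝ) ∨ ((n : ℝ) : WithTop ℝ) ≤ N) (hconv : S.NullConvergence N)
    (hη : S.IsLightlikeGeodesic I η) (hconj : ¬ S.HasConjugatePair I η) (hε : NullRange n N ε)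
    (hcomplete : S.EpsComplete ε I η) : ¬ S.NullGenericAlong I η := by
  have hg := hη.isGeodesic
  obtain ⟨E, hE, hEg⟩ := hg.exists_orthonormal_frame
  have hu := fun t (ht : t ∈ I) => LorentzFinsler.IsGeodesic.isUnit_of_orthonormal hEg ht
  obtain ⟨v₀, hv₀⟩ := hg.exists_velocity_components hE hEg
  obtain ⟨t₀, ht₀⟩ := hη.interval.2.2
  obtain ⟨k, hk, hric⟩ := exists_ricci_bound hn hN hε
    fun t ht => ricciN_nonneg hconv hη ht
  have hRs := hg.contDiffOn_frameCurv hE hu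
  have hψ := contDiffOn_ψAlong hη.toIsCausalGeodesic
  have hψ₁ : ContDiffOn ℝ ∞ (deriv (S.ψAlong η)) I :=
    (contDiffOn_infty_iff_deriv_of_isOpen hη.interval.1).1 hψ |>.2
  have hψ₂ : ContDiffOn ℝ ∞ (deriv (deriv (S.ψAlong η))) I :=
    (contDiffOn_infty_iff_deriv_of_isOpen hη.interval.1).1 hψ₁ |>.2
  have hd : ∀ f : ℝ → ℝ, ContDiffOn ℝ ∞ f I → ∀ t ∈ I, HasDerivAt f (deriv f t) t :=
    fun f hf t ht => ((hf.contDiffAt (hη.interval.1.mem_nhds ht)).differentiableAt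
      ne_zero_infty).hasDerivAt
  have hinj := fun t (ht : t ∈ I) => (ContinuousLinearMap.isUnit_iff_bijective.1 (hu t ht)).1
  have hv0 : v₀ ≠ 0 := by
    rintro rfl
    exact hg.velocity_ne_zero t₀ ht₀ ((hv₀ t₀ ht₀).symm.trans (map_zero (E t₀)))
  have hvv : mink n v₀ v₀ = 0 := by
    rw [← hEg t₀ ht₀, hv₀ t₀ ht₀]
    refine (S.fibreHess_self (hg.velocity_ne_zero t₀ ht₀)).trans ?_
    exact (congrArg (2 * ·) (hη.lightlike t₀ ht₀)).trans (mul_zero 2)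
  have hRv : ∀ t ∈ I, S.frameCurv η E t v₀ = 0 :=
    fun t ht => hinj t ht (by
      rw [LorentzFinsler.IsGeodesic.frame_frameCurv (hu t ht), hv₀ t ht, map_zero]
      exact hg.curvOp_velocity ht)
  have key := curvature_mem_span_of_complete hn hη.interval hRs.continuousOn
    (fun t ht => hg.frameCurv_symm hE hEg ht) hv0 hvv hRv
    (hg.noConjugate_frameCurv hE hu hconj) (hd _ hψ) (hd _ hψ₁) hψ₂.continuousOn hk
    (fun t ht => by
      rw [hg.trace_frameCurv ht (hu t ht)]
      exact hric t ht)
    (fun t ht => hasDerivAt_τ hη.toIsCausalGeodesic ht₀ ht)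
    (exists_τ_eq hη.toIsCausalGeodesic hcomplete ht₀)
  rintro ⟨t, ht, w, hw, hcurv⟩
  obtain ⟨x, hx⟩ := (ContinuousLinearMap.isUnit_iff_bijective.1 (hu t ht)).2 w
  refine hcurv ?_
  have h1 : mink n v₀ x = 0 := by
    rw [← hEg t ht, hv₀ t ht, hx]
    exact hw
  obtain ⟨c, hc⟩ := Submodule.mem_span_singleton.1 (key t ht x h1)
  refine Submodule.mem_span_singleton.2 ⟨c, ?_⟩
  refine Eq.trans ?_ (hg.curvature_eq ht w).symm
  have h2 := LorentzFinsler.IsGeodesic.frame_frameCurv (S := S.toLorentzFinsler) (η := η) (hu t ht) x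
  rw [← hc, map_smul, hv₀ t ht, hx] at h2
  exact h2

end Weighted

end FinslerST

end

theorem mainTheorem7 (n : ℕ) (hn : 3 ≤ n + 1)
    (M : Type*) [TopologicalSpace M] [T2Space M] [SecondCountableTopology M] [ConnectedSpace M]
    [ChartedSpace (FinslerST.Model n) M] [IsManifold 𝓘(ℝ, FinslerST.Model n) ∞ M]
    (S : FinslerST.WeightedSpacetime n M)
    (N : WithTop ℝ) (hN : N < ((1 : ℝ) : WithTop ℝ) ∨ ((n : ℝ) : WithTop ℝ) ≤ N)
    (hgen : S.NullGenericity) (hconv : S.NullConvergence N)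
    (I : Set ℝ) (η : ℝ → M) (hη : S.IsLightlikeGeodesic I η) :
    S.HasConjugatePair I η ∨ ∀ ε : ℝ, FinslerST.NullRange n N ε → ¬ S.EpsComplete ε I η := by
  refine or_iff_not_imp_left.2 fun hconj ε hε hcomplete => ?_
  exact FinslerST.not_nullGenericAlong (by omega) hN hconv hη hconj hε hcomplete
    (hgen I η hη hcomplete.1)
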